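/- **Definitions.** Let $q\ge 2$ and $\Sigma_q=\{0,\dots,q-1\}$. A period of $\mathbf s\in\Sigma_q^m$ is an integer $1\le p'\le m-1$ with $s_i=s_{i+p'}$ for all $1\le i\le m-p'$. $A_q(m,\ell,p)$ is the set of $\mathbf s\in\Sigma_q^m$ such that no window of $\ell$ consecutive symbols of $\mathbf s$ has a period $p'<p$; an $(\ell,p)$-LPA code of length $m$ is a subset of $A_q(m,\ell,p)$. The *core encoder* with window size $w\ge p+1$ maps $\mathbf x\in\Sigma_q^N$ to a word of length $N+1$: start with $\mathbf y=\mathbf x1$ and, as long as $\mathbf y\notin A_q(N+1,w,p)$, replace $\mathbf y$ by $\mathrm{Repair}(\mathbf y)$. Here, if $i$ is the zero-based index of the first length-$w$ window of $\mathbf y$ that has a period less than $p$, and $p'$ is the least period of that window, then $\mathrm{Repair}$ appends to $\mathbf y$ the first $p'$ symbols of the window, a $1$, $p-p'-1$ zeros, the base-$q$ representation of $i$ with $w-p-1$ symbols (most significant first) and a $0$, and removes the window at index $i$. **Statement.** Let $n,\ell,p$ be integers with $p\ge 1$ and $\ell\ge 2(p+1)$, and write $h=\lceil \ell/2\rceil$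 (so $h=\ell/2$ for even $\ell$). Let $k$ be the smallest positive integer such that $\frac nk-h+2>0$ and $$\ell\ \ge\ 2\left(\left\lceil\log_q\left(\tfrac nk-h+2\right)\right\rceil+p+1\right),$$ assuming that such an integer exists. Split a message $\mathbf x\in\Sigma_q^n$ into $k$ consecutive segments of length $\lceil n/k\rceil$ (the last one may be shorter), encode each segment with the core encoder with window size $h$, and let $\mathrm{Enc}(\mathbf x)$ be the concatenation of the results. Then the core encoder terminates on every segment of every message, $\mathrm{Enc}(\mathbf x)\in A_q(n+k,\ell,p)$ for all $\mathbf x\in\Sigma_q^n$, and $\mathrm{Enc}$ is injective. So the codewords form an $(\ell,p)$-LPA code with $k$ redundancy symbols. Moreover, encoding and decoding take $O(n)$ time on average: there are two fixed programs for the word RAM (unit-cost addition, truncated subtraction, multiplication, division and remainder of words, memory access and tests; words hold the integers below $(n+q)^c$ for a fixed constant $c$) and, for every $q\ge2$, a constant $C$ depending only on $q$, such that for all $n,\ell,p$ as above, given the parameters $(q,n,\ell,p)$, the first program computes $\mathrm{Enc}(\mathbf x)$ from $\mathbf x$, the second computes $\mathbf x$ from $\mathrm{Enc}(\mathbf x)$,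 for every $\mathbf x\in\Sigma_q^n$, and the average number of steps of each, over uniformly distributed $\mathbf x\in\Sigma_q^n$, is at most $Cn$. -/

import Mathlib

namespace PeriodAvoiding

/-! ### Period-avoiding words -/

/-- The window of length `w` of the word `s` that starts at the (zero-based) index `i`. -/
def window {α : Type*} (s : List α) (i w : ℕ) : List α := (s.drop i).take w

/-- `p` is a period of the word `s = s₁ … sₙ`: `1 ≤ p ≤ n - 1` and `sᵢ = sᵢ₊ₚ` for `1 ≤ i ≤ n - p`. -/
def IsPeriod {α : Type*} (s : List α) (p : ℕ) : Prop :=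
  1 ≤ p ∧ p < s.length ∧ s.HasPeriod p

/-- `s` is `ℓ`-window `p`-period avoiding: no window of length `ℓ` has the period `p`. -/
def IsPA {α : Type*} (ℓ p : ℕ) (s : List α) : Prop :=
  ∀ i, i + ℓ ≤ s.length → ¬ IsPeriod (window s i ℓ) p

/-- `s` is `ℓ`-window `p`-least-period avoiding: it is `ℓ`-window `p'`-period avoiding for all
`p' < p`. -/
def IsLPA {α : Type*} (ℓ p : ℕ) (s : List α) : Prop :=
  ∀ p' < p, IsPA ℓ p' s

/-- The set `A_q(n, ℓ, p)`. -/
def lpaWords (q n ℓ p : ℕ) : Set (List (Fin q)) :=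
  {s | s.length = n ∧ IsLPA ℓ p s}

/-! ### The core construction with window size `w` -/

section Core

variable {q : ℕ} [NeZero q]

/-- The representation of `i` in base `q` with `d` symbols, most significant symbol first. -/
def digits (q : ℕ) [NeZero q] (d i : ℕ) : List (Fin q) :=
  List.ofFn fun j : Fin d => Fin.ofNat q (i / q ^ (d - 1 - (j : ℕ)))

/-- The index of the first window of length `w` that has a period `p' < p`. -/
noncomputable def badIndex (w p : ℕ) (y : List (Fin q)) : ℕ :=
  sInf {i | i + w ≤ y.length ∧ ∃ p' < p, IsPeriod (window y i w) p'}

/-- The least period of the window at `badIndex`. -/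
noncomputable def badPeriod (w p : ℕ) (y : List (Fin q)) : ℕ :=
  sInf {p' | IsPeriod (window y (badIndex w p y) w) p'}

/-- One repair step on a word that is not least-period avoiding. With `i` the index of the first
invalid window and `p'` its period, append the kernel (the `p'` symbols from index `i` on), a one,
`p - p' - 1` zeros, the index `i` written with `w - p - 1` symbols, and a zero, and remove the
window at index `i`. Exactly `w` symbols are appended and `w` symbols are removed. -/
noncomputable def repair (w p : ℕ) (y : List (Fin q)) : List (Fin q) :=
  let i := badIndex w p y
  let p' := badPeriod w p y
  let z := y ++ (window y i p' ++ 1 :: List.replicate (p - p' - 1) 0) ++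
    digits q (w - p - 1) i ++ [0]
  z.take i ++ z.drop (i + w)

/-- The state of the core encoder on input `x` after `t` iterations of its loop: it starts with
`x` followed by the redundancy symbol one. -/
noncomputable def coreState (w p : ℕ) (x : List (Fin q)) (t : ℕ) : List (Fin q) :=
  (repair w p)^[t] (x ++ [1])

/-- The loop "while `y` is not least-period avoiding, repair `y`" ends on input `x`. -/
def CoreTerminates (w p : ℕ) (x : List (Fin q)) : Prop :=
  ∃ t, IsLPA w p (coreState w p x t)

/-- The output of the core encoder: the first state that is least-period avoiding. -/
noncomputable def coreEncode (w p : ℕ) (x : List (Fin q)) : List (Fin q) :=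
  coreState w p x (sInf {t | IsLPA w p (coreState w p x t)})

end Core

/-! ### The segmented construction -/

/-- Half of the window size, rounded up when `ℓ` is odd. -/
def half (ℓ : ℕ) : ℕ := (ℓ + 1) / 2

/-- `k` is the smallest positive integer with `ℓ ≥ 2 (⌈log_q (n/k - ℓ/2 + 2)⌉ + p + 1)`,
where the logarithm has to be that of a positive number. -/
def IsSegmentCount (q n ℓ p k : ℕ) : Prop :=
  IsLeast {k : ℕ | 1 ≤ k ∧ 0 < (n : ℝ) / k - half ℓ + 2 ∧
    2 * (⌈Real.logb q ((n : ℝ) / k - half ℓ + 2)⌉ + p + 1) ≤ (ℓ : ℤ)} k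

/-- The partition of `x` into `k` consecutive segments of length `⌈|x| / k⌉`, where the last one
may be shorter. -/
def segments {α : Type*} (k : ℕ) (x : List α) : List (List α) :=
  let N := (x.length + k - 1) / k
  (List.range k).map fun j => window x (j * N) N

/-- Encode the `k` segments one by one by the core construction with window size `ℓ / 2`, and
concatenate the results. -/
noncomputable def encode {q : ℕ} [NeZero q] (ℓ p k : ℕ) (x : List (Fin q)) : List (Fin q) :=
  (segments k x).flatMap (coreEncode (half ℓ) p)

/-! ### Word RAM with a step count -/

/-- The arithmetic operations of the machine: truncated subtraction, division rounded down,
`a / 0 = 0`, `a % 0 = a`. -/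
inductive ArithOp
  | add | sub | mul | div | mod

/-- The value of an arithmetic operation. -/
def ArithOp.eval : ArithOp → ℕ → ℕ → ℕ
  | add, a, b => a + b
  | sub, a, b => a - b
  | mul, a, b => a * b
  | div, a, b => a / b
  | mod, a, b => a % b

/-- Structured programs of a random access machine. The natural numbers in it name registers,
apart from the constant `c` in `const r c`. -/
inductive Program
  /-- Do nothing. -/
  | skip
  /-- `r := c` -/
  | const (r c : ℕ)
  /-- `r := a op b` -/
  | arith (op : ArithOp) (r a b : ℕ)
  /-- `r := mem[a]` -/
  | load (r a : ℕ)
  /-- `mem[a] := b` -/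
  | store (a b : ℕ)
  /-- First `P`, then `Q`. -/
  | seq (P Q : Program)
  /-- If register `r` is nonzero then `P` else `Q`. -/
  | ite (r : ℕ) (P Q : Program)
  /-- While register `r` is nonzero do `P`. -/
  | loop (r : ℕ) (P : Program)

/-- A machine state: registers and random access memory. -/
structure State where
  /-- The contents of the registers. -/
  reg : ℕ → ℕ
  /-- The contents of the memory cells. -/
  mem : ℕ → ℕ

/-- Write `v` into register `r`. -/
def State.setReg (s : State) (r v : ℕ) : State := { s with reg := Function.update s.reg r v }

/-- Write `v` into memory cell `a`. -/
def State.setMem (s : State) (a v : ℕ) : State := { s with mem := Function.update s.mem a v }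

/-- `Exec B P s t s'`: on a machine whose words hold the numbers below `B`, the program `P`,
started in state `s`, halts after exactly `t` steps in state `s'`. Each instruction and each test
of a register costs one step. A computed value that does not fit into a word, or an address that
is not a word, has no transition. -/
inductive Exec (B : ℕ) : Program → State → ℕ → State → Prop
  | skip (s : State) : Exec B .skip s 1 s
  | const (s : State) (r c : ℕ) (h : c < B) : Exec B (.const r c) s 1 (s.setReg r c)
  | arith (s : State) (op : ArithOp) (r a b : ℕ) (h : op.eval (s.reg a) (s.reg b) < B) :
      Exec B (.arith op r a b) s 1 (s.setReg r (op.eval (s.reg a) (s.reg b)))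
  | load (s : State) (r a : ℕ) (h : s.reg a < B) :
      Exec B (.load r a) s 1 (s.setReg r (s.mem (s.reg a)))
  | store (s : State) (a b : ℕ) (h : s.reg a < B) :
      Exec B (.store a b) s 1 (s.setMem (s.reg a) (s.reg b))
  | seq {P Q : Program} {s s₁ s₂ : State} {t₁ t₂ : ℕ}
      (h₁ : Exec B P s t₁ s₁) (h₂ : Exec B Q s₁ t₂ s₂) : Exec B (.seq P Q) s (t₁ + t₂) s₂
  | ite_true {r : ℕ} {P Q : Program} {s s' : State} {t : ℕ}
      (h : s.reg r ≠ 0) (hP : Exec B P s t s') : Exec B (.ite r P Q) s (t + 1) s'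
  | ite_false {r : ℕ} {P Q : Program} {s s' : State} {t : ℕ}
      (h : s.reg r = 0) (hQ : Exec B Q s t s') : Exec B (.ite r P Q) s (t + 1) s'
  | loop_true {r : ℕ} {P : Program} {s s₁ s₂ : State} {t₁ t₂ : ℕ}
      (h : s.reg r ≠ 0) (h₁ : Exec B P s t₁ s₁) (h₂ : Exec B (.loop r P) s₁ t₂ s₂) :
      Exec B (.loop r P) s (t₁ + t₂ + 1) s₂
  | loop_false {r : ℕ} {P : Program} {s : State} (h : s.reg r = 0) :
      Exec B (.loop r P) s 1 s

/-- The start state: the registers `0, 1, …` hold the parameters, the memory cells `0, 1, …` hold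
the symbols of the input word, and everything else is zero. -/
def State.start {q : ℕ} (params : List ℕ) (input : List (Fin q)) : State where
  reg r := params.getD r 0
  mem i := (input.map Fin.val).getD i 0

/-- The word `w` stands in the memory cells `0, 1, …`, and its length stands in register `0`. -/
def State.Holds {q : ℕ} (s : State) (w : List (Fin q)) : Prop :=
  s.reg 0 = w.length ∧ ∀ (i : ℕ) (hi : i < w.length), s.mem i = (w[i] : ℕ)

/-- With words below `B`, the program `P` turns `input` into `output` in exactly `t` steps. -/
def Program.Computes {q : ℕ} (P : Program) (B : ℕ) (params : List ℕ)
    (input : List (Fin q)) (t : ℕ) (output : List (Fin q)) : Prop :=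
  ∃ s, Exec B P (State.start params input) t s ∧ s.Holds output

end PeriodAvoiding

/-! A repair step is reversible. The appended block has the fixed length `w`, so its fields can be
located. The marker one is the last nonzero symbol of the first `p` symbols of the block, which
gives the period `p'` and the kernel, and a window with period `p'` is determined by its first `p'`
symbols. The index fits into its field because a segment of length at most `N` leads to at most `N +
2 - w ≤ q ^ (w - p - 1)` windows; the choice of `k` ensures this inequality. This is
`repair_injective`.

The start word ends in one and every repaired word ends in zero. Following repairs backwards, the
states of the core encoder on all messages of a fixed length are therefore pairwise distinct
(`coreState_inj`). This has three consequences. No run is infinite. Undoing repairs until the word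
ends in one decodes. And for every cost `F`, the sum of `F` over all states of all runs is at most
its sum over all words of length `N + 1` (`sum_coreState_le`): there are on average at most `q`
states per message, and the average cost of a run is at most `q` times that of one round on a
uniform word.

A window of length `ℓ ≥ 2h - 1` in the concatenation contains `h` consecutive symbols of a single
codeword, and these would inherit a small period (`isPA_flatten`).

It remains to make one round linear on average. Testing all periods of all windows separately is too
slow. Instead choose `g` with `q ^ g` at least the number of windows, but at most `q * N`. The
search scans from right to left and keeps, for each code of a factor of length `g`, the linked list
of its positions. The window at `i` is compared only with its shifts to positions `i + p'` in its
own list, from symbol `g` on. A random word agrees with its shift on `T` given symbols with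
probability at most `q ^ (-T)`; summing over `T ≥ g`, over fewer than `p` periods and over at most
`q ^ g` windows gives at most `2p` expected comparisons (`sum_matchCost_le`). Clearing the table and
moving words costs a number of steps linear in `q ^ g + N`.

The programs are verified through `Halts`, which carries a step bound along with the final state.
The bounds are then summed over the segments, using `k * N < 2 * n`. -/

set_option linter.unusedSectionVars false

namespace PeriodAvoiding

/-! ### Windows with a period -/

section Windows

variable {α : Type*}

/-- The window of length `w` at index `i` of `y` has the period `p`, in terms of indices. -/
def WinPeriod (w : ℕ) (y : List α) (i p : ℕ) : Prop :=
  1 ≤ p ∧ p < w ∧ ∀ t < w - p, y[i + t]? = y[i + p + t]?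

theorem isPeriod_window_iff {w : ℕ} {y : List α} {i p : ℕ} (h : i + w ≤ y.length) :
    IsPeriod (window y i w) p ↔ WinPeriod w y i p := by
  have hl : (window y i w).length = w := by
    simp only [window, List.length_take, List.length_drop]; omega
  unfold IsPeriod WinPeriod
  rw [List.hasPeriod_iff_getElem?, hl]
  refine and_congr_right fun h1 => and_congr_right fun h2 => forall₂_congr fun t ht => ?_
  simp only [window, List.getElem?_take, List.getElem?_drop]
  rw [if_pos (by omega), if_pos (by omega), show i + p + t = i + (t + p) by omega]

theorem isPA_iff {w p : ℕ} {y : List α} :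
    IsPA w p y ↔ ∀ i, i + w ≤ y.length → ¬ WinPeriod w y i p :=
  forall₂_congr fun _ h => not_congr (isPeriod_window_iff h)

theorem WinPeriod.mono {w w' : ℕ} {y : List α} {i i' p : ℕ} (h : WinPeriod w y i p)
    (hi : i ≤ i') (hw : i' + w' ≤ i + w) (hp : p < w') : WinPeriod w' y i' p := by
  refine ⟨h.1, hp, fun t ht => ?_⟩
  have := h.2.2 (i' - i + t) (by omega)
  rwa [show i + (i' - i + t) = i' + t by omega,
    show i + p + (i' - i + t) = i' + p + t by omega] at this

theorem WinPeriod.of_append_left {w : ℕ} {a b : List α} {i p : ℕ}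
    (h : WinPeriod w (a ++ b) i p) (hi : i + w ≤ a.length) : WinPeriod w a i p := by
  refine ⟨h.1, h.2.1, fun t ht => ?_⟩
  have := h.2.2 t ht
  rwa [List.getElem?_append_left (by omega), List.getElem?_append_left (by omega)] at this

theorem WinPeriod.of_append_right {w : ℕ} {a b : List α} {i p : ℕ}
    (h : WinPeriod w (a ++ b) i p) (hi : a.length ≤ i) : WinPeriod w b (i - a.length) p := by
  refine ⟨h.1, h.2.1, fun t ht => ?_⟩
  have := h.2.2 t ht
  rwa [List.getElem?_append_right (by omega), List.getElem?_append_right (by omega),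
    show i + t - a.length = i - a.length + t by omega,
    show i + p + t - a.length = i - a.length + p + t by omega] at this

/-- Go back by `p` until the index lies among the first `p` symbols. This is why the kernel alone
recovers a removed window. -/
theorem WinPeriod.getElem?_mod {w : ℕ} {y : List α} {i p : ℕ} (h : WinPeriod w y i p) :
    ∀ t < w, y[i + t]? = y[i + t % p]? := by
  intro t
  induction t using Nat.strong_induction_on with
  | _ t ih =>
    intro ht
    obtain ⟨h1, h2, h3⟩ := h
    by_cases hp : t < p
    · rw [Nat.mod_eq_of_lt hp]
    · have e := h3 (t - p) (by omega)
      rw [show i + p + (t - p) = i + t by omega] at e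
      rw [← e, ih (t - p) (by omega) (by omega), ← Nat.mod_eq_sub_mod (by omega)]

/-- A concatenation of words that avoid a period in all windows of length `h`, all but the last of
length at least `h`, avoids it in all windows of length `2 h - 1`. -/
theorem isPA_flatten {h ℓ p : ℕ} (hp : p < h) (hl : 2 * h - 1 ≤ ℓ) (L : List (List α))
    (hlen : ∀ j, j + 1 < L.length → ∀ a ∈ L[j]?, h ≤ a.length) (hL : ∀ a ∈ L, IsPA h p a) :
    IsPA ℓ p L.flatten := by
  induction L with
  | nil =>
    rw [isPA_iff]
    intro i hi
    simp only [List.flatten_nil, List.length_nil] at hi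
    omega
  | cons a L ih =>
    have ih' := isPA_iff.1 (ih (fun j hj b hb => hlen (j + 1) (by simpa using hj) b (by simpa using hb))
      (fun b hb => hL b (List.mem_cons_of_mem _ hb)))
    rw [isPA_iff]
    intro i hi hper
    simp only [List.flatten_cons, List.length_append] at hi hper
    have ha := isPA_iff.1 (hL a (by simp))
    -- Either at least `h` symbols of the window lie in `a`, or it starts behind `a`, or at most `h
    -- - 1` of its symbols lie in `a` and hence at least `h` behind it, since `ℓ ≥ 2h - 1`.
    by_cases h1 : i + h ≤ a.length
    · exact ha i h1 ((hper.mono le_rfl (by omega) hp).of_append_left h1)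
    by_cases h2 : a.length ≤ i
    · exact ih' (i - a.length) (by omega) (hper.of_append_right h2)
    cases L with
    | nil => simp at hi; omega
    | cons b L =>
      have hb := isPA_iff.1 (hL b (by simp))
      by_cases h3 : h ≤ b.length
      · have h4 := (hper.mono (i' := a.length) (w' := h) (by omega) (by omega) hp).of_append_right
          le_rfl
        rw [List.flatten_cons, Nat.sub_self] at h4
        exact hb 0 (by omega) (h4.of_append_left (by omega))
      -- A word shorter than `h` can only be the last one, and then the window would not fit.
      · cases L with
        | nil => simp at hi; omega
        | cons c L => exact h3 (hlen 1 (by simp) b (by simp))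

end Windows

/-! ### Representations in base `q` -/

section Digits

variable {q : ℕ} [NeZero q]

theorem digits_length (d i : ℕ) : (digits q d i).length = d := by simp [digits]

theorem digits_succ (d i : ℕ) :
    digits q (d + 1) i = digits q d (i / q) ++ [Fin.ofNat q i] := by
  unfold digits
  rw [List.ofFn_succ']
  simp only [List.concat_eq_append, Fin.val_castSucc, Fin.val_last]
  congr 1
  · congr 1
    funext j
    have : d + 1 - 1 - (j : ℕ) = (d - 1 - j) + 1 := by omega
    rw [this, pow_succ', Nat.div_div_eq_div_mul]
  · simp

/-- The number represented by a word in base `q`. -/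
def value (l : List (Fin q)) : ℕ := l.foldl (fun a b => a * q + b) 0

theorem value_append_singleton (l : List (Fin q)) (b : Fin q) :
    value (l ++ [b]) = value l * q + b := by simp [value]

theorem value_digits (d i : ℕ) (h : i < q ^ d) : value (digits q d i) = i := by
  induction d generalizing i with
  | zero => simp at h; subst h; simp [digits, value]
  | succ d ih =>
    rw [digits_succ, value_append_singleton, ih _ (Nat.div_lt_of_lt_mul (by rwa [pow_succ'] at h))]
    simp only [Fin.ofNat]
    rw [mul_comm]
    exact Nat.div_add_mod i q

end Digits

/-! ### The repair step -/

section Repair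

variable {q : ℕ} [NeZero q] {w p : ℕ} {y : List (Fin q)}

theorem isLPA_iff {α : Type*} {w p : ℕ} {y : List α} :
    IsLPA w p y ↔ ∀ i, i + w ≤ y.length → ∀ p' < p, ¬ WinPeriod w y i p' := by
  unfold IsLPA
  simp only [isPA_iff]
  exact ⟨fun h i hi p' hp => h p' hp i hi, fun h p' hp i hi => h i hi p' hp⟩

/-- The index `i` and the period `p'` are those that the repair step uses on `y`. -/
structure IsFirstBad (w p : ℕ) (y : List (Fin q)) (i p' : ℕ) : Prop where
  le : i + w ≤ y.length
  lt : p' < p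
  period : WinPeriod w y i p'
  first : ∀ i' < i, ∀ p'' < p, ¬ WinPeriod w y i' p''
  least : ∀ p'' < p', ¬ WinPeriod w y i p''

/-- `IsFirstBad` is the form in which a search can certify the choices made by `repair`; here and in
`IsFirstBad.badPeriod_eq` it is matched with the infima in the definitions. -/
theorem IsFirstBad.badIndex_eq {i p' : ℕ} (h : IsFirstBad w p y i p') : badIndex w p y = i := by
  unfold badIndex
  apply le_antisymm
  · exact Nat.sInf_le ⟨h.le, p', h.lt, (isPeriod_window_iff h.le).2 h.period⟩
  · refine le_csInf ⟨i, h.le, p', h.lt, (isPeriod_window_iff h.le).2 h.period⟩ ?_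
    rintro j ⟨hj, p'', hp, hper⟩
    by_contra hlt
    exact h.first j (by omega) p'' hp ((isPeriod_window_iff hj).1 hper)

theorem IsFirstBad.badPeriod_eq {i p' : ℕ} (h : IsFirstBad w p y i p') :
    badPeriod w p y = p' := by
  unfold badPeriod
  rw [h.badIndex_eq]
  apply le_antisymm
  · exact Nat.sInf_le ((isPeriod_window_iff h.le).2 h.period)
  · refine le_csInf ⟨p', (isPeriod_window_iff h.le).2 h.period⟩ ?_
    intro p'' hper
    by_contra hlt
    exact h.least p'' (by omega) ((isPeriod_window_iff h.le).1 hper)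

theorem exists_isFirstBad (h : ¬ IsLPA w p y) : ∃ i p', IsFirstBad w p y i p' := by
  classical
  rw [isLPA_iff] at h
  push Not at h
  have h1 : ∃ i, i + w ≤ y.length ∧ ∃ p' < p, WinPeriod w y i p' := by
    obtain ⟨i, hi, p', hp, hper⟩ := h
    exact ⟨i, hi, p', hp, hper⟩
  obtain ⟨hi, h2⟩ := Nat.find_spec h1
  obtain ⟨hp, hper⟩ := Nat.find_spec h2
  refine ⟨Nat.find h1, Nat.find h2, hi, hp, hper, ?_, ?_⟩
  · intro i' hi' p'' hp'' hper'
    exact Nat.find_min h1 hi' ⟨by omega, p'', hp'', hper'⟩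
  · intro p'' hp'' hper'
    exact Nat.find_min h2 hp'' ⟨by omega, hper'⟩

theorem IsFirstBad.not_isLPA {i p' : ℕ} (h : IsFirstBad w p y i p') : ¬ IsLPA w p y :=
  fun h' => isLPA_iff.1 h' i h.le p' h.lt h.period

/-- The word of length `w` that a repair step appends. -/
def repairBlock (w p : ℕ) (y : List (Fin q)) (i p' : ℕ) : List (Fin q) :=
  (window y i p' ++ 1 :: List.replicate (p - p' - 1) 0) ++ digits q (w - p - 1) i ++ [0]

theorem window_length {α : Type*} {y : List α} {i w : ℕ} (h : i + w ≤ y.length) :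
    (window y i w).length = w := by
  simp only [window, List.length_take, List.length_drop]; omega

theorem IsFirstBad.kernel_length {i p' : ℕ} (h : IsFirstBad w p y i p') :
    (window y i p').length = p' :=
  window_length (by have := h.le; have := h.period.2.1; omega)

theorem IsFirstBad.repairBlock_length {i p' : ℕ} (h : IsFirstBad w p y i p') (hw : p + 1 ≤ w) :
    (repairBlock w p y i p').length = w := by
  have := h.lt
  simp only [repairBlock, List.length_append, h.kernel_length, List.length_cons,
    List.length_replicate, digits_length, List.length_nil]
  omega

theorem IsFirstBad.repair_eq {i p' : ℕ} (h : IsFirstBad w p y i p') :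
    repair w p y = (y ++ repairBlock w p y i p').take i ++
      (y ++ repairBlock w p y i p').drop (i + w) := by
  simp only [repair, h.badIndex_eq, h.badPeriod_eq, repairBlock, List.append_assoc]

/-- The block is appended behind the window, so cutting the window out leaves the block intact as a
suffix. -/
theorem IsFirstBad.repair_eq' {i p' : ℕ} (h : IsFirstBad w p y i p') :
    repair w p y = y.take i ++ y.drop (i + w) ++ repairBlock w p y i p' := by
  have := h.le
  rw [h.repair_eq, List.take_append_of_le_length (by omega), List.drop_append_of_le_length (by omega),
    List.append_assoc]

theorem IsFirstBad.repair_length {i p' : ℕ} (h : IsFirstBad w p y i p') (hw : p + 1 ≤ w) :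
    (repair w p y).length = y.length := by
  have := h.le
  rw [h.repair_eq']
  simp only [List.length_append, h.repairBlock_length hw, List.length_take, List.length_drop]
  omega

theorem repair_length (h : ¬ IsLPA w p y) (hw : p + 1 ≤ w) :
    (repair w p y).length = y.length := by
  obtain ⟨i, p', h⟩ := exists_isFirstBad h
  exact h.repair_length hw

/-- This zero distinguishes repaired words from start words, which end in one; the decoder stops on
this symbol. -/
theorem repair_getLast? (h : ¬ IsLPA w p y) : (repair w p y).getLast? = some 0 := by
  obtain ⟨i, p', h⟩ := exists_isFirstBad h
  rw [h.repair_eq', repairBlock, ← List.append_assoc, List.getLast?_concat]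

/-- The marker is the last symbol different from `b`. If one kernel were shorter, the position of
the other marker would hold `b` in the first word and `a` in the second. -/
theorem kernel_inj {α : Type*} {a b : α} (hab : a ≠ b) {k₁ k₂ : List α} {m₁ m₂ : ℕ}
    (h : k₁ ++ a :: List.replicate m₁ b = k₂ ++ a :: List.replicate m₂ b) : k₁ = k₂ := by
  have key : ∀ {k₁ k₂ : List α} {m₁ m₂ : ℕ},
      k₁ ++ a :: List.replicate m₁ b = k₂ ++ a :: List.replicate m₂ b →
      ¬ k₁.length < k₂.length := by
    intro k₁ k₂ m₁ m₂ h hlt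
    have e := congrArg (fun l => l[k₂.length]?) h
    rw [List.getElem?_append_right hlt.le, List.getElem?_append_right le_rfl, Nat.sub_self,
      List.getElem?_cons_zero, show k₂.length - k₁.length = (k₂.length - k₁.length - 1) + 1 by omega,
      List.getElem?_cons_succ, List.getElem?_replicate] at e
    split_ifs at e
    exact hab (Option.some.inj e).symm
  exact (List.append_inj h (by have := key h; have := key h.symm; omega)).1

theorem one_ne_zero_fin (hq : 2 ≤ q) : (1 : Fin q) ≠ 0 := by
  intro h
  have := congrArg Fin.val h
  rw [Fin.val_zero, Fin.val_one', Nat.mod_eq_of_lt (by omega)] at this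
  omega

/-- A repair step can be undone. -/
theorem repair_injective (hq : 2 ≤ q) (hw : p + 1 ≤ w) {m : ℕ} (hm : m + 1 - w ≤ q ^ (w - p - 1))
    {y₁ y₂ : List (Fin q)} (hy₁ : y₁.length = m) (hy₂ : y₂.length = m)
    (h₁ : ¬ IsLPA w p y₁) (h₂ : ¬ IsLPA w p y₂) (h : repair w p y₁ = repair w p y₂) : y₁ = y₂ := by
  obtain ⟨i₁, p₁, h₁⟩ := exists_isFirstBad h₁
  obtain ⟨i₂, p₂, h₂⟩ := exists_isFirstBad h₂
  have l₁ := h₁.le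
  have l₂ := h₂.le
  rw [h₁.repair_eq', h₂.repair_eq'] at h
  obtain ⟨hA, hB⟩ := List.append_inj' h (by
    rw [h₁.repairBlock_length hw, h₂.repairBlock_length hw])
  obtain ⟨hC, -⟩ := List.append_inj' hB rfl
  obtain ⟨hD, hE⟩ := List.append_inj' hC (by rw [digits_length, digits_length])
  have hk := kernel_inj (one_ne_zero_fin hq) hD
  -- Both indices are at most `m - w`, hence below `q ^ (w - p - 1)`, so the digits lose nothing.
  have hi : i₁ = i₂ := by
    rw [← value_digits _ i₁ (lt_of_lt_of_le (by omega) hm), hE,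
      value_digits _ i₂ (lt_of_lt_of_le (by omega) hm)]
  subst hi
  have hp : p₁ = p₂ := by rw [← h₁.kernel_length, hk, h₂.kernel_length]
  subst hp
  obtain ⟨hF, hG⟩ := List.append_inj hA (by simp; omega)
  apply List.ext_getElem?
  intro t
  by_cases ht : t < i₁
  · have := congrArg (fun l => l[t]?) hF
    simpa [List.getElem?_take, ht] using this
  by_cases ht' : i₁ + w ≤ t
  · have := congrArg (fun l => l[t - (i₁ + w)]?) hG
    simpa [List.getElem?_drop, show i₁ + w + (t - (i₁ + w)) = t by omega] using this
  -- Inside the removed window both words repeat the common kernel.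
  · have e₁ := h₁.period.getElem?_mod (t - i₁) (by omega)
    have e₂ := h₂.period.getElem?_mod (t - i₁) (by omega)
    rw [show i₁ + (t - i₁) = t by omega] at e₁ e₂
    have := congrArg (fun l => l[(t - i₁) % p₁]?) hk
    have hlt : (t - i₁) % p₁ < p₁ := Nat.mod_lt _ h₁.period.1
    simp only [window, List.getElem?_take, List.getElem?_drop, if_pos hlt] at this
    rw [e₁, e₂, this]

end Repair

/-! ### The core encoder -/

section CoreEncoder

variable {q : ℕ} [NeZero q] {w p : ℕ}

/-- The number of repair steps of the core encoder. -/
noncomputable def coreSteps (w p : ℕ) (x : List (Fin q)) : ℕ :=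
  sInf {t | IsLPA w p (coreState w p x t)}

theorem coreState_zero (x : List (Fin q)) : coreState w p x 0 = x ++ [1] := rfl

theorem coreState_succ (x : List (Fin q)) (t : ℕ) :
    coreState w p x (t + 1) = repair w p (coreState w p x t) := by
  simp only [coreState, Function.iterate_succ_apply']

theorem coreState_length (hw : p + 1 ≤ w) {x : List (Fin q)} {t : ℕ}
    (h : ∀ s < t, ¬ IsLPA w p (coreState w p x s)) :
    (coreState w p x t).length = x.length + 1 := by
  induction t with
  | zero => simp [coreState_zero]
  | succ t ih =>
    rw [coreState_succ, repair_length (h t (by omega)) hw, ih fun s hs => h s (by omega)]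

/-- Undo repairs on both sides in parallel. The last symbol shows whether a repair has taken place,
so both runs reach their start words at the same time. -/
theorem coreState_inj (hq : 2 ≤ q) (hw : p + 1 ≤ w) {m : ℕ} (hm : m + 1 - w ≤ q ^ (w - p - 1))
    {x₁ x₂ : List (Fin q)} (hx₁ : x₁.length + 1 = m) (hx₂ : x₂.length + 1 = m) {t₁ t₂ : ℕ}
    (h₁ : ∀ s < t₁, ¬ IsLPA w p (coreState w p x₁ s))
    (h₂ : ∀ s < t₂, ¬ IsLPA w p (coreState w p x₂ s))
    (h : coreState w p x₁ t₁ = coreState w p x₂ t₂) : x₁ = x₂ ∧ t₁ = t₂ := by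
  have last : ∀ x : List (Fin q), (coreState w p x 0).getLast? = some 1 := by
    simp [coreState_zero]
  have key := one_ne_zero_fin hq
  induction t₁ generalizing t₂ with
  | zero =>
    cases t₂ with
    | zero => exact ⟨List.append_cancel_right h, rfl⟩
    | succ t₂ =>
      have := congrArg List.getLast? h
      rw [last, coreState_succ, repair_getLast? (h₂ t₂ (by omega))] at this
      exact absurd (Option.some.inj this) key
  | succ t₁ ih =>
    cases t₂ with
    | zero =>
      have := congrArg List.getLast? h
      rw [last, coreState_succ, repair_getLast? (h₁ t₁ (by omega))] at this
      exact absurd (Option.some.inj this).symm key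
    | succ t₂ =>
      rw [coreState_succ, coreState_succ] at h
      have h₁' : ∀ s < t₁, ¬ IsLPA w p (coreState w p x₁ s) := fun s hs => h₁ s (by omega)
      have h₂' : ∀ s < t₂, ¬ IsLPA w p (coreState w p x₂ s) := fun s hs => h₂ s (by omega)
      have := ih h₁' h₂' (repair_injective hq hw hm (by rw [coreState_length hw h₁', hx₁])
        (by rw [coreState_length hw h₂', hx₂]) (h₁ t₁ (by omega)) (h₂ t₂ (by omega)) h)
      exact ⟨this.1, by rw [this.2]⟩

/-- An infinite run would map the step numbers injectively into the finite set of words of length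
`x.length + 1`. -/
theorem coreTerminates (hq : 2 ≤ q) (hw : p + 1 ≤ w) {x : List (Fin q)}
    (hm : x.length + 2 - w ≤ q ^ (w - p - 1)) : CoreTerminates w p x := by
  by_contra hne
  unfold CoreTerminates at hne
  push Not at hne
  let f : ℕ → List.Vector (Fin q) (x.length + 1) := fun t =>
    ⟨coreState w p x t, coreState_length hw fun s _ => hne s⟩
  refine not_injective_infinite_finite f fun t₁ t₂ h => ?_
  exact (coreState_inj (m := x.length + 1) hq hw hm rfl rfl (fun s _ => hne s) (fun s _ => hne s)
    (congrArg Subtype.val h)).2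

theorem not_isLPA_of_lt_coreSteps {x : List (Fin q)} {s : ℕ} (h : s < coreSteps w p x) :
    ¬ IsLPA w p (coreState w p x s) := fun h' => Nat.notMem_of_lt_sInf h h'

theorem coreEncode_eq (x : List (Fin q)) :
    coreEncode w p x = coreState w p x (coreSteps w p x) := rfl

theorem isLPA_coreEncode {x : List (Fin q)} (h : CoreTerminates w p x) :
    IsLPA w p (coreEncode w p x) := Nat.sInf_mem (s := {t | IsLPA w p (coreState w p x t)}) h

theorem coreEncode_length (hw : p + 1 ≤ w) (x : List (Fin q)) :
    (coreEncode w p x).length = x.length + 1 :=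
  coreState_length hw fun _ h => not_isLPA_of_lt_coreSteps h

end CoreEncoder

/-! ### Segments -/

section Segments

/-- What the choice of the number `k` of segments gives: `N` is the length of a segment, and the
window size is `h`. -/
structure SegmentSizes (q n ℓ p k N h : ℕ) : Prop where
  half_eq : half ℓ = h
  seg_eq : (n + k - 1) / k = N
  k_pos : 1 ≤ k
  n_pos : 1 ≤ n
  p_lt : p + 1 ≤ h
  h_le : h ≤ N + 1
  lt_n : (k - 1) * N < n
  n_le : n ≤ k * N
  windows_le : N + 2 - h ≤ q ^ (h - p - 1)
  k_lt : (k - 1) * (q ^ (ℓ / 2 - p - 1) + h - 2) < n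
  le_k : n ≤ k * (q ^ (ℓ / 2 - p - 1) + h - 2)

/-- The ceiling is an integer, so for odd `ℓ` the bound rounds down to `ℓ / 2`; by `hl` the natural
subtractions in the exponent do not truncate. -/
theorem logb_bound_iff {q ℓ p : ℕ} (hq : 2 ≤ q) (hl : 2 * (p + 1) ≤ ℓ) {z : ℝ} (hz : 0 < z) :
    2 * (⌈Real.logb q z⌉ + p + 1) ≤ (ℓ : ℤ) ↔ z ≤ (q : ℝ) ^ (ℓ / 2 - p - 1) := by
  have hq' : (1 : ℝ) < q := by exact_mod_cast hq
  rw [← Real.rpow_natCast, ← Real.logb_le_iff_le_rpow hq' hz]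
  have h2 : (2 * (⌈Real.logb q z⌉ + p + 1) ≤ (ℓ : ℤ)) ↔
      ⌈Real.logb q z⌉ ≤ ((ℓ / 2 - p - 1 : ℕ) : ℤ) := by omega
  rw [h2, Int.ceil_le]
  simp

theorem segment_cond_iff {q n ℓ p k : ℕ} (hq : 2 ≤ q) (hp : 1 ≤ p) (hl : 2 * (p + 1) ≤ ℓ)
    (hk : 1 ≤ k) (hpos : 0 < (n : ℝ) / k - half ℓ + 2) :
    2 * (⌈Real.logb q ((n : ℝ) / k - half ℓ + 2)⌉ + p + 1) ≤ (ℓ : ℤ) ↔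
      n ≤ k * (q ^ (ℓ / 2 - p - 1) + half ℓ - 2) := by
  have hh : 2 ≤ half ℓ := by unfold half; omega
  have hk' : (0 : ℝ) < k := by exact_mod_cast hk
  rw [logb_bound_iff hq hl hpos, ← Nat.cast_le (α := ℝ)]
  have : ((q ^ (ℓ / 2 - p - 1) + half ℓ - 2 : ℕ) : ℝ) = (q : ℝ) ^ (ℓ / 2 - p - 1) + half ℓ - 2 := by
    rw [Nat.cast_sub (by omega)]; push_cast; ring
  rw [Nat.cast_mul, this, ← div_le_iff₀' hk']
  constructor <;> intro h <;> linarith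

/-- By `segment_cond_iff` the logarithmic condition is the integer inequality `le_k`; minimality of
`k` gives the strict inequality `k_lt`. The two together let a program find `k` by a division
rounded up. -/
theorem IsSegmentCount.sizes {q n ℓ p k : ℕ} (hq : 2 ≤ q) (hp : 1 ≤ p) (hl : 2 * (p + 1) ≤ ℓ)
    (h : IsSegmentCount q n ℓ p k) :
    SegmentSizes q n ℓ p k ((n + k - 1) / k) (half ℓ) := by
  obtain ⟨⟨hk, hpos, hlog⟩, hmin⟩ := h
  have hh : p + 1 ≤ half ℓ := by unfold half; omega
  have hk' : (0 : ℝ) < k := by exact_mod_cast hk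
  have hlek := (segment_cond_iff hq hp hl hk hpos).1 hlog
  have hpow : 1 ≤ q ^ (ℓ / 2 - p - 1) := Nat.one_le_pow _ _ (by omega)
  have hpow' : q ^ (ℓ / 2 - p - 1) ≤ q ^ (half ℓ - p - 1) :=
    Nat.pow_le_pow_right (by omega) (by unfold half; omega)
  -- From the positivity of the argument of the logarithm; it makes a full segment at least `h - 1`
  -- symbols long.
  have hn : k * (half ℓ - 2) < n := by
    rw [← Nat.cast_lt (α := ℝ), Nat.cast_mul, Nat.cast_sub (by omega), ← lt_div_iff₀' hk']
    push_cast; linarith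
  have hN1 : n ≤ k * ((n + k - 1) / k) := by
    have := Nat.div_add_mod (n + k - 1) k
    have := Nat.mod_lt (n + k - 1) (show 0 < k by omega)
    omega
  have hN2 : (n + k - 1) / k ≤ q ^ (ℓ / 2 - p - 1) + half ℓ - 2 := by
    rw [Nat.div_le_iff_le_mul_add_pred (by omega)]; omega
  have hklt : (k - 1) * (q ^ (ℓ / 2 - p - 1) + half ℓ - 2) < n := by
    by_contra hge
    rcases Nat.eq_or_lt_of_le hk with h1 | h1
    · rw [← h1] at hge; simp at hge; omega
    have hk1 : (0 : ℝ) < ((k - 1 : ℕ) : ℝ) := by exact_mod_cast (by omega)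
    -- Fewer segments only enlarge the argument of the logarithm, so `k - 1` can fail only through
    -- the inequality.
    have hpos' : 0 < (n : ℝ) / ((k - 1 : ℕ) : ℝ) - half ℓ + 2 := by
      have : (n : ℝ) / k ≤ (n : ℝ) / ((k - 1 : ℕ) : ℝ) :=
        div_le_div_of_nonneg_left (by positivity) hk1 (by exact_mod_cast (by omega))
      linarith
    have := hmin ⟨(by omega : 1 ≤ k - 1), hpos',
      (segment_cond_iff hq hp hl (by omega) hpos').2 (by omega)⟩
    omega
  refine ⟨rfl, rfl, hk, by omega, hh, ?_, ?_, hN1, by omega, hklt, hlek⟩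
  · have : half ℓ - 2 < (n + k - 1) / k := by
      by_contra hc
      have := Nat.mul_le_mul_left k (not_lt.1 hc)
      omega
    omega
  · exact lt_of_le_of_lt (Nat.mul_le_mul_left _ hN2) hklt

variable {q n ℓ p k N h : ℕ}

theorem SegmentSizes.mul_lt (S : SegmentSizes q n ℓ p k N h) {j : ℕ} (hj : j < k) : j * N < n :=
  lt_of_le_of_lt (Nat.mul_le_mul_right N (by omega)) S.lt_n

theorem SegmentSizes.succ_mul_le (S : SegmentSizes q n ℓ p k N h) {j : ℕ} (hj : j + 1 < k) :
    j * N + N ≤ n := by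
  have := S.mul_lt hj
  rw [Nat.succ_mul] at this
  exact this.le

/-- The `j`-th segment has length `min N (n - j * N)`. -/
theorem segment_length {α : Type*} (x : List α) (j N : ℕ) :
    (window x (j * N) N).length = min N (x.length - j * N) := by
  simp [window]

theorem segments_length {α : Type*} (k : ℕ) (x : List α) : (segments k x).length = k := by
  simp [segments]

theorem SegmentSizes.segments_eq (S : SegmentSizes q n ℓ p k N h) {α : Type*} {x : List α}
    (hx : x.length = n) : segments k x = (List.range k).map fun j => window x (j * N) N := by
  simp only [segments, hx, S.seg_eq]

theorem SegmentSizes.segments_getElem? (S : SegmentSizes q n ℓ p k N h) {α : Type*} {x : List α}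
    (hx : x.length = n) {j : ℕ} (hj : j < k) :
    (segments k x)[j]? = some (window x (j * N) N) := by
  simp [S.segments_eq hx, hj]

theorem SegmentSizes.segments_drop (S : SegmentSizes q n ℓ p k N h) {α : Type*} {x : List α}
    (hx : x.length = n) {j : ℕ} (hj : j < k) :
    (segments k x).drop j = window x (j * N) N :: (segments k x).drop (j + 1) := by
  have hl : j < (segments k x).length := by rwa [segments_length]
  rw [List.drop_eq_getElem_cons hl]
  congr 1
  have := S.segments_getElem? hx hj
  rw [List.getElem?_eq_getElem hl] at this
  exact Option.some.inj this

section

variable [NeZero q] {x : List (Fin q)}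

theorem SegmentSizes.mem_segments_length (S : SegmentSizes q n ℓ p k N h) (hx : x.length = n)
    {s : List (Fin q)} (hs : s ∈ segments k x) : s.length ≤ N := by
  rw [S.segments_eq hx] at hs
  obtain ⟨j, -, rfl⟩ := List.mem_map.1 hs
  rw [segment_length]
  exact min_le_left _ _

theorem SegmentSizes.coreTerminates (S : SegmentSizes q n ℓ p k N h) (hq : 2 ≤ q)
    {s : List (Fin q)} (hs : s.length ≤ N) : CoreTerminates h p s :=
  PeriodAvoiding.coreTerminates hq S.p_lt (le_trans (by omega) S.windows_le)

/-- All segments before the last one are full, so each of their codewords has `N + 1` symbols. This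
gives the addresses of the codewords in memory. -/
theorem SegmentSizes.encode_take (S : SegmentSizes q n ℓ p k N h) (hx : x.length = n) {j : ℕ}
    (hj : j < k) :
    (((segments k x).take j).flatMap (coreEncode h p)).length = j * (N + 1) := by
  induction j with
  | zero => simp
  | succ j ih =>
    have hl : j < (segments k x).length := by rw [segments_length]; omega
    rw [List.take_add_one, S.segments_getElem? hx (by omega), Option.toList_some, List.flatMap_append,
      List.length_append, ih (by omega)]
    have := S.succ_mul_le hj
    simp only [List.flatMap_cons, List.flatMap_nil, List.append_nil, coreEncode_length S.p_lt,
      segment_length, hx]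
    rw [min_eq_left (by omega), Nat.succ_mul]

theorem SegmentSizes.encode_eq (S : SegmentSizes q n ℓ p k N h) (x : List (Fin q)) :
    encode ℓ p k x = (segments k x).flatMap (coreEncode h p) := by
  rw [encode, S.half_eq]

theorem SegmentSizes.encode_split (S : SegmentSizes q n ℓ p k N h) (hx : x.length = n) {j : ℕ}
    (hj : j < k) :
    encode ℓ p k x = ((segments k x).take j).flatMap (coreEncode h p) ++
      (coreEncode h p (window x (j * N) N) ++
        ((segments k x).drop (j + 1)).flatMap (coreEncode h p)) := by
  rw [S.encode_eq, ← List.flatMap_cons, ← S.segments_drop hx hj, ← List.flatMap_append,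
    List.take_append_drop]

theorem SegmentSizes.encode_length (S : SegmentSizes q n ℓ p k N h) (hx : x.length = n) :
    (encode ℓ p k x).length = n + k := by
  have hk := S.k_pos
  have hlt := S.lt_n
  have hle := S.n_le
  have hdrop : (segments k x).drop (k - 1 + 1) = [] := by
    apply List.drop_of_length_le; rw [segments_length]; omega
  rw [S.encode_split hx (show k - 1 < k by omega), List.length_append, S.encode_take hx (by omega),
    hdrop, List.flatMap_nil, List.append_nil, coreEncode_length S.p_lt, segment_length, hx]
  obtain ⟨k, rfl⟩ := Nat.exists_eq_add_of_le' hk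
  simp only [Nat.add_sub_cancel] at *
  rw [Nat.succ_mul] at hle
  rw [Nat.mul_add]
  omega

theorem SegmentSizes.encode_mem (S : SegmentSizes q n ℓ p k N h) (hq : 2 ≤ q)
    (hx : x.length = n) : encode ℓ p k x ∈ lpaWords q (n + k) ℓ p := by
  refine ⟨S.encode_length hx, fun p' hp' => ?_⟩
  have hpl := S.p_lt
  have hh := S.half_eq
  rw [S.encode_eq, List.flatMap_def]
  apply isPA_flatten (h := h) (by omega) (by unfold half at hh; omega)
  · intro j hj a ha
    rw [List.length_map, segments_length] at hj
    rw [List.getElem?_map, S.segments_getElem? hx (by omega)] at ha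
    obtain rfl := Option.some.inj ha
    have := S.succ_mul_le hj
    have := S.h_le
    rw [coreEncode_length S.p_lt, segment_length, hx]
    omega
  · intro a ha
    obtain ⟨s, hs, rfl⟩ := List.mem_map.1 ha
    exact isLPA_coreEncode (S.coreTerminates hq (S.mem_segments_length hx hs)) p' hp'

end

end Segments

end PeriodAvoiding

namespace PeriodAvoiding

/-! ### Counting words -/

section Counting

variable {q : ℕ} [NeZero q]

/-- A set of words that are determined by their symbols outside `D` is small. -/
theorem card_le_of_determined {n : ℕ} (P : Finset (Fin n → Fin q)) (D : Finset (Fin n))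
    (h : ∀ x ∈ P, ∀ x' ∈ P, (∀ i ∉ D, x i = x' i) → x = x') : P.card ≤ q ^ (n - D.card) := by
  have h1 : P.card ≤ (Finset.univ : Finset ({i // i ∉ D} → Fin q)).card := by
    apply Finset.card_le_card_of_injOn (fun x i => x i.1) (fun _ _ => Finset.mem_coe.2 (Finset.mem_univ _))
    intro x hx x' hx' hxx
    exact h x hx x' hx' fun i hi => congrFun hxx ⟨i, hi⟩
  refine h1.trans (le_of_eq ?_)
  rw [Finset.card_univ, Fintype.card_fun, Fintype.card_fin, Fintype.card_subtype_compl]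
  simp

theorem card_interval {n a L : ℕ} (h : a + L ≤ n) :
    (Finset.univ.filter fun i : Fin n => a ≤ (i : ℕ) ∧ (i : ℕ) < a + L).card = L := by
  have : (Finset.univ.filter fun i : Fin n => a ≤ (i : ℕ) ∧ (i : ℕ) < a + L) =
      (Finset.Ico a (a + L)).attachFin fun i hi => by
        have := (Finset.mem_Ico.1 hi).2; omega := by
    ext i; simp [Finset.mem_attachFin]
  rw [this, Finset.card_attachFin]; simp

/-- Each word of length `L` is the window of at most `q ^ (n - L)` messages, because the other `n -
L` symbols determine such a message. -/
theorem sum_window_le {n a L N : ℕ} (hL : min N (n - a) = L) (ha : a ≤ n)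
    (F : List (Fin q) → ℕ) :
    ∑ x : Fin n → Fin q, F (window (List.ofFn x) a N) ≤
      q ^ (n - L) * ∑ u : Fin L → Fin q, F (List.ofFn u) := by
  classical
  have haL : a + L ≤ n := by omega
  let g : (Fin n → Fin q) → (Fin L → Fin q) := fun x i => x ⟨a + i, by omega⟩
  have hg : ∀ x, window (List.ofFn x) a N = List.ofFn (g x) := by
    intro x
    apply List.ext_getElem
    · simp [window, hL]
    · intro i h1 h2
      simp [window, g]
  simp only [hg]
  rw [← Finset.sum_fiberwise_of_maps_to (s := Finset.univ) (t := Finset.univ) (g := g)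
    (fun _ _ => Finset.mem_univ _), Finset.mul_sum]
  refine Finset.sum_le_sum fun u _ => ?_
  rw [Finset.sum_congr rfl (g := fun _ => F (List.ofFn u))
    (fun x hx => by rw [(Finset.mem_filter.1 hx).2]), Finset.sum_const, smul_eq_mul]
  refine Nat.mul_le_mul_right _ ?_
  refine (card_le_of_determined _
    (Finset.univ.filter fun i : Fin n => a ≤ (i : ℕ) ∧ (i : ℕ) < a + L) ?_).trans
    (by rw [card_interval haL])
  intro x hx x' hx' hxx
  funext i
  by_cases hi : a ≤ (i : ℕ) ∧ (i : ℕ) < a + L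
  · have e : g x = g x' := (Finset.mem_filter.1 hx).2.trans (Finset.mem_filter.1 hx').2.symm
    have := congrFun e ⟨i - a, by omega⟩
    simp only [g, show a + ((i : ℕ) - a) = i by omega] at this
    exact this
  · exact hxx i (by simpa using hi)

/-- The `T` symbols from `i + p` on are copies of symbols `p` places earlier. The shift and its
source may overlap, so they are recovered from left to right by strong induction. -/
theorem card_match_le {m i p T : ℕ} (hp : 1 ≤ p) (h : i + p + T ≤ m) :
    (Finset.univ.filter fun y : Fin m → Fin q =>
      ∀ t < T, (List.ofFn y)[i + t]? = (List.ofFn y)[i + p + t]?).card ≤ q ^ (m - T) := by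
  refine (card_le_of_determined _
    (Finset.univ.filter fun c : Fin m => i + p ≤ (c : ℕ) ∧ (c : ℕ) < i + p + T) ?_).trans
    (by rw [card_interval h])
  intro x hx x' hx' hxx
  have key : ∀ c : ℕ, ∀ hc : c < m, x ⟨c, hc⟩ = x' ⟨c, hc⟩ := by
    intro c
    induction c using Nat.strong_induction_on with
    | _ c ih =>
      intro hc
      by_cases hcD : i + p ≤ c ∧ c < i + p + T
      · have e := (Finset.mem_filter.1 hx).2 (c - (i + p)) (by omega)
        have e' := (Finset.mem_filter.1 hx').2 (c - (i + p)) (by omega)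
        simp only [List.getElem?_ofFn, show i + p + (c - (i + p)) = c by omega, hc,
          show i + (c - (i + p)) = c - p by omega, show c - p < m by omega, dite_true] at e e'
        rw [← Option.some.inj e, ← Option.some.inj e', ih (c - p) (by omega)]
      · exact hxx ⟨c, hc⟩ (by simpa using hcD)
  funext c
  exact key c c.2

/-- The number of comparisons in a search for a window with a small period: for every index
`i < A` and every period, the number of lengths `T ≥ g` up to which the word and its shift agree. -/
def matchCost (g w p A : ℕ) (y : List (Fin q)) : ℕ :=
  ∑ i ∈ Finset.range A, ∑ p' ∈ Finset.Ico 1 p, ∑ T ∈ Finset.Ico g (w - p' + 1),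
    if ∀ t < T, y[i + t]? = y[i + p' + t]? then 1 else 0

/-- A geometric sum with ratio at least two; the second term on the left is what lets the induction
close. -/
theorem sum_geometric_le (hq : 2 ≤ q) {m g b : ℕ} (hg : g ≤ b) (hb : b ≤ m) :
    ∑ T ∈ Finset.Ico g b, q ^ (m - T) + 2 * q ^ (m - b) ≤ 2 * q ^ (m - g) := by
  induction b, hg using Nat.le_induction with
  | base => simp
  | succ b hgb ih =>
    rw [Finset.sum_Ico_succ_top hgb]
    have := ih (by omega)
    have e : q ^ (m - b) = q ^ (m - (b + 1)) * q := by
      rw [← pow_succ]; congr 1; omega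
    have : q ^ (m - (b + 1)) * 2 ≤ q ^ (m - (b + 1)) * q := Nat.mul_le_mul_left _ hq
    omega

/-- A pair `i`, `p'` contributes at most `2 * q ^ (m - g)`. There are at most `p` periods per index,
and the `A ≤ q ^ g` indices cancel the factor `q ^ (-g)`. -/
theorem sum_matchCost_le (hq : 2 ≤ q) {g w p A m : ℕ} (hA : A ≤ m + 1 - w) (hAg : A ≤ q ^ g)
    (hg : g ≤ w) (hpw : p ≤ w) :
    ∑ y : Fin m → Fin q, matchCost g w p A (List.ofFn y) ≤ 2 * p * q ^ m := by
  unfold matchCost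
  rw [Finset.sum_comm]
  have h1 : ∀ i ∈ Finset.range A, ∑ y : Fin m → Fin q, ∑ p' ∈ Finset.Ico 1 p,
      ∑ T ∈ Finset.Ico g (w - p' + 1),
        (if ∀ t < T, (List.ofFn y)[i + t]? = (List.ofFn y)[i + p' + t]? then 1 else 0)
      ≤ p * (2 * q ^ (m - g)) := by
    intro i hi
    have hi := Finset.mem_range.1 hi
    rw [Finset.sum_comm]
    refine (Finset.sum_le_card_nsmul _ _ (2 * q ^ (m - g)) ?_).trans ?_
    · intro p' hp'
      have hp' := Finset.mem_Ico.1 hp'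
      rw [Finset.sum_comm]
      calc _ ≤ ∑ T ∈ Finset.Ico g (w - p' + 1), q ^ (m - T) := by
            refine Finset.sum_le_sum fun T hT => ?_
            have hT := Finset.mem_Ico.1 hT
            rw [← Finset.sum_filter, Finset.sum_const, smul_eq_mul, mul_one]
            exact card_match_le hp'.1 (by omega)
        _ ≤ 2 * q ^ (m - g) := by
            by_cases hgb : g ≤ w - p' + 1
            · have := sum_geometric_le (q := q) hq hgb (m := m) (by omega)
              omega
            · rw [Finset.Ico_eq_empty (by omega)]; simp
    · rw [Nat.card_Ico, smul_eq_mul]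
      exact Nat.mul_le_mul_right _ (by omega)
  refine (Finset.sum_le_card_nsmul _ _ _ h1).trans ?_
  rw [Finset.card_range, smul_eq_mul]
  rcases Nat.eq_zero_or_pos A with h0 | h0
  · simp [h0]
  have e : q ^ m = q ^ g * q ^ (m - g) := by rw [← pow_add]; congr 1; omega
  calc A * (p * (2 * q ^ (m - g))) ≤ q ^ g * (p * (2 * q ^ (m - g))) := Nat.mul_le_mul_right _ hAg
    _ = 2 * p * q ^ m := by rw [e]; ring

/-- The states of the core encoder on all inputs are distinct words. -/
theorem sum_coreState_le (hq : 2 ≤ q) {w p N : ℕ} (hw : p + 1 ≤ w)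
    (hm : N + 2 - w ≤ q ^ (w - p - 1)) (F : List (Fin q) → ℕ) :
    ∑ u : Fin N → Fin q, ∑ t ∈ Finset.range (coreSteps w p (List.ofFn u) + 1),
      F (coreState w p (List.ofFn u) t) ≤ ∑ y : Fin (N + 1) → Fin q, F (List.ofFn y) := by
  classical
  rw [Finset.sum_sigma']
  set 𝒮 := Finset.univ.sigma fun u : Fin N → Fin q =>
    Finset.range (coreSteps w p (List.ofFn u) + 1)
  -- The default zero is never read on `𝒮`, since these states have `N + 1` symbols.
  let f : (Σ _ : Fin N → Fin q, ℕ) → (Fin (N + 1) → Fin q) := fun a i =>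
    (coreState w p (List.ofFn a.1) a.2).getD i 0
  have hlt : ∀ a ∈ 𝒮, ∀ s < a.2, ¬ IsLPA w p (coreState w p (List.ofFn a.1) s) := by
    intro a ha s hs
    have := Finset.mem_range.1 (Finset.mem_sigma.1 ha).2
    exact not_isLPA_of_lt_coreSteps (by omega)
  have hf : ∀ a ∈ 𝒮, coreState w p (List.ofFn a.1) a.2 = List.ofFn (f a) := by
    intro a ha
    have hl := coreState_length hw (hlt a ha)
    apply List.ext_getElem
    · simp [hl]
    · intro i h1 h2
      rw [List.getElem_ofFn]
      simp [f, h1]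
  rw [Finset.sum_congr rfl fun a ha => congrArg F (hf a ha)]
  have hinj : Set.InjOn f 𝒮 := by
    intro a ha b hb hab
    have := coreState_inj hq hw (m := N + 1) hm (by simp) (by simp) (hlt a ha) (hlt b hb)
      (by rw [hf a ha, hf b hb, hab])
    exact Sigma.ext (List.ofFn_injective this.1) (heq_of_eq this.2)
  rw [← Finset.sum_image (f := fun y => F (List.ofFn y)) hinj]
  exact Finset.sum_le_univ_sum_of_nonneg (fun _ => Nat.zero_le _)

/-- A segment of a uniform message is uniform, so the bound for a single run carries over to each
segment, including a shorter last one. -/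
theorem sum_segment_states_le (hq : 2 ≤ q) {n ℓ p k N h : ℕ} (S : SegmentSizes q n ℓ p k N h)
    {j : ℕ} (hj : j < k) (F : List (Fin q) → ℕ) :
    ∑ x : Fin n → Fin q, ∑ t ∈ Finset.range (coreSteps h p (window (List.ofFn x) (j * N) N) + 1),
      F (coreState h p (window (List.ofFn x) (j * N) N) t) ≤
      q ^ (n - min N (n - j * N)) *
        ∑ y : Fin (min N (n - j * N) + 1) → Fin q, F (List.ofFn y) := by
  refine (sum_window_le rfl (S.mul_lt hj).le fun s =>
    ∑ t ∈ Finset.range (coreSteps h p s + 1), F (coreState h p s t)).trans ?_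
  exact Nat.mul_le_mul_left _ (sum_coreState_le hq S.p_lt
    (le_trans (by omega) S.windows_le) F)

end Counting

end PeriodAvoiding

namespace PeriodAvoiding

/-! ### Reasoning about programs -/

section Machine

@[simp] theorem State.setReg_reg (s : State) (r v r' : ℕ) :
    (s.setReg r v).reg r' = if r' = r then v else s.reg r' := by
  simp [State.setReg, Function.update_apply]

@[simp] theorem State.setReg_mem (s : State) (r v : ℕ) : (s.setReg r v).mem = s.mem := rfl

@[simp] theorem State.setMem_reg (s : State) (a v : ℕ) : (s.setMem a v).reg = s.reg := rfl

@[simp] theorem State.setMem_mem (s : State) (a v a' : ℕ) :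
    (s.setMem a v).mem a' = if a' = a then v else s.mem a' := by
  simp [State.setMem, Function.update_apply]

/-- Used for the injectivity of the code: messages with equal codewords lead the decoder to the same
final state. -/
theorem Exec.deterministic {B : ℕ} {P : Program} {s s₁ s₂ : State} {t₁ t₂ : ℕ}
    (h₁ : Exec B P s t₁ s₁) (h₂ : Exec B P s t₂ s₂) : s₁ = s₂ := by
  induction h₁ generalizing t₂ s₂ with
  | skip | const | arith | load | store => cases h₂; rfl
  | seq _ _ ih₁ ih₂ =>
    cases h₂ with
    | seq h h' => obtain rfl := ih₁ h; exact ih₂ h'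
  | ite_true h _ ih =>
    cases h₂ with
    | ite_true _ h' => exact ih h'
    | ite_false h' => exact absurd h' h
  | ite_false h _ ih =>
    cases h₂ with
    | ite_true h' => exact absurd h h'
    | ite_false _ h' => exact ih h'
  | loop_true h _ _ ih₁ ih₂ =>
    cases h₂ with
    | loop_true _ h' h'' => obtain rfl := ih₁ h'; exact ih₂ h''
    | loop_false h' => exact absurd h' h
  | loop_false h =>
    cases h₂ with
    | loop_true h' => exact absurd h h'
    | loop_false => rfl

/-- Started in `s`, the program `P` halts, and the number of steps and the last state satisfy
`Q`. -/
def Halts (B : ℕ) (P : Program) (s : State) (Q : ℕ → State → Prop) : Prop :=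
  ∃ t s', Exec B P s t s' ∧ Q t s'

variable {B : ℕ} {P R : Program} {s : State} {Q Q' : ℕ → State → Prop}

theorem Halts.mono (h : Halts B P s Q) (hQ : ∀ t s', Q t s' → Q' t s') : Halts B P s Q' := by
  obtain ⟨t, s', he, hq⟩ := h
  exact ⟨t, s', he, hQ t s' hq⟩

/-- The rules for instructions are equivalences, so that simplification computes the weakest
precondition of straight-line code and leaves the word-size bounds as side goals. -/
theorem halts_skip : Halts B .skip s Q ↔ Q 1 s :=
  ⟨fun ⟨_, _, he, hq⟩ => by cases he; exact hq, fun h => ⟨_, _, .skip s, h⟩⟩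

theorem halts_const {r c : ℕ} :
    Halts B (.const r c) s Q ↔ c < B ∧ Q 1 (s.setReg r c) :=
  ⟨fun ⟨_, _, he, hq⟩ => by cases he with | const _ _ _ h => exact ⟨h, hq⟩,
    fun h => ⟨_, _, .const s r c h.1, h.2⟩⟩

theorem halts_arith {op : ArithOp} {r a b : ℕ} :
    Halts B (.arith op r a b) s Q ↔ op.eval (s.reg a) (s.reg b) < B ∧
      Q 1 (s.setReg r (op.eval (s.reg a) (s.reg b))) :=
  ⟨fun ⟨_, _, he, hq⟩ => by cases he with | arith _ _ _ _ _ h => exact ⟨h, hq⟩,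
    fun h => ⟨_, _, .arith s op r a b h.1, h.2⟩⟩

theorem halts_load {r a : ℕ} :
    Halts B (.load r a) s Q ↔ s.reg a < B ∧ Q 1 (s.setReg r (s.mem (s.reg a))) :=
  ⟨fun ⟨_, _, he, hq⟩ => by cases he with | load _ _ _ h => exact ⟨h, hq⟩,
    fun h => ⟨_, _, .load s r a h.1, h.2⟩⟩

theorem halts_store {a b : ℕ} :
    Halts B (.store a b) s Q ↔ s.reg a < B ∧ Q 1 (s.setMem (s.reg a) (s.reg b)) :=
  ⟨fun ⟨_, _, he, hq⟩ => by cases he with | store _ _ _ h => exact ⟨h, hq⟩,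
    fun h => ⟨_, _, .store s a b h.1, h.2⟩⟩

theorem halts_seq : Halts B (.seq P R) s Q ↔
    Halts B P s fun t₁ s₁ => Halts B R s₁ fun t₂ s₂ => Q (t₁ + t₂) s₂ := by
  constructor
  · rintro ⟨_, _, he, hq⟩
    cases he with
    | seq h₁ h₂ => exact ⟨_, _, h₁, _, _, h₂, hq⟩
  · rintro ⟨_, _, h₁, _, _, h₂, hq⟩
    exact ⟨_, _, .seq h₁ h₂, hq⟩

theorem halts_ite {r : ℕ} : Halts B (.ite r P R) s Q ↔
    (s.reg r ≠ 0 → Halts B P s fun t => Q (t + 1)) ∧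
      (s.reg r = 0 → Halts B R s fun t => Q (t + 1)) := by
  constructor
  · rintro ⟨_, _, he, hq⟩
    cases he with
    | ite_true h h' => exact ⟨fun _ => ⟨_, _, h', hq⟩, fun h0 => absurd h0 h⟩
    | ite_false h h' => exact ⟨fun h0 => absurd h h0, fun _ => ⟨_, _, h', hq⟩⟩
  · rintro ⟨h₁, h₂⟩
    by_cases h : s.reg r = 0
    · obtain ⟨_, _, h', hq⟩ := h₂ h
      exact ⟨_, _, .ite_false h h', hq⟩
    · obtain ⟨_, _, h', hq⟩ := h₁ h
      exact ⟨_, _, .ite_true h h', hq⟩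

/-- The sequence of a list of programs. -/
def seqs : List Program → Program
  | [] => .skip
  | [P] => P
  | P :: Ps => .seq P (seqs Ps)

theorem halts_seqs_singleton : Halts B (seqs [P]) s Q ↔ Halts B P s Q := Iff.rfl

/-- Two entries are required because `seqs [P]` is `P` itself, without a final `skip` that would
cost a step. -/
theorem halts_seqs_cons {Ps : List Program} : Halts B (seqs (P :: R :: Ps)) s Q ↔
    Halts B P s fun t₁ s₁ => Halts B (seqs (R :: Ps)) s₁ fun t₂ s₂ => Q (t₁ + t₂) s₂ := halts_seq

/-- The rule for loops. The invariant `I b` includes that at most `b` steps are left. -/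
theorem halts_loop {r : ℕ} (I : ℕ → State → Prop) (D : State → Prop)
    (h₀ : ∀ b s, I b s → s.reg r = 0 → 1 ≤ b ∧ D s)
    (h₁ : ∀ b s, I b s → s.reg r ≠ 0 →
      Halts B P s fun t s' => ∃ b', t + 1 + b' ≤ b ∧ I b' s')
    {b : ℕ} {s : State} (hs : I b s) :
    Halts B (.loop r P) s fun t s' => t ≤ b ∧ s'.reg r = 0 ∧ D s' := by
  induction b using Nat.strong_induction_on generalizing s with
  | _ b ih =>
    by_cases h : s.reg r = 0
    · exact ⟨1, s, .loop_false h, (h₀ b s hs h).1, h, (h₀ b s hs h).2⟩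
    · obtain ⟨t, s', he, b', hb', hi⟩ := h₁ b s hs h
      obtain ⟨t', s'', he', ht', hr, hd⟩ := ih b' (by omega) hi
      exact ⟨_, _, .loop_true h he he', by omega, hr, hd⟩

/-- The program that runs `P` with `r` counting down to zero. Register `9` has to hold one. -/
def downLoop (r : ℕ) (P : Program) : Program := .loop r (.seq (.arith .sub r r 9) P)

/-- The invariant is indexed by the number of rounds left. Each round pays two steps on top of `c
j`, for the test and the subtraction; the last `+ 1` is the failing test. -/
theorem halts_downLoop {r : ℕ} (I : ℕ → State → Prop) (c : ℕ → ℕ) {len : ℕ} (hlen : len < B)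
    (h9 : ∀ j s, I j s → s.reg 9 = 1)
    (step : ∀ j < len, ∀ s, s.reg r = j + 1 → I (j + 1) s →
      Halts B P (s.setReg r j) fun t s' => t ≤ c j ∧ s'.reg r = j ∧ I j s')
    {s : State} (hr : s.reg r = len) (hs : I len s) :
    Halts B (downLoop r P) s fun t s' =>
      t ≤ ∑ j ∈ Finset.range len, (c j + 2) + 1 ∧ s'.reg r = 0 ∧ I 0 s' := by
  refine halts_loop (fun b s => ∃ j ≤ len, b = ∑ j ∈ Finset.range j, (c j + 2) + 1 ∧
    s.reg r = j ∧ I j s) (I 0) ?_ ?_ ⟨len, le_rfl, rfl, hr, hs⟩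
  · rintro b s ⟨j, -, rfl, hj, hi⟩ h0
    rw [h0] at hj; subst hj
    exact ⟨by simp, hi⟩
  · rintro b s ⟨j, hjl, rfl, hj, hi⟩ h0
    obtain ⟨j, rfl⟩ := Nat.exists_eq_add_of_le' (show 1 ≤ j by omega)
    simp only [halts_seq, halts_arith, ArithOp.eval, hj, h9 _ _ hi, Nat.add_sub_cancel]
    refine ⟨by omega, (step j (by omega) s hj hi).mono ?_⟩
    rintro t s' ⟨ht, hr', hi'⟩
    exact ⟨_, by rw [Finset.sum_range_succ]; omega, j, by omega, rfl, hr', hi'⟩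

theorem halts_downLoop_const {r : ℕ} (I : ℕ → State → Prop) (c : ℕ) {len : ℕ} (hlen : len < B)
    (h9 : ∀ j s, I j s → s.reg 9 = 1)
    (step : ∀ j < len, ∀ s, s.reg r = j + 1 → I (j + 1) s →
      Halts B P (s.setReg r j) fun t s' => t ≤ c ∧ s'.reg r = j ∧ I j s')
    {s : State} (hr : s.reg r = len) (hs : I len s) :
    Halts B (downLoop r P) s fun t s' =>
      t ≤ (c + 2) * len + 1 ∧ s'.reg r = 0 ∧ I 0 s' := by
  refine (halts_downLoop I (fun _ => c) hlen h9 step hr hs).mono ?_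
  rintro t s' ⟨ht, h⟩
  refine ⟨ht.trans ?_, h⟩
  simp [mul_comm]

/-! ### Moving and filling blocks of memory -/

/-- Copy the cells from `r28` on to the cells from `r27` on, `r30` of them, from the last one to
the first one. -/
def copyDown : Program :=
  downLoop 30 (seqs [.arith .add 37 28 30, .load 37 37, .arith .add 38 27 30, .store 38 37])

/-- Going downwards is safe if the target starts no earlier than the source: the cells still to be
read lie below those already written. Otherwise the blocks have to be disjoint. -/
theorem halts_copyDown {dst src len : ℕ} (hlen : len < B) (hsrc : src + len ≤ B)
    (hdst : dst + len ≤ B) (hd : src ≤ dst ∨ dst + len ≤ src) {s : State} (h9 : s.reg 9 = 1)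
    (h27 : s.reg 27 = dst) (h28 : s.reg 28 = src) (h30 : s.reg 30 = len) :
    Halts B copyDown s fun t s' => t ≤ 6 * len + 1 ∧ (∀ r < 30, s'.reg r = s.reg r) ∧
      ∀ a, s'.mem a = if dst ≤ a ∧ a < dst + len then s.mem (src + (a - dst)) else s.mem a := by
  refine (halts_downLoop_const (fun j s' => (∀ r < 30, s'.reg r = s.reg r) ∧
    ∀ a, s'.mem a = if dst + j ≤ a ∧ a < dst + len then s.mem (src + (a - dst)) else s.mem a)
    4 hlen (fun j s' h => by rw [h.1 9 (by omega), h9]) ?_ h30 ⟨fun _ _ => rfl, fun a => ?_⟩).mono ?_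
  · rintro j hj s' hj' ⟨hr, hm⟩
    simp [halts_seqs_cons, halts_seqs_singleton, halts_arith, halts_load, halts_store,
      ArithOp.eval, hr, h27, h28]
    refine ⟨by omega, by omega, fun r hr' => ?_, fun a => ?_⟩
    · simp [hr r hr', show r ≠ 30 by omega, show r ≠ 37 by omega, show r ≠ 38 by omega]
    · rw [hm, hm]
      split_ifs <;> first | rfl | (exfalso; omega) | (congr 1; omega)
  · rw [if_neg (by omega)]
  · rintro t s' ⟨ht, -, hr, hm⟩
    exact ⟨ht, hr, hm⟩

/-- Copy the cells from `r28` on to the cells from `r27` on, `r30` of them, from the first one to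
the last one. -/
def copyUp : Program :=
  downLoop 30 (seqs [.load 37 28, .store 27 37, .arith .add 27 27 9, .arith .add 28 28 9])

/-- The opposite direction, for targets before the source. The pointers advance, so registers `27`
and `28` are not preserved. -/
theorem halts_copyUp {dst src len : ℕ} (hlen : len < B) (hsrc : src + len < B)
    (hdst : dst + len < B) (hd : dst ≤ src) {s : State} (h9 : s.reg 9 = 1)
    (h27 : s.reg 27 = dst) (h28 : s.reg 28 = src) (h30 : s.reg 30 = len) :
    Halts B copyUp s fun t s' => t ≤ 6 * len + 1 ∧ (∀ r < 27, s'.reg r = s.reg r) ∧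
      ∀ a, s'.mem a = if dst ≤ a ∧ a < dst + len then s.mem (src + (a - dst)) else s.mem a := by
  refine (halts_downLoop_const (fun j s' => (∀ r < 27, s'.reg r = s.reg r) ∧
    s'.reg 27 = dst + (len - j) ∧ s'.reg 28 = src + (len - j) ∧
    ∀ a, s'.mem a = if dst ≤ a ∧ a < dst + (len - j) then s.mem (src + (a - dst)) else s.mem a)
    4 hlen (fun j s' h => by rw [h.1 9 (by omega), h9]) ?_ h30
    ⟨fun _ _ => rfl, by omega, by omega, fun a => ?_⟩).mono ?_
  · rintro j hj s' hj' ⟨hr, h27', h28', hm⟩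
    simp [halts_seqs_cons, halts_seqs_singleton, halts_arith, halts_load, halts_store,
      ArithOp.eval, hr, h27', h28', h9]
    refine ⟨by omega, by omega, by omega, by omega, fun r hr' => ?_, by omega, by omega,
      fun a => ?_⟩
    · simp [hr r hr', show r ≠ 27 by omega, show r ≠ 28 by omega, show r ≠ 30 by omega,
        show r ≠ 37 by omega]
    · rw [hm, hm]
      split_ifs <;> first | rfl | (exfalso; omega) | (congr 1; omega)
  · rw [if_neg (by omega)]
  · rintro t s' ⟨ht, -, hr, -, -, hm⟩
    exact ⟨ht, hr, hm⟩

/-- Store `r28` in the `r30` cells from `r27` on. -/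
def fill : Program := downLoop 30 (seqs [.arith .add 38 27 30, .store 38 28])

theorem halts_fill {dst v len : ℕ} (hlen : len < B) (hdst : dst + len ≤ B) {s : State}
    (h9 : s.reg 9 = 1) (h27 : s.reg 27 = dst) (h28 : s.reg 28 = v) (h30 : s.reg 30 = len) :
    Halts B fill s fun t s' => t ≤ 4 * len + 1 ∧ (∀ r < 30, s'.reg r = s.reg r) ∧
      ∀ a, s'.mem a = if dst ≤ a ∧ a < dst + len then v else s.mem a := by
  refine (halts_downLoop_const (fun j s' => (∀ r < 30, s'.reg r = s.reg r) ∧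
    ∀ a, s'.mem a = if dst + j ≤ a ∧ a < dst + len then v else s.mem a)
    2 hlen (fun j s' h => by rw [h.1 9 (by omega), h9]) ?_ h30 ⟨fun _ _ => rfl, fun a => ?_⟩).mono ?_
  · rintro j hj s' hj' ⟨hr, hm⟩
    simp [halts_seqs_cons, halts_seqs_singleton, halts_arith, halts_store,
      ArithOp.eval, hr, h27, h28]
    refine ⟨by omega, fun r hr' => ?_, fun a => ?_⟩
    · simp [hr r hr', show r ≠ 30 by omega, show r ≠ 38 by omega]
    · rw [hm]
      split_ifs <;> first | rfl | (exfalso; omega)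
  · rw [if_neg (by omega)]
  · rintro t s' ⟨ht, -, hr, hm⟩
    exact ⟨ht, hr, hm⟩

/-! ### Words in memory -/

/-- The word `y` stands in the memory cells from `b` on. -/
def Stands {q : ℕ} (mem : ℕ → ℕ) (b : ℕ) (y : List (Fin q)) : Prop :=
  ∀ (i : ℕ) (hi : i < y.length), mem (b + i) = (y[i] : ℕ)

variable {q : ℕ} {mem mem' : ℕ → ℕ} {b : ℕ} {y z : List (Fin q)}

theorem Stands.congr (h : Stands mem b y)
    (hm : ∀ a, b ≤ a → a < b + y.length → mem' a = mem a) : Stands mem' b y :=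
  fun i hi => by rw [hm _ (by omega) (by omega), h i hi]

theorem stands_append : Stands mem b (y ++ z) ↔ Stands mem b y ∧ Stands mem (b + y.length) z := by
  constructor
  · intro h
    refine ⟨fun i hi => ?_, fun i hi => ?_⟩
    · rw [h i (by simp; omega), List.getElem_append_left hi]
    · rw [add_assoc, h (y.length + i) (by simp; omega), List.getElem_append_right (by omega)]
      simp
  · rintro ⟨h₁, h₂⟩ i hi
    by_cases h : i < y.length
    · rw [List.getElem_append_left h, h₁ i h]
    · rw [List.getElem_append_right (by omega),
        ← h₂ (i - y.length) (by rw [List.length_append] at hi; omega)]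
      congr 1; omega

theorem Stands.getElem?_eq_iff (h : Stands mem b y) {i i' : ℕ} (hi : i < y.length)
    (hi' : i' < y.length) : y[i]? = y[i']? ↔ mem (b + i) = mem (b + i') := by
  rw [h i hi, h i' hi', List.getElem?_eq_getElem hi, List.getElem?_eq_getElem hi',
    Option.some_inj, Fin.ext_iff]

theorem Stands.move (h : Stands mem b y) {d : ℕ}
    (hm : ∀ i < y.length, mem' (d + i) = mem (b + i)) : Stands mem' d y :=
  fun i hi => by rw [hm i hi, h i hi]

theorem stands_window (h : Stands mem b y) (i w : ℕ) : Stands mem (b + i) (window y i w) := by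
  intro t ht
  simp only [window, List.length_take, List.length_drop] at ht
  simp only [window, List.getElem_take, List.getElem_drop]
  rw [add_assoc, h]

theorem Stands.lt (h : Stands mem b y) {i : ℕ} (hi : i < y.length) : mem (b + i) < q := by
  rw [h i hi]; exact Fin.is_lt _

end Machine

end PeriodAvoiding

namespace PeriodAvoiding

/-! ### Codes of short factors -/

section Gram

variable {q : ℕ}

/-- The number that the first `g` symbols of a word represent in base `q`, where `G = q ^ g`; short
words are padded with zeros. -/
def gram (G : ℕ) : List (Fin q) → ℕ
  | [] => 0
  | a :: l => (gram G l + a * G) / q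

theorem gram_lt {G : ℕ} (hG : 0 < G) (l : List (Fin q)) : gram G l < G := by
  cases l with
  | nil => exact hG
  | cons a l =>
    have ih := gram_lt hG l
    have ha := a.2
    rw [gram, Nat.div_lt_iff_lt_mul (by omega)]
    calc gram G l + a * G < G + a * G := by omega
      _ = (a + 1) * G := by ring
      _ ≤ q * G := Nat.mul_le_mul_right _ ha
      _ = G * q := mul_comm _ _

/-- Division by `q` forgets the last symbol of a code. Hence the recursion in `gram`, which divides
after adding the new leading symbol, is a rolling update. -/
theorem gram_succ_div (g : ℕ) (l : List (Fin q)) :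
    gram (q ^ (g + 1)) l / q = gram (q ^ g) l := by
  induction l with
  | nil => simp [gram]
  | cons a l ih =>
    have ha : 0 < q := by have := a.2; omega
    rw [gram, gram, ← ih, pow_succ, ← mul_assoc, Nat.add_mul_div_right _ _ ha]

theorem gram_succ_cons (g : ℕ) (a : Fin q) (l : List (Fin q)) :
    gram (q ^ (g + 1)) (a :: l) = gram (q ^ g) l + a * q ^ g := by
  have ha : 0 < q := by have := a.2; omega
  rw [gram, ← gram_succ_div g l, pow_succ, ← mul_assoc, Nat.add_mul_div_right _ _ ha]

theorem gram_eq_iff {g : ℕ} {l l' : List (Fin q)} (h : g ≤ l.length) (h' : g ≤ l'.length) :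
    gram (q ^ g) l = gram (q ^ g) l' ↔ ∀ t < g, l[t]? = l'[t]? := by
  induction g generalizing l l' with
  | zero =>
    have h1 := gram_lt (q := q) one_pos l
    have h2 := gram_lt (q := q) one_pos l'
    simp only [pow_zero, Nat.not_lt_zero, false_imp_iff, implies_true, iff_true]
    omega
  | succ g ih =>
    cases l with
    | nil => simp at h
    | cons a l =>
      cases l' with
      | nil => simp at h'
      | cons a' l' =>
        have hq : 0 < q := by have := a.2; omega
        have hG : 0 < q ^ g := Nat.pow_pos hq
        simp only [List.length_cons, Nat.add_le_add_iff_right] at h h'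
        rw [gram_succ_cons, gram_succ_cons]
        constructor
        · intro e
          have e1 := congrArg (· / q ^ g) e
          have e2 := congrArg (· % q ^ g) e
          simp only [Nat.add_mul_div_right _ _ hG, Nat.add_mul_mod_self_right,
            Nat.div_eq_of_lt (gram_lt hG _), Nat.mod_eq_of_lt (gram_lt hG _), zero_add] at e1 e2
          have e3 := (ih h h').1 e2
          intro t ht
          cases t with
          | zero => simpa using Fin.ext e1
          | succ t => simpa using e3 t (by omega)
        · intro e
          rw [(ih h h').2 fun t ht => by simpa using e (t + 1) (by omega)]
          have := e 0 (by omega)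
          simp only [List.getElem?_cons_zero, Option.some_inj] at this
          rw [this]

theorem gram_drop_eq_iff {g i i' : ℕ} {y : List (Fin q)} (h : i + g ≤ y.length)
    (h' : i' + g ≤ y.length) :
    gram (q ^ g) (y.drop i) = gram (q ^ g) (y.drop i') ↔ ∀ t < g, y[i + t]? = y[i' + t]? := by
  rw [gram_eq_iff (by simp; omega) (by simp; omega)]
  simp

theorem gram_drop {G i : ℕ} {y : List (Fin q)} (h : i < y.length) :
    gram G (y.drop i) = (gram G (y.drop (i + 1)) + y[i] * G) / q := by
  rw [List.drop_eq_getElem_cons h, gram]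

end Gram

/-! ### The search for a bad window -/

/-- What the programs need to know about the parameters: `n` is the length of the message, `w` the
size of the windows, `N` the length of a segment, and `q ^ g` the size of the table. -/
structure CoreNums (B q n p w N g : ℕ) : Prop where
  two_le : 2 ≤ q
  p_pos : 1 ≤ p
  p_lt : p + 1 ≤ w
  w_le : w ≤ N + 1
  N_le : N ≤ n
  n_pos : 1 ≤ n
  g_le : g + p + 1 ≤ w
  windows_le : N + 2 - w ≤ q ^ g
  digits_le : N + 2 - w ≤ q ^ (w - p - 1)
  table_le : 12 * n + q ^ g ≤ B
  gram_le : q * q ^ g ≤ B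
  big : 20 * n + q + 20 ≤ B

/-- The registers that are fixed while the segments are processed. -/
structure CoreRegs (q n p w N g : ℕ) (s : State) : Prop where
  r0 : s.reg 0 = q
  r3 : s.reg 3 = p
  r4 : s.reg 4 = w
  r7 : s.reg 7 = q ^ g
  r8 : s.reg 8 = g
  r9 : s.reg 9 = 1
  r10 : s.reg 10 = 4 * n
  r11 : s.reg 11 = 8 * n
  r12 : s.reg 12 = 12 * n
  r13 : s.reg 13 = N + 1 + p
  r14 : s.reg 14 = 0

/-- Registers `10`, `11` and `12` are the base addresses of the word buffer, of the links of the
lists and of their heads; `13` is the end mark of the lists and `14` the zero used for register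
moves. Registers from `15` on are working space, so agreement below `15` suffices. -/
theorem CoreRegs.congr {q n p w N g : ℕ} {s s' : State} (R : CoreRegs q n p w N g s)
    (h : ∀ r < 15, s'.reg r = s.reg r) : CoreRegs q n p w N g s' := by
  constructor <;> rw [h _ (by norm_num)]
  exacts [R.r0, R.r3, R.r4, R.r7, R.r8, R.r9, R.r10, R.r11, R.r12, R.r13, R.r14]

section Search

variable {B q n p w N g : ℕ} {s : State} {y : List (Fin q)}

/-- The number of lengths `T` with `g ≤ T ≤ L` such that the words of length `T` at the indices `i`
and `i'` agree. -/
def agreeCount (y : List (Fin q)) (i i' g L : ℕ) : ℕ :=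
  ∑ T ∈ Finset.Ico g (L + 1), if ∀ t < T, y[i + t]? = y[i' + t]? then 1 else 0

/-- The unit that pays for one round of the comparison: agreement up to `t` allows symbol `t` to be
inspected. -/
theorem agreeCount_succ {i i' t L : ℕ} (h : ∀ u < t, y[i + u]? = y[i' + u]?) (ht : t ≤ L) :
    agreeCount y i i' t L = agreeCount y i i' (t + 1) L + 1 := by
  rw [agreeCount, Finset.sum_eq_sum_Ico_succ_bot (by omega), if_pos h, add_comm]; rfl

/-- Compare the words at the indices `r30` and `r32`, from their symbols `r8` on and up to the
length `r34`; `r35` becomes the length up to which they agree. -/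
def compareWords : Program := seqs [.arith .add 35 8 14, .arith .sub 36 34 35,
  .loop 36 (seqs [.arith .add 37 10 30, .arith .add 37 37 35, .load 37 37,
    .arith .add 38 10 32, .arith .add 38 38 35, .load 38 38,
    .arith .sub 39 37 38, .arith .sub 37 38 37, .arith .add 39 39 37,
    .ite 39 (.const 36 0) (seqs [.arith .add 35 35 9, .arith .sub 36 34 35])])]

/-- A round costs `13` steps. Register `36` serves as the loop flag: it holds the remaining length,
or zero after a mismatch, hence the disjunction in the invariant. -/
theorem halts_compareWords (C : CoreNums B q n p w N g) (R : CoreRegs q n p w N g s)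
    (hy : Stands s.mem (4 * n) y) (hyN : y.length ≤ N + 1) {j c L : ℕ} (hj : j + L ≤ y.length)
    (hc : c + L ≤ y.length) (hgL : g ≤ L) (hg : ∀ t < g, y[j + t]? = y[c + t]?)
    (h30 : s.reg 30 = j) (h32 : s.reg 32 = c) (h34 : s.reg 34 = L) :
    Halts B compareWords s fun t s' => t ≤ 13 * agreeCount y j c g L + 3 ∧
      (∀ r < 35, s'.reg r = s.reg r) ∧ s'.mem = s.mem ∧ s'.reg 35 ≤ L ∧
      (s'.reg 35 = L ↔ ∀ u < L, y[j + u]? = y[c + u]?) := by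
  have h1 := C.N_le
  have h2 := C.big
  have h3 := C.n_pos
  rw [compareWords]
  simp only [halts_seqs_cons, halts_arith, ArithOp.eval]
  simp only [State.setReg_reg, R.r8, R.r14, h34]
  simp only [halts_seqs_singleton]
  norm_num
  refine ⟨by omega, by omega, (halts_loop (fun b s' => ∃ t, s'.reg 35 = t ∧ g ≤ t ∧ t ≤ L ∧
      (∀ r < 35, s'.reg r = s.reg r) ∧ s'.mem = s.mem ∧
      (∀ u < t, y[j + u]? = y[c + u]?) ∧
      ((s'.reg 36 = L - t ∧ b = 13 * agreeCount y j c t L + 1) ∨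
        (s'.reg 36 = 0 ∧ t < L ∧ y[j + t]? ≠ y[c + t]? ∧ b = 1)))
    (fun s' => (∀ r < 35, s'.reg r = s.reg r) ∧ s'.mem = s.mem ∧ s'.reg 35 ≤ L ∧
      (s'.reg 35 = L ↔ ∀ u < L, y[j + u]? = y[c + u]?)) ?_ ?_
      (b := 13 * agreeCount y j c g L + 1) ?_).mono ?_⟩
  · rintro b s' ⟨t, h35, hgt, htL, hr, hm, hu, ⟨h36, hb⟩ | ⟨h36, hlt, hne, hb⟩⟩ h0
    · obtain rfl : t = L := by omega
      exact ⟨by omega, hr, hm, h35.le, by simpa [h35] using hu⟩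
    · refine ⟨by omega, hr, hm, by omega, ?_⟩
      rw [h35]
      exact ⟨fun h => by omega, fun h => absurd (h t hlt) hne⟩
  · rintro b s' ⟨t, h35, hgt, htL, hr, hm, hu, ⟨h36, hb⟩ | ⟨h36, hlt, hne, hb⟩⟩ h0
    · have hlt : t < L := by omega
      have hs := agreeCount_succ hu htL
      have e := hy.getElem?_eq_iff (i := j + t) (i' := c + t) (by omega) (by omega)
      have l1 := hy.lt (i := j + t) (by omega)
      have l2 := hy.lt (i := c + t) (by omega)
      rw [← add_assoc] at e l1 l2
      rw [← add_assoc] at e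
      simp [halts_seqs_cons, halts_seqs_singleton, halts_arith, halts_load, halts_ite, halts_const,
        ArithOp.eval, hr, R.r9, R.r10, h30, h32, h34, h35, hm]
      refine ⟨by omega, by omega, by omega, by omega, by omega, by omega, by omega,
        fun hne => ⟨by omega, 1, by omega, hgt, htL, fun r hr' => ?_, hu, ?_⟩,
        fun e1 e2 => ⟨by omega, by omega, 13 * agreeCount y j c (t + 1) L + 1, by omega, by omega,
          by omega, fun r hr' => ?_, ?_, ?_⟩⟩
      · simp [show r ≠ 36 by omega, show r ≠ 37 by omega, show r ≠ 38 by omega,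
          show r ≠ 39 by omega, hr r hr']
      · right
        refine ⟨hlt, ?_, rfl⟩
        -- The sum of the two truncated differences is nonzero exactly if the symbols differ.
        rw [e]; omega
      · simp [show r ≠ 36 by omega, show r ≠ 37 by omega, show r ≠ 38 by omega,
          show r ≠ 39 by omega, show r ≠ 35 by omega, hr r hr']
      · intro u hu'
        rcases Nat.lt_or_eq_of_le hu' with h | h
        · exact hu u h
        · rw [h, e]; omega
      · left
        omega
    · exact absurd h36 h0
  · refine ⟨g, ?_, le_rfl, hgL, fun r hr' => ?_, ?_, hg, Or.inl ⟨?_, rfl⟩⟩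
    · simp
    · simp [show r ≠ 36 by omega, show r ≠ 35 by omega]
    · simp
    · simp
  · rintro t s' ⟨ht, -, h⟩
    exact ⟨by omega, h⟩

/-- `c` is the first position from `a` on whose value under `γ` is `v`, or it is `S`, if there is
no such position below `m`. -/
structure IsNext (γ : ℕ → ℕ) (m S v a c : ℕ) : Prop where
  skip : ∀ j, a ≤ j → j < m → j < c → γ j ≠ v
  hit : (a ≤ c ∧ c < m ∧ γ c = v) ∨ c = S

/-- With `isNext_self` this describes how list heads change when the scan moves from `a + 1` to `a`:
only the list with the code of `a` gets a new head. -/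
theorem IsNext.of_ne {γ : ℕ → ℕ} {m S v a c : ℕ} (h : IsNext γ m S v (a + 1) c) (hv : γ a ≠ v) :
    IsNext γ m S v a c := by
  refine ⟨fun j h1 h2 h3 => ?_, h.hit.imp (fun h' => ⟨by omega, h'.2⟩) id⟩
  rcases Nat.eq_or_lt_of_le h1 with rfl | h4
  · exact hv
  · exact h.skip j h4 h2 h3

theorem isNext_self {γ : ℕ → ℕ} {m S a : ℕ} (h : a < m) : IsNext γ m S (γ a) a a :=
  ⟨fun j h1 _ h3 => by omega, Or.inl ⟨le_rfl, h, rfl⟩⟩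

/-- Look for a period less than `r3` of the window at index `r30`, among the positions in the list
that starts at cell `r31` of the table. If there is one, then it is stored in `r24`, and the index
is stored in `r23`. -/
def searchPeriod : Program := seqs [.arith .add 32 12 31, .load 32 32, .arith .add 33 30 3,
  .arith .sub 33 33 32,
  .loop 33 (seqs [.arith .add 34 4 30, .arith .sub 34 34 32, compareWords, .arith .sub 37 34 35,
    .ite 37
      (seqs [.arith .add 32 11 32, .load 32 32, .arith .add 33 30 3, .arith .sub 33 33 32])
      (seqs [.arith .add 23 30 14, .arith .sub 24 32 30, .const 33 0])])]

/-- A period `p'` forces equal codes at `j` and `j + p'`, since `g ≤ w - p'`. So only positions in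
the list of `j` matter. They come in increasing order, which makes the first success the least
period. The walk ends once the position reaches `j + p`, and the end mark `N + 1 + p` lies beyond
that for every window. -/
theorem halts_searchPeriod (C : CoreNums B q n p w N g) (R : CoreRegs q n p w N g s)
    (hy : Stands s.mem (4 * n) y) (hyN : y.length ≤ N + 1) {j v : ℕ} (hj : j + w ≤ y.length)
    (hv : v = gram (q ^ g) (y.drop j))
    (hhead : IsNext (fun i => gram (q ^ g) (y.drop i)) y.length (N + 1 + p) v (j + 1)
      (s.mem (12 * n + v)))
    (hnext : ∀ j', j < j' → j' < y.length →
      IsNext (fun i => gram (q ^ g) (y.drop i)) y.length (N + 1 + p) (gram (q ^ g) (y.drop j'))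
        (j' + 1) (s.mem (8 * n + j')))
    (h30 : s.reg 30 = j) (h31 : s.reg 31 = v) :
    Halts B searchPeriod s fun t s' =>
      t ≤ 26 * ∑ p' ∈ Finset.Ico 1 p, agreeCount y j (j + p') g (w - p') + 5 ∧
      (∀ r < 32, r ≠ 23 → r ≠ 24 → s'.reg r = s.reg r) ∧ s'.mem = s.mem ∧
      ((s'.reg 23 = s.reg 23 ∧ s'.reg 24 = s.reg 24 ∧ ∀ p' < p, ¬ WinPeriod w y j p') ∨
        (s'.reg 23 = j ∧ s'.reg 24 < p ∧ WinPeriod w y j (s'.reg 24) ∧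
          ∀ p' < s'.reg 24, ¬ WinPeriod w y j p')) := by
  have h1 := C.N_le
  have h2 := C.big
  have h3 := C.n_pos
  have h4 := C.table_le
  have h5 := C.g_le
  have h6 := C.w_le
  have hvlt : v < q ^ g := hv ▸ gram_lt (Nat.pow_pos (by have := C.two_le; omega)) _
  have hgram : ∀ p' < p, gram (q ^ g) (y.drop j) = gram (q ^ g) (y.drop (j + p')) ↔
      ∀ t < g, y[j + t]? = y[j + p' + t]? := fun p' hp' =>
    gram_drop_eq_iff (by omega) (by omega)
  rw [searchPeriod]
  simp only [halts_seqs_cons, halts_arith, halts_load, ArithOp.eval]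
  simp only [State.setReg_reg, R.r3, R.r12, h30, h31]
  simp only [halts_seqs_singleton]
  norm_num [h30]
  refine ⟨by omega, by omega, by omega, (halts_loop (fun b s' =>
      (∀ r < 32, r ≠ 23 → r ≠ 24 → s'.reg r = s.reg r) ∧ s'.mem = s.mem ∧
      ((∃ a, j < a ∧ IsNext (fun i => gram (q ^ g) (y.drop i)) y.length (N + 1 + p) v a
          (s'.reg 32) ∧ s'.reg 33 = j + p - s'.reg 32 ∧ s'.reg 23 = s.reg 23 ∧
          s'.reg 24 = s.reg 24 ∧ (∀ p' < p, j + p' < a → ¬ WinPeriod w y j p') ∧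
          b = 26 * ∑ p' ∈ Finset.Ico (a - j) p, agreeCount y j (j + p') g (w - p') + 1) ∨
        (s'.reg 33 = 0 ∧ b = 1 ∧ s'.reg 23 = j ∧ s'.reg 24 < p ∧ WinPeriod w y j (s'.reg 24) ∧
          ∀ p' < s'.reg 24, ¬ WinPeriod w y j p')))
    (fun s' => (∀ r < 32, r ≠ 23 → r ≠ 24 → s'.reg r = s.reg r) ∧ s'.mem = s.mem ∧
      ((s'.reg 23 = s.reg 23 ∧ s'.reg 24 = s.reg 24 ∧ ∀ p' < p, ¬ WinPeriod w y j p') ∨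
        (s'.reg 23 = j ∧ s'.reg 24 < p ∧ WinPeriod w y j (s'.reg 24) ∧
          ∀ p' < s'.reg 24, ¬ WinPeriod w y j p'))) ?_ ?_
      (b := 26 * ∑ p' ∈ Finset.Ico 1 p, agreeCount y j (j + p') g (w - p') + 1) ?_).mono ?_⟩
  · rintro b s' ⟨hr, hm, ⟨a, hja, hnx, h33, h23, h24, hno, hb⟩ | ⟨h33, hb, hf⟩⟩ h0
    · refine ⟨by omega, hr, hm, Or.inl ⟨h23, h24, fun p' hp' hper => ?_⟩⟩
      by_cases hlt : j + p' < a
      · exact hno p' hp' hlt hper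
      -- A period that was never tested belongs to a position missing from the list, whose code
      -- differs.
      · refine hnx.skip (j + p') (by omega) (by omega) (by omega) ?_
        rw [hv, eq_comm, hgram p' hp']
        exact fun t ht => hper.2.2 t (by omega)
    · exact ⟨by omega, hr, hm, Or.inr hf⟩
  · rintro b s' ⟨hr, hm, ⟨a, hja, hnx, h33, h23, h24, hno, hb⟩ | ⟨h33, hb, hf⟩⟩ h0
    · obtain ⟨hac, hcm, hcv⟩ := hnx.hit.resolve_right (by omega)
      set c := s'.reg 32 with hc
      obtain ⟨p', hp'⟩ : ∃ p', c = j + p' := ⟨c - j, by omega⟩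
      have R' : CoreRegs q n p w N g s' := R.congr fun r hr' =>
        hr r (by omega) (by omega) (by omega)
      have h30' : s'.reg 30 = j := by rw [hr 30 (by omega) (by omega) (by omega), h30]
      have hL : w + j - c = w - p' := by omega
      -- Equal codes are agreement on the first `g` symbols, which the comparison takes for granted.
      have hag := (hgram p' (by omega)).1 (by rw [← hp', hcv, hv])
      have hsum : agreeCount y j (j + p') g (w - p') +
          ∑ p'' ∈ Finset.Ico (p' + 1) p, agreeCount y j (j + p'') g (w - p'') ≤
          ∑ p'' ∈ Finset.Ico (a - j) p, agreeCount y j (j + p'') g (w - p'') := by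
        rw [← Finset.sum_eq_sum_Ico_succ_bot (show p' < p by omega)
          (fun p'' => agreeCount y j (j + p'') g (w - p''))]
        exact Finset.sum_le_sum_of_subset (Finset.Ico_subset_Ico_left (by omega))
      -- Every visited position counts at least once, so the overhead of a round is absorbed by
      -- doubling `13` to `26`.
      have hpos : 1 ≤ agreeCount y j (j + p') g (w - p') := by
        rw [agreeCount_succ hag (by omega)]; omega
      simp only [halts_seqs_cons, halts_arith, ArithOp.eval]
      simp only [State.setReg_reg, R'.r4, h30', ← hc]
      norm_num
      refine ⟨by omega, by omega, (halts_compareWords (L := w - p') (c := j + p') (j := j) C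
        (R'.congr fun r hr' => ?_) (by simpa [hm] using hy) hyN (by omega) (by omega) (by omega)
        hag (by simp [h30']) (by simp [← hc, hp']) (by simp [hL])).mono ?_⟩
      · simp [show r ≠ 34 by omega]
      rintro t s'' ⟨ht, hr'', hm'', h35, h35'⟩
      have hnext' := hnext c (by omega) (by omega)
      have e34 := hr'' 34 (by omega)
      have e4 := hr'' 4 (by omega)
      have e3 := hr'' 3 (by omega)
      have e30 := hr'' 30 (by omega)
      have e32 := hr'' 32 (by omega)
      have e11 := hr'' 11 (by omega)
      have e14 := hr'' 14 (by omega)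
      simp [R'.r4, R'.r3, R'.r11, R'.r14, h30', ← hc] at e34 e4 e3 e30 e32 e11 e14 hm''
      simp [halts_seqs_singleton, halts_seqs_cons, halts_arith, halts_load, halts_ite, halts_const,
        ArithOp.eval, e34, e3, e30, e32, e11, e14, hm'', hm]
      refine ⟨by omega, fun hne => ⟨by omega, by omega, by omega, _, ?_,
          fun r hr1 hr2 hr3 => ?_, Or.inl ⟨c + 1, by omega, ?_, ?_, ?_, ?_, rfl⟩⟩,
        fun heq => ⟨by omega, by omega, by omega, 1, by omega, fun r hr1 hr2 hr3 => ?_,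
          Or.inr ⟨rfl, by omega, ?_, ?_⟩⟩⟩
      · rw [show c + 1 - j = p' + 1 by omega]
        omega
      · simp [show r ≠ 33 by omega, show r ≠ 32 by omega, show r ≠ 37 by omega,
          hr'' r (by omega), show r ≠ 34 by omega, hr r hr1 hr2 hr3]
      · rw [hcv] at hnext'
        exact hnext'
      · rw [hr'' 23 (by omega)]
        simpa using h23
      · rw [hr'' 24 (by omega)]
        simpa using h24
      · intro p'' hp'' hlt hper
        by_cases hlt' : j + p'' < a
        · exact hno p'' hp'' hlt' hper
        by_cases heq : p'' = p'
        · subst heq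
          have := h35'.2 hper.2.2
          omega
        · refine hnx.skip (j + p'') (by omega) (by omega) (by omega) ?_
          rw [hv, eq_comm, hgram p'' hp'']
          exact fun t ht => hper.2.2 t (by omega)
      · simp [show r ≠ 33 by omega, hr2, hr3, show r ≠ 37 by omega,
          hr'' r (by omega), show r ≠ 34 by omega, hr r hr1 hr2 hr3]
      · rw [show c - j = p' by omega]
        exact ⟨by omega, by omega, h35'.1 (by omega)⟩
      · intro p'' hp'' hper
        by_cases hlt' : j + p'' < a
        · exact hno p'' (by omega) hlt' hper
        · refine hnx.skip (j + p'') (by omega) (by omega) (by omega) ?_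
          rw [hv, eq_comm, hgram p'' (by omega)]
          exact fun t ht => hper.2.2 t (by omega)
    · exact absurd h33 h0
  · refine ⟨fun r h1 h2 h3 => ?_, ?_, Or.inl ⟨j + 1, by omega, ?_, ?_, ?_, ?_, ?_, ?_⟩⟩
    · simp [show r ≠ 33 by omega, show r ≠ 32 by omega]
    · simp
    · simpa using hhead
    · simp
    · simp
    · simp
    · intro p' hp' hlt hper
      have := hper.1
      omega
    · simp
  · rintro t s' ⟨ht, -, h⟩
    exact ⟨by omega, h⟩

end Search

end PeriodAvoiding

namespace PeriodAvoiding

/-! ### The scan of a word for its first bad window -/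

section Find

variable {B q n p w N g : ℕ} {s : State} {y : List (Fin q)}

/-- From the code in `r31` of the factor at the index after `r30` compute that at index `r30`;
`r37` becomes nonzero if a window starts there. -/
def gramStep : Program := seqs [.arith .add 37 10 30, .load 37 37, .arith .mul 37 37 7,
  .arith .add 31 31 37, .arith .div 31 31 0, .arith .sub 37 22 30]

theorem halts_gramStep (C : CoreNums B q n p w N g) (R : CoreRegs q n p w N g s)
    (hy : Stands s.mem (4 * n) y) (hyN : y.length ≤ N + 1) {j : ℕ} (hj : j < y.length)
    (h22 : s.reg 22 = y.length + 1 - w) (h30 : s.reg 30 = j)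
    (h31 : s.reg 31 = gram (q ^ g) (y.drop (j + 1))) :
    Halts B gramStep s fun t s' => t = 6 ∧ (∀ r < 37, r ≠ 31 → s'.reg r = s.reg r) ∧
      s'.mem = s.mem ∧ s'.reg 31 = gram (q ^ g) (y.drop j) ∧
      s'.reg 37 = y.length + 1 - w - j := by
  have h1 := C.N_le
  have h2 := C.big
  have h3 := C.gram_le
  have hq := C.two_le
  have hG : 0 < q ^ g := Nat.pow_pos (by omega)
  have hb : gram (q ^ g) (y.drop (j + 1)) + y[j] * q ^ g < q * q ^ g := by
    have hlt := gram_lt hG (y.drop (j + 1))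
    have hle : ((y[j] : ℕ) + 1) * q ^ g ≤ q * q ^ g := Nat.mul_le_mul_right _ y[j].2
    rw [Nat.succ_mul] at hle
    omega
  rw [gramStep]
  simp [halts_seqs_cons, halts_seqs_singleton, halts_arith, halts_load, ArithOp.eval, R.r10, R.r7,
    R.r0, h22, h30, h31, hy j hj, ← gram_drop hj]
  have := gram_lt hG (y.drop j)
  have := Nat.le_mul_of_pos_left (q ^ g) (show 0 < q by omega)
  refine ⟨by omega, by omega, by omega, by omega, by omega, fun r hr hr' => ?_⟩
  simp [show r ≠ 37 by omega, hr']

/-- Insert the position `r30` in front of the list with the code `r31`. -/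
def insertStep : Program := seqs [.arith .add 37 12 31, .load 38 37, .arith .add 39 11 30,
  .store 39 38, .store 37 30]

theorem halts_insertStep (C : CoreNums B q n p w N g) (R : CoreRegs q n p w N g s) {j v : ℕ}
    (hj : j < 4 * n) (hv : v < q ^ g) (h30 : s.reg 30 = j) (h31 : s.reg 31 = v) :
    Halts B insertStep s fun t s' => t = 5 ∧ (∀ r < 37, s'.reg r = s.reg r) ∧
      ∀ a, s'.mem a = if a = 12 * n + v then j else
        if a = 8 * n + j then s.mem (12 * n + v) else s.mem a := by
  have h2 := C.big
  have h3 := C.table_le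
  rw [insertStep]
  simp [halts_seqs_cons, halts_seqs_singleton, halts_arith, halts_load, halts_store, ArithOp.eval,
    R.r11, R.r12, h30, h31]
  refine ⟨by omega, by omega, by omega, fun r hr => ?_⟩
  simp [show r ≠ 37 by omega, show r ≠ 38 by omega, show r ≠ 39 by omega]

/-- Look for the first window with a period less than `p` of the word of length `r21` in the buffer;
`r22` is the number of windows. The index is stored in `r23` and the period in `r24`; this is zero
if there is no such window. -/
def findBad : Program := seqs [.arith .add 27 12 14, .arith .add 28 13 14, .arith .add 30 7 14,
  fill, .const 24 0, .const 31 0, .arith .add 30 21 14,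
  downLoop 30 (seqs [gramStep, .ite 37 searchPeriod .skip, insertStep])]

/-- The result of the search among the windows at the indices from `j` on: `i` and `p'` are the
first index and its least period, or `p'` is zero. -/
def FoundFrom (w p : ℕ) (y : List (Fin q)) (j i p' : ℕ) : Prop :=
  (p' = 0 ∧ ∀ i', j ≤ i' → i' + w ≤ y.length → ∀ p'' < p, ¬ WinPeriod w y i' p'') ∨
  (p' ≠ 0 ∧ p' < p ∧ i + w ≤ y.length ∧ WinPeriod w y i p' ∧ (∀ p'' < p', ¬ WinPeriod w y i p'') ∧
    ∀ i', j ≤ i' → i' < i → ∀ p'' < p, ¬ WinPeriod w y i' p'')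

/-- The window at `j` is tested before `j` enters its list, so the lists hold only later positions.
A success overwrites an earlier one, which had a larger index. -/
theorem halts_findBad_body (C : CoreNums B q n p w N g) (R : CoreRegs q n p w N g s)
    (hy : Stands s.mem (4 * n) y) (hyN : y.length ≤ N + 1)
    (h22 : s.reg 22 = y.length + 1 - w) {j : ℕ} (hj : j < y.length) (h30 : s.reg 30 = j)
    (h31 : s.reg 31 = gram (q ^ g) (y.drop (j + 1)))
    (hhead : ∀ v < q ^ g, IsNext (fun i => gram (q ^ g) (y.drop i)) y.length (N + 1 + p) v (j + 1)
      (s.mem (12 * n + v)))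
    (hnext : ∀ j', j < j' → j' < y.length →
      IsNext (fun i => gram (q ^ g) (y.drop i)) y.length (N + 1 + p) (gram (q ^ g) (y.drop j'))
        (j' + 1) (s.mem (8 * n + j')))
    (hfound : FoundFrom w p y (j + 1) (s.reg 23) (s.reg 24)) :
    Halts B (seqs [gramStep, .ite 37 searchPeriod .skip, insertStep]) s fun t s' =>
      t ≤ 26 * (if j < y.length + 1 - w then
        ∑ p' ∈ Finset.Ico 1 p, agreeCount y j (j + p') g (w - p') else 0) + 17 ∧
      (∀ r < 31, r ≠ 23 → r ≠ 24 → s'.reg r = s.reg r) ∧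
      (∀ a < 8 * n, s'.mem a = s.mem a) ∧ s'.reg 31 = gram (q ^ g) (y.drop j) ∧
      (∀ v < q ^ g, IsNext (fun i => gram (q ^ g) (y.drop i)) y.length (N + 1 + p) v j
        (s'.mem (12 * n + v))) ∧
      (∀ j', j ≤ j' → j' < y.length →
        IsNext (fun i => gram (q ^ g) (y.drop i)) y.length (N + 1 + p) (gram (q ^ g) (y.drop j'))
        (j' + 1) (s'.mem (8 * n + j'))) ∧
      FoundFrom w p y j (s'.reg 23) (s'.reg 24) := by
  have h1 := C.N_le
  have h2 := C.n_pos
  have hv : gram (q ^ g) (y.drop j) < q ^ g :=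
    gram_lt (Nat.pow_pos (by have := C.two_le; omega)) _
  set γ := fun i => gram (q ^ g) (y.drop i) with hγ
  rw [halts_seqs_cons]
  refine (halts_gramStep C R hy hyN hj h22 h30 h31).mono ?_
  rintro t₁ s₁ ⟨ht₁, hr₁, hm₁, h31₁, h37₁⟩
  have hsearch : Halts B (.ite 37 searchPeriod .skip) s₁ fun t s₂ =>
      t ≤ 26 * (if j < y.length + 1 - w then
        ∑ p' ∈ Finset.Ico 1 p, agreeCount y j (j + p') g (w - p') else 0) + 6 ∧
      (∀ r < 32, r ≠ 23 → r ≠ 24 → s₂.reg r = s₁.reg r) ∧ s₂.mem = s₁.mem ∧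
      FoundFrom w p y j (s₂.reg 23) (s₂.reg 24) := by
    rw [halts_ite, h37₁]
    have e23 := hr₁ 23 (by omega) (by omega)
    have e24 := hr₁ 24 (by omega) (by omega)
    refine ⟨fun hA => ?_, fun hA => ?_⟩
    · rw [if_pos (by omega)]
      refine (halts_searchPeriod C (R.congr fun r hr => hr₁ r (by omega) (by omega))
        (by rwa [hm₁]) hyN (j := j) (by omega) rfl (by rw [hm₁]; exact hhead _ hv)
        (by rw [hm₁]; exact hnext) (by rw [hr₁ 30 (by omega) (by omega), h30]) h31₁).mono ?_
      rintro t s₂ ⟨ht, hr, hm, hf⟩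
      refine ⟨by omega, hr, hm, ?_⟩
      rcases hf with ⟨h23, h24, hno⟩ | ⟨h23, hlt, hper, hleast⟩
      · rw [h23, h24, e23, e24]
        rcases hfound with ⟨h0, hall⟩ | ⟨h0, hp, hi, hper, hleast, hall⟩
        · refine Or.inl ⟨h0, fun i' hi' => ?_⟩
          rcases Nat.eq_or_lt_of_le hi' with rfl | h
          · exact fun _ => hno
          · exact hall i' h
        · refine Or.inr ⟨h0, hp, hi, hper, hleast, fun i' hi' => ?_⟩
          rcases Nat.eq_or_lt_of_le hi' with rfl | h
          · exact fun _ => hno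
          · exact hall i' h
      · rw [h23]
        refine Or.inr ⟨?_, hlt, by omega, hper, hleast, fun i' _ _ => by omega⟩
        have := hper.1
        omega
    · rw [halts_skip, if_neg (by omega)]
      refine ⟨by omega, fun _ _ _ _ => rfl, rfl, ?_⟩
      rw [e23, e24]
      rcases hfound with ⟨h0, hall⟩ | ⟨h0, hp, hi, hper, hleast, hall⟩
      · exact Or.inl ⟨h0, fun i' hi' hi'' => by omega⟩
      · refine Or.inr ⟨h0, hp, hi, hper, hleast, fun i' hi' => ?_⟩
        rcases Nat.eq_or_lt_of_le hi' with rfl | h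
        · omega
        · exact hall i' h
  rw [halts_seqs_cons]
  refine hsearch.mono ?_
  rintro t₂ s₂ ⟨ht₂, hr₂, hm₂, hf₂⟩
  rw [halts_seqs_singleton]
  have e30 : s₂.reg 30 = j := by
    rw [hr₂ 30 (by omega) (by omega) (by omega), hr₁ 30 (by omega) (by omega), h30]
  have e31 : s₂.reg 31 = gram (q ^ g) (y.drop j) := by
    rw [hr₂ 31 (by omega) (by omega) (by omega), h31₁]
  refine (halts_insertStep C (R.congr fun r hr => ?_) (by omega) hv e30 e31).mono ?_
  · rw [hr₂ r (by omega) (by omega) (by omega), hr₁ r (by omega) (by omega)]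
  rintro t₃ s₃ ⟨ht₃, hr₃, hm₃⟩
  rw [hm₂, hm₁] at hm₃
  refine ⟨by omega, fun r hr hr' hr'' => ?_, fun a ha => ?_, ?_, fun v hv' => ?_,
    fun j' hj' hj'' => ?_, ?_⟩
  · rw [hr₃ r (by omega), hr₂ r (by omega) hr' hr'', hr₁ r (by omega) (by omega)]
  · rw [hm₃, if_neg (by omega), if_neg (by omega)]
  · rw [hr₃ 31 (by omega), e31]
  · rw [hm₃]
    by_cases hvv : v = gram (q ^ g) (y.drop j)
    · rw [if_pos (by omega), hvv]
      exact isNext_self (γ := γ) hj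
    · rw [if_neg (by omega), if_neg (by omega)]
      exact (hhead v hv').of_ne (Ne.symm hvv)
  · rw [hm₃, if_neg (by omega)]
    rcases Nat.eq_or_lt_of_le hj' with rfl | h
    · rw [if_pos rfl]
      exact hhead _ hv
    · rw [if_neg (by omega)]
      exact hnext j' h hj''
  · rwa [hr₃ 23 (by omega), hr₃ 24 (by omega)]

theorem sum_range_ite_lt {m A : ℕ} (h : A ≤ m) (f : ℕ → ℕ) :
    ∑ j ∈ Finset.range m, (if j < A then f j else 0) = ∑ j ∈ Finset.range A, f j := by
  rw [← Finset.sum_filter]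
  congr 1
  ext j
  simp only [Finset.mem_filter, Finset.mem_range]
  omega

/-- The scan from right to left updates each code from its successor, sorts the lists without effort
and leaves the first bad index as the last success. The term `4 * q ^ g` pays for clearing the
heads. -/
theorem halts_findBad (C : CoreNums B q n p w N g) (R : CoreRegs q n p w N g s)
    (hy : Stands s.mem (4 * n) y) (hyN : y.length ≤ N + 1) (h21 : s.reg 21 = y.length)
    (h22 : s.reg 22 = y.length + 1 - w) :
    Halts B findBad s fun t s' =>
      t ≤ 26 * matchCost g w p (y.length + 1 - w) y + 19 * y.length + 4 * q ^ g + 8 ∧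
      (∀ r < 23, s'.reg r = s.reg r) ∧ (∀ a < 8 * n, s'.mem a = s.mem a) ∧
      ((s'.reg 24 = 0 ∧ IsLPA w p y) ∨
        (s'.reg 24 ≠ 0 ∧ IsFirstBad w p y (s'.reg 23) (s'.reg 24))) := by
  have h1 := C.N_le
  have h2 := C.n_pos
  have h3 := C.big
  have h4 := C.table_le
  have h5 := C.p_lt
  have h6 := C.w_le
  rw [findBad]
  simp only [halts_seqs_cons, halts_arith, ArithOp.eval]
  simp only [State.setReg_reg, R.r12, R.r13, R.r7, R.r14]
  norm_num [R.r12, R.r13, R.r7, R.r14]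
  refine ⟨by omega, by omega, by omega, (halts_fill (dst := 12 * n) (v := N + 1 + p) (len := q ^ g)
    (by omega) (by omega) ?_ ?_ ?_ ?_).mono ?_⟩
  · simp [R.r9]
  · simp
  · simp
  · simp
  rintro t₁ s₁ ⟨ht₁, hr₁, hm₁⟩
  simp only [State.setReg_mem] at hm₁
  have hr₁' : ∀ r < 27, s₁.reg r = s.reg r := fun r hr => by
    simp [hr₁ r (by omega), show r ≠ 27 by omega, show r ≠ 28 by omega, show r ≠ 30 by omega]
  simp [halts_const, hr₁' 21, hr₁' 14, R.r14, h21, halts_seqs_singleton]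
  refine ⟨by omega, by omega, (halts_downLoop (len := y.length) (fun j s' =>
    (∀ r < 23, s'.reg r = s.reg r) ∧ (∀ a < 8 * n, s'.mem a = s.mem a) ∧
    s'.reg 31 = gram (q ^ g) (y.drop j) ∧
    (∀ v < q ^ g, IsNext (fun i => gram (q ^ g) (y.drop i)) y.length (N + 1 + p) v j
        (s'.mem (12 * n + v))) ∧
      (∀ j', j ≤ j' → j' < y.length →
        IsNext (fun i => gram (q ^ g) (y.drop i)) y.length (N + 1 + p) (gram (q ^ g) (y.drop j'))
        (j' + 1) (s'.mem (8 * n + j'))) ∧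
      FoundFrom w p y j (s'.reg 23) (s'.reg 24))
    (fun j => 26 * (if j < y.length + 1 - w then
      ∑ p' ∈ Finset.Ico 1 p, agreeCount y j (j + p') g (w - p') else 0) + 17)
    (by omega) ?_ ?_ ?_ ?_).mono ?_⟩
  · rintro j s' ⟨hr, -⟩
    rw [hr 9 (by omega), R.r9]
  · rintro j hj s' h30 ⟨hr, hm, h31, hhead, hnext, hf⟩
    refine (halts_findBad_body (y := y) C (R.congr fun r hr' => ?_) ?_ hyN ?_ hj ?_ ?_ ?_ ?_ ?_).mono ?_
    · simp [show r ≠ 30 by omega, hr r (by omega)]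
    · exact hy.congr fun a _ ha => hm a (by omega)
    · simp [hr 22, h22]
    · simp
    · simpa using h31
    · simpa using hhead
    · exact hnext
    · simpa using hf
    rintro t s'' ⟨ht, hr'', hm'', h31'', hrest⟩
    refine ⟨ht, ?_, fun r hr' => ?_, fun a ha => ?_, h31'', hrest⟩
    · rw [hr'' 30 (by omega) (by omega) (by omega)]; simp
    · simp [hr'' r (by omega) (by omega) (by omega), show r ≠ 30 by omega, hr r hr']
    · rw [hm'' a ha]; exact hm a ha
  · simp
  -- Before the scan all lists are empty, so each head is the end mark, and the code of the empty
  -- suffix is zero.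
  · refine ⟨fun r hr => ?_, fun a ha => ?_, ?_, fun v hv => ⟨fun j hj hj' => by omega, Or.inr ?_⟩,
      fun j' hj' hj'' => by omega, Or.inl ⟨?_, fun i' hi' hi'' => by omega⟩⟩
    · simp [hr₁' r (by omega), show r ≠ 30 by omega, show r ≠ 31 by omega, show r ≠ 24 by omega]
    · simp only [State.setReg_mem]
      rw [hm₁, if_neg (by omega)]
    · simp [gram]
    · simp only [State.setReg_mem]
      rw [hm₁, if_pos (by omega)]
    · simp
  · rintro t₂ s₂ ⟨ht₂, -, hr₂, hm₂, -, -, -, hf⟩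
    refine ⟨?_, hr₂, hm₂, ?_⟩
    · rw [Finset.sum_add_distrib, Finset.sum_add_distrib, ← Finset.mul_sum,
        sum_range_ite_lt (by omega)] at ht₂
      simp only [Finset.sum_const, Finset.card_range, smul_eq_mul] at ht₂
      have : matchCost g w p (y.length + 1 - w) y = ∑ j ∈ Finset.range (y.length + 1 - w),
          ∑ p' ∈ Finset.Ico 1 p, agreeCount y j (j + p') g (w - p') := rfl
      omega
    · rcases hf with ⟨h0, hall⟩ | ⟨h0, hp, hi, hper, hleast, hall⟩
      · exact Or.inl ⟨h0, isLPA_iff.2 fun i hi p' hp' => hall i (by omega) hi p' hp'⟩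
      · exact Or.inr ⟨h0, hi, hp, hper, fun i' hi' => hall i' (by omega) hi', hleast⟩

end Find

end PeriodAvoiding

namespace PeriodAvoiding

/-! ### Parts of words in memory -/

section StandsLemmas

variable {q : ℕ} {mem mem' : ℕ → ℕ} {b : ℕ} {y z : List (Fin q)}

theorem stands_nil : Stands mem b ([] : List (Fin q)) := fun i hi => by simp at hi

theorem stands_singleton {a : Fin q} (h : mem b = a) : Stands mem b [a] := by
  intro i hi
  obtain rfl : i = 0 := by simpa using hi
  simpa using h

theorem stands_replicate {a : Fin q} {d : ℕ} (h : ∀ t < d, mem (b + t) = a) :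
    Stands mem b (List.replicate d a) := by
  intro i hi
  rw [h i (by simpa using hi)]
  simp

theorem Stands.take (h : Stands mem b y) (i : ℕ) : Stands mem b (y.take i) := by
  rw [← List.take_append_drop i y] at h
  exact (stands_append.1 h).1

theorem Stands.drop (h : Stands mem b y) {i : ℕ} (hi : i ≤ y.length) :
    Stands mem (b + i) (y.drop i) := by
  rw [← List.take_append_drop i y] at h
  have := (stands_append.1 h).2
  rwa [List.length_take, min_eq_left hi] at this

end StandsLemmas

/-! ### The repair step on the machine -/

section RepairProgram

variable {B q n p w N g : ℕ} [NeZero q] {s : State} {y : List (Fin q)}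

/-- Write the representation of `r31` with `r30` symbols into the cells from `r27` on. -/
def writeDigits : Program := downLoop 30 (seqs [.arith .mod 37 31 0, .arith .div 31 31 0,
  .arith .add 38 27 30, .store 38 37])

/-- Repeated division produces the least significant symbol first, which fits a loop filling the
cells from the last to the first. -/
theorem halts_writeDigits {dst d i : ℕ} (hd : d < B) (hdst : dst + d ≤ B) (hi : i < B)
    (h0 : s.reg 0 = q) (h9 : s.reg 9 = 1) (h27 : s.reg 27 = dst) (h30 : s.reg 30 = d)
    (h31 : s.reg 31 = i) :
    Halts B writeDigits s fun t s' => t ≤ 6 * d + 1 ∧ (∀ r < 30, s'.reg r = s.reg r) ∧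
      (∀ a, a < dst ∨ dst + d ≤ a → s'.mem a = s.mem a) ∧ Stands s'.mem dst (digits q d i) := by
  refine (halts_downLoop_const (fun j s' => (∀ r < 30, s'.reg r = s.reg r) ∧
    s'.reg 31 = i / q ^ (d - j) ∧ (∀ a, a < dst ∨ dst + d ≤ a → s'.mem a = s.mem a) ∧
    ∀ t, j ≤ t → t < d → s'.mem (dst + t) = i / q ^ (d - 1 - t) % q)
    4 hd (fun j s' h => by rw [h.1 9 (by omega), h9]) ?_ h30
    ⟨fun _ _ => rfl, by simp [h31], fun _ _ => rfl, fun t _ _ => by omega⟩).mono ?_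
  · rintro j hj s' hj' ⟨hr, h31', hm, hdig⟩
    have e1 : i / q ^ (d - (j + 1)) / q = i / q ^ (d - j) := by
      rw [Nat.div_div_eq_div_mul, ← pow_succ]; congr 2; omega
    have l1 := Nat.div_le_self i (q ^ (d - (j + 1)))
    have l2 := Nat.mod_le (i / q ^ (d - (j + 1))) q
    have l3 := Nat.div_le_self (i / q ^ (d - (j + 1))) q
    simp [halts_seqs_cons, halts_seqs_singleton, halts_arith, halts_store,
      ArithOp.eval, hr, h27, h31', h0]
    refine ⟨by omega, by omega, by omega, fun r hr' => ?_, e1, fun a ha => ?_, fun t ht ht' => ?_⟩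
    · simp [hr r hr', show r ≠ 30 by omega, show r ≠ 37 by omega, show r ≠ 38 by omega,
        show r ≠ 31 by omega]
    · rw [if_neg (by omega), hm a ha]
    · rcases Nat.eq_or_lt_of_le ht with rfl | h
      · rw [if_pos rfl, show d - 1 - j = d - (j + 1) by omega]
      · rw [if_neg (by omega), hdig t h ht']
  · rintro t s' ⟨ht, -, hr, -, hm, hdig⟩
    refine ⟨ht, hr, hm, fun t ht => ?_⟩
    rw [digits_length] at ht
    rw [hdig t (by omega) ht]
    simp [digits, Fin.ofNat]

/-- Append the first `r24` symbols of the window at index `r23`, a one, and zeros to the word of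
length `r21` in the buffer. -/
def writeKernel : Program := seqs [.arith .add 25 10 21,
  .arith .add 27 25 14, .arith .add 28 10 23, .arith .add 30 24 14, copyDown,
  .arith .add 37 25 24, .store 37 9,
  .arith .add 27 37 9, .arith .add 28 14 14, .arith .sub 30 3 24, .arith .sub 30 30 9, fill]

theorem halts_writeKernel (C : CoreNums B q n p w N g) (R : CoreRegs q n p w N g s)
    (hy : Stands s.mem (4 * n) y) (hyN : y.length ≤ N + 1) {m i p' : ℕ} (hm : y.length = m)
    (hi : i + p' ≤ m) (hp : p' < p) (h21 : s.reg 21 = m) (h23 : s.reg 23 = i)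
    (h24 : s.reg 24 = p') :
    Halts B writeKernel s fun t s' => t ≤ 6 * p + 12 ∧
      (∀ r < 25, s'.reg r = s.reg r) ∧ (∀ a < 4 * n, s'.mem a = s.mem a) ∧
      Stands s'.mem (4 * n)
        (y ++ (window y i p' ++ 1 :: List.replicate (p - p' - 1) (0 : Fin q))) := by
  have c1 := C.N_le
  have c2 := C.n_pos
  have c3 := C.big
  have c5 := C.p_lt
  have c6 := C.w_le
  have c7 := C.two_le
  have hkl : (window y i p').length = p' := window_length (by omega)
  rw [writeKernel]
  simp [halts_seqs_cons, halts_arith, ArithOp.eval, R.r10, h21, R.r14, h23, h24]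
  refine ⟨by omega, by omega, by omega, (halts_copyDown (dst := 4 * n + m) (src := 4 * n + i)
    (len := p') (by omega) (by omega) (by omega) (by omega) ?_ ?_ ?_ ?_).mono ?_⟩
  · simp [R.r9]
  · simp
  · simp
  · simp
  rintro t₁ s₁ ⟨ht₁, hr₁, hm₁⟩
  simp only [State.setReg_mem] at hm₁
  have f₁ : ∀ r < 25, s₁.reg r = s.reg r := fun r hr => by
    simp [hr₁ r (by omega), show r ≠ 30 by omega, show r ≠ 28 by omega, show r ≠ 27 by omega,
      show r ≠ 25 by omega]
  have g₁ : s₁.reg 25 = 4 * n + m := by simp [hr₁ 25]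
  simp [halts_store, halts_seqs_singleton, g₁, f₁ 24, f₁ 9, f₁ 14, f₁ 3, R.r3, R.r14, R.r9, h24]
  refine ⟨by omega, by omega, by omega, by omega, by omega,
    (halts_fill (dst := 4 * n + m + p' + 1) (v := 0)
    (len := p - p' - 1) (by omega) (by omega) ?_ ?_ ?_ ?_).mono ?_⟩
  · simp [f₁ 9, R.r9]
  · simp
  · simp
  · simp
  rintro t₂ s₂ ⟨ht₂, hr₂, hm₂⟩
  simp only [State.setReg_mem, State.setMem_mem] at hm₂
  refine ⟨by omega, fun r hr => ?_, fun a ha => ?_, ?_⟩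
  · simp [hr₂ r (by omega), show r ≠ 30 by omega, show r ≠ 28 by omega, show r ≠ 27 by omega,
      show r ≠ 37 by omega, f₁ r hr]
  · rw [hm₂, if_neg (by omega), if_neg (by omega), hm₁, if_neg (by omega)]
  · rw [stands_append, stands_append, hkl, ← List.singleton_append, stands_append, hm]
    refine ⟨hy.congr fun a ha ha' => ?_, (stands_window hy i p').move fun t ht => ?_,
      stands_singleton ?_, stands_replicate fun t ht => ?_⟩
    · rw [hm₂, if_neg (by omega), if_neg (by omega), hm₁, if_neg (by omega)]
    · rw [hkl] at ht
      rw [hm₂, if_neg (by omega), if_neg (by omega), hm₁, if_pos (by omega)]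
      congr 1; omega
    · rw [hm₂, if_neg (by omega), if_pos (by omega), Fin.val_one', Nat.mod_eq_of_lt (by omega)]
    · rw [List.length_singleton, hm₂, if_pos (by omega), Fin.val_zero]

/-- Append the representation of `r23` with `r4 - r3 - 1` symbols and a zero to the word of length
`r21 + r3` in the buffer. -/
def writeIndex : Program := seqs [.arith .add 25 10 21,
  .arith .add 27 25 3, .arith .add 31 23 14, .arith .sub 30 4 3, .arith .sub 30 30 9, writeDigits,
  .arith .add 37 25 4, .arith .sub 37 37 9, .store 37 14]

theorem halts_writeIndex (C : CoreNums B q n p w N g) (R : CoreRegs q n p w N g s)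
    {z : List (Fin q)} (hz : Stands s.mem (4 * n) z) {m i : ℕ} (hzl : z.length = m + p)
    (hmN : m ≤ N + 1) (hi : i < m) (h21 : s.reg 21 = m) (h23 : s.reg 23 = i) :
    Halts B writeIndex s fun t s' => t ≤ 6 * w + 9 ∧
      (∀ r < 25, s'.reg r = s.reg r) ∧ (∀ a < 4 * n, s'.mem a = s.mem a) ∧
      Stands s'.mem (4 * n) (z ++ digits q (w - p - 1) i ++ [0]) := by
  have c1 := C.N_le
  have c2 := C.n_pos
  have c3 := C.big
  have c5 := C.p_lt
  have c6 := C.w_le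
  rw [writeIndex]
  simp [halts_seqs_cons, halts_arith, ArithOp.eval, R.r10, R.r14, R.r3, R.r4, R.r9, h21, h23]
  refine ⟨by omega, by omega, by omega, by omega, by omega,
    (halts_writeDigits (dst := 4 * n + m + p) (i := i)
    (d := w - p - 1) (q := q) (by omega) (by omega) (by omega) ?_ ?_ ?_ ?_ ?_).mono ?_⟩
  · simp [R.r0]
  · simp [R.r9]
  · simp
  · simp
  · simp
  rintro t₃ s₃ ⟨ht₃, hr₃, hm₃, hdig⟩
  simp only [State.setReg_mem] at hm₃
  have f₃ : ∀ r < 25, s₃.reg r = s.reg r := fun r hr => by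
    simp [hr₃ r (by omega), show r ≠ 30 by omega, show r ≠ 31 by omega, show r ≠ 27 by omega,
      show r ≠ 25 by omega]
  have g₃ : s₃.reg 25 = 4 * n + m := by simp [hr₃ 25]
  simp [halts_store, halts_seqs_singleton, g₃, f₃ 14, f₃ 4, f₃ 9, R.r14, R.r9, R.r4]
  refine ⟨by omega, by omega, by omega, fun r hr => ?_, fun a ha => ?_, ?_⟩
  · simp [show r ≠ 37 by omega, f₃ r hr]
  · rw [if_neg (by omega), hm₃ a (by omega)]
  · rw [← List.append_assoc, stands_append, stands_append, List.length_append, hzl, digits_length]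
    refine ⟨⟨hz.congr fun a ha ha' => ?_, hdig.move fun t ht => ?_⟩, stands_singleton ?_⟩
    · rw [hzl] at ha'
      simp only [State.setMem_mem, State.setReg_mem]
      rw [if_neg (by omega), hm₃ a (by omega)]
    · rw [digits_length] at ht
      simp only [State.setMem_mem, State.setReg_mem]
      rw [if_neg (by omega)]
      congr 1; omega
    · simp only [State.setMem_mem]
      rw [if_pos (by omega), Fin.val_zero]

/-- Remove the window at index `r23` from the word of length `r21` and the block after it. -/
def removeWindow : Program := seqs [.arith .add 27 10 23, .arith .add 28 27 4,
  .arith .sub 30 21 23, copyUp]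

/-- A single move of `m - i` cells closes the gap: the `m - i - w` symbols behind the window and the
`w` symbols of the block. -/
theorem halts_removeWindow (C : CoreNums B q n p w N g) (R : CoreRegs q n p w N g s)
    {z : List (Fin q)} {m i : ℕ} (hz : Stands s.mem (4 * n) z) (hzl : z.length = m + w)
    (hm : m ≤ N + 1) (hi : i + w ≤ m) (h21 : s.reg 21 = m) (h23 : s.reg 23 = i) :
    Halts B removeWindow s fun t s' => t ≤ 6 * m + 4 ∧
      (∀ r < 25, s'.reg r = s.reg r) ∧ (∀ a < 4 * n, s'.mem a = s.mem a) ∧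
      Stands s'.mem (4 * n) (z.take i ++ z.drop (i + w)) := by
  have c1 := C.N_le
  have c2 := C.n_pos
  have c3 := C.big
  rw [removeWindow]
  simp [halts_seqs_cons, halts_seqs_singleton, halts_arith, ArithOp.eval, R.r4, R.r10, h21, h23]
  refine ⟨by omega, by omega, by omega, (halts_copyUp (dst := 4 * n + i)
    (src := 4 * n + i + w) (len := m - i) (by omega) (by omega) (by omega) (by omega)
    ?_ ?_ ?_ ?_).mono ?_⟩
  · simp [R.r9]
  · simp
  · simp
  · simp
  rintro t₄ s₄ ⟨ht₄, hr₄, hm₄⟩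
  simp only [State.setReg_mem] at hm₄
  refine ⟨by omega, fun r hr => ?_, fun a ha => ?_, ?_⟩
  · simp [hr₄ r (by omega), show r ≠ 30 by omega, show r ≠ 28 by omega, show r ≠ 27 by omega]
  · rw [hm₄, if_neg (by omega)]
  · rw [stands_append]
    have htl : (z.take i).length = i := by
      rw [List.length_take, hzl]; omega
    rw [htl]
    refine ⟨(hz.take i).congr fun a ha ha' => ?_,
      (hz.drop (i := i + w) (by omega)).move fun t ht => ?_⟩
    · rw [hm₄, if_neg (by omega)]
    · rw [List.length_drop, hzl] at ht
      rw [hm₄, if_pos (by omega)]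
      congr 1; omega

/-- Repair the word of length `r21` in the buffer, whose window at index `r23` has the least period
`r24`. -/
def repairProgram : Program := seqs [writeKernel, writeIndex, removeWindow]

theorem halts_repairProgram (C : CoreNums B q n p w N g) (R : CoreRegs q n p w N g s)
    (hy : Stands s.mem (4 * n) y) (hyN : y.length ≤ N + 1) (h21 : s.reg 21 = y.length)
    (hbad : IsFirstBad w p y (s.reg 23) (s.reg 24)) :
    Halts B repairProgram s fun t s' => t ≤ 18 * y.length + 25 ∧
      (∀ r < 25, s'.reg r = s.reg r) ∧ (∀ a < 4 * n, s'.mem a = s.mem a) ∧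
      Stands s'.mem (4 * n) (repair w p y) := by
  have b1 := hbad.le
  have b2 := hbad.lt
  have b3 := hbad.period.2.1
  have c5 := C.p_lt
  rw [repairProgram, halts_seqs_cons]
  refine (halts_writeKernel C R hy hyN rfl (by omega) hbad.lt h21 rfl rfl).mono ?_
  rintro t₁ s₁ ⟨ht₁, hr₁, hm₁, hst₁⟩
  rw [halts_seqs_cons]
  refine (halts_writeIndex (m := y.length) (i := s.reg 23) C (R.congr fun r hr => hr₁ r (by omega))
    hst₁ ?_ hyN (by omega) (by rw [hr₁ 21 (by omega), h21]) (hr₁ 23 (by omega))).mono ?_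
  · rw [List.length_append, List.length_append, hbad.kernel_length, List.length_cons,
      List.length_replicate]
    omega
  rintro t₂ s₂ ⟨ht₂, hr₂, hm₂, hst₂⟩
  have e : y ++ (window y (s.reg 23) (s.reg 24) ++ 1 ::
      List.replicate (p - s.reg 24 - 1) (0 : Fin q)) ++ digits q (w - p - 1) (s.reg 23) ++ [0] =
      y ++ repairBlock w p y (s.reg 23) (s.reg 24) := by
    simp only [repairBlock, List.append_assoc]
  rw [e] at hst₂
  rw [halts_seqs_singleton]
  refine (halts_removeWindow (m := y.length) (i := s.reg 23) C
    (R.congr fun r hr => by rw [hr₂ r (by omega), hr₁ r (by omega)]) hst₂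
    (by rw [List.length_append, hbad.repairBlock_length C.p_lt]) hyN b1
    (by rw [hr₂ 21 (by omega), hr₁ 21 (by omega), h21])
    (by rw [hr₂ 23 (by omega), hr₁ 23 (by omega)])).mono ?_
  rintro t₃ s₃ ⟨ht₃, hr₃, hm₃, hst₃⟩
  refine ⟨by omega, fun r hr => ?_, fun a ha => ?_, ?_⟩
  · rw [hr₃ r hr, hr₂ r hr, hr₁ r hr]
  · rw [hm₃ a ha, hm₂ a ha, hm₁ a ha]
  · rw [hbad.repair_eq]; exact hst₃

/-- Run the core encoder on the buffer. -/
def coreLoop : Program := seqs [.const 26 1,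
  .loop 26 (seqs [findBad, .ite 24 repairProgram .skip, .arith .add 26 24 14])]

/-- A bound for the number of steps of the core encoder in one of its states. -/
def stateCost (g w p : ℕ) (y : List (Fin q)) : ℕ :=
  26 * matchCost g w p (y.length + 1 - w) y + 41 * y.length + 4 * q ^ g + 37

/-- The search is the loop test: its period register is zero exactly when the state avoids small
periods. The round on state `τ` is charged to `stateCost` of that state, including the final,
successful test. -/
theorem halts_coreLoop (C : CoreNums B q n p w N g) (R : CoreRegs q n p w N g s)
    {x : List (Fin q)} (hx : Stands s.mem (4 * n) (x ++ [1])) (hxN : x.length ≤ N)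
    (h21 : s.reg 21 = x.length + 1) (h22 : s.reg 22 = x.length + 2 - w) :
    Halts B coreLoop s fun t s' =>
      t ≤ ∑ τ ∈ Finset.range (coreSteps w p x + 1), stateCost g w p (coreState w p x τ) + 2 ∧
      (∀ r < 23, s'.reg r = s.reg r) ∧ (∀ a < 4 * n, s'.mem a = s.mem a) ∧
      Stands s'.mem (4 * n) (coreEncode w p x) := by
  have c3 := C.big
  have hterm := coreTerminates (x := x) C.two_le C.p_lt (le_trans (by omega) C.digits_le)
  rw [coreLoop]
  simp [halts_seqs_cons, halts_seqs_singleton, halts_const]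
  refine ⟨by omega, (halts_loop (fun b s' =>
    (∀ r < 23, s'.reg r = s.reg r) ∧ (∀ a < 4 * n, s'.mem a = s.mem a) ∧
    ((s'.reg 26 = 0 ∧ 1 ≤ b ∧ Stands s'.mem (4 * n) (coreEncode w p x)) ∨
      ∃ τ ≤ coreSteps w p x, s'.reg 26 ≠ 0 ∧ Stands s'.mem (4 * n) (coreState w p x τ) ∧
        b = ∑ τ' ∈ Finset.Ico τ (coreSteps w p x + 1), stateCost g w p (coreState w p x τ') + 1))
    (fun s' => (∀ r < 23, s'.reg r = s.reg r) ∧ (∀ a < 4 * n, s'.mem a = s.mem a) ∧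
      Stands s'.mem (4 * n) (coreEncode w p x)) ?_ ?_
    (b := ∑ τ ∈ Finset.range (coreSteps w p x + 1), stateCost g w p (coreState w p x τ) + 1)
    ?_).mono ?_⟩
  · rintro b s' ⟨hr, hm, ⟨h0, hb, hs⟩ | ⟨τ, hτ, h0', -⟩⟩ h0
    · exact ⟨hb, hr, hm, hs⟩
    · exact absurd h0 h0'
  · rintro b s' ⟨hr, hm, ⟨h0, hb, hs⟩ | ⟨τ, hτ, -, hst, hb⟩⟩ h0'
    · exact absurd h0 h0'
    have hlen : (coreState w p x τ).length = x.length + 1 :=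
      coreState_length C.p_lt fun σ hσ => not_isLPA_of_lt_coreSteps (by omega)
    set y := coreState w p x τ with hy
    have R' : CoreRegs q n p w N g s' := R.congr fun r hr' => hr r (by omega)
    rw [Finset.sum_eq_sum_Ico_succ_bot (by omega), ← hy, stateCost] at hb
    rw [halts_seqs_cons]
    refine (halts_findBad (y := y) C R' hst (by omega) (by rw [hr 21 (by omega), h21, hlen])
      (by rw [hr 22 (by omega), h22, hlen])).mono ?_
    rintro t₁ s₁ ⟨ht₁, hr₁, hm₁, hf⟩
    have R₁ : CoreRegs q n p w N g s₁ := R'.congr fun r hr' => hr₁ r (by omega)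
    rw [halts_seqs_cons, halts_ite]
    rcases hf with ⟨h24, hlpa⟩ | ⟨h24, hbad⟩
    -- The first avoiding state is by definition the one at `coreSteps`.
    · have hT : τ = coreSteps w p x := le_antisymm hτ (Nat.sInf_le hlpa)
      refine ⟨fun h => absurd h24 h, fun _ => ?_⟩
      simp [halts_skip, halts_seqs_singleton, halts_arith, ArithOp.eval, h24, R₁.r14]
      refine ⟨by omega, 1, by omega, fun r hr' => ?_, fun a ha => ?_, le_rfl, ?_⟩
      · simp [show r ≠ 26 by omega, hr₁ r hr', hr r hr']
      · rw [hm₁ a (by omega), hm a ha]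
      · rw [coreEncode_eq, ← hT, ← hy]
        exact hst.congr fun a ha ha' => hm₁ a (by have := C.N_le; have := C.n_pos; omega)
    · have hT : τ < coreSteps w p x := by
        refine lt_of_le_of_ne hτ fun e => hbad.not_isLPA ?_
        rw [hy, e]
        exact isLPA_coreEncode hterm
      refine ⟨fun _ => ?_, fun h => absurd h h24⟩
      refine (halts_repairProgram (y := y) C R₁ (hst.congr fun a ha ha' =>
        hm₁ a (by have := C.N_le; have := C.n_pos; omega)) (by omega)
        (by rw [hr₁ 21 (by omega), hr 21 (by omega), h21, hlen]) hbad).mono ?_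
      rintro t₂ s₂ ⟨ht₂, hr₂, hm₂, hst₂⟩
      have := hbad.lt
      have := C.p_lt
      have := C.w_le
      have := C.N_le
      simp [halts_seqs_singleton, halts_arith, ArithOp.eval, hr₂ 24, hr₂ 14, R₁.r14]
      refine ⟨by omega, ∑ τ' ∈ Finset.Ico (τ + 1) (coreSteps w p x + 1),
        stateCost g w p (coreState w p x τ') + 1, by omega, fun r hr' => ?_, fun a ha => ?_,
        Or.inr ⟨τ + 1, by omega, h24, ?_, rfl⟩⟩
      · simp [show r ≠ 26 by omega, hr₂ r (by omega), hr₁ r hr', hr r hr']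
      · rw [hm₂ a ha, hm₁ a (by omega), hm a ha]
      · rw [coreState_succ]
        exact hst₂
  · refine ⟨fun r hr => ?_, fun a _ => rfl, Or.inr ⟨0, by omega, by simp, hx, ?_⟩⟩
    · simp [show r ≠ 26 by omega]
    · rw [Finset.range_eq_Ico]
  · rintro t s' ⟨ht, -, h⟩
    exact ⟨by omega, h⟩

end RepairProgram

end PeriodAvoiding

namespace PeriodAvoiding

/-! ### The encoder after the computation of the parameters -/

section EncodeSegments

variable {B q n ℓ p k N h g : ℕ} [NeZero q] {s : State} {x : List (Fin q)}

theorem SegmentSizes.N_pos (S : SegmentSizes q n ℓ p k N h) : 1 ≤ N := by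
  by_contra h0
  have := S.n_le
  have := S.n_pos
  obtain rfl : N = 0 := by omega
  omega

theorem SegmentSizes.k_le (S : SegmentSizes q n ℓ p k N h) : k ≤ n := by
  have := Nat.le_mul_of_pos_right (k - 1) S.N_pos
  have := S.lt_n
  omega

/-- Only the last segment is incomplete, so `k * N` exceeds `n` by less than `N ≤ n`. This turns
linear costs per segment into a cost linear in `n`. -/
theorem SegmentSizes.kN_le (S : SegmentSizes q n ℓ p k N h) : k * N < 2 * n := by
  have h1 := S.lt_n
  have h2 : N ≤ n := by
    rw [← S.seg_eq]
    have := S.k_pos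
    have := S.n_pos
    rw [Nat.div_le_iff_le_mul_add_pred (by omega)]
    have := Nat.le_mul_of_pos_left n (show 0 < k by omega)
    omega
  have h3 : k * N = (k - 1) * N + N := by
    rw [← Nat.succ_mul]; congr 1; have := S.k_pos; omega
  omega

/-- The registers that the loop over the segments uses. -/
structure SegRegs (q n p k N h g : ℕ) (s : State) : Prop extends CoreRegs q n p h N g s where
  r1 : s.reg 1 = n
  r5 : s.reg 5 = k
  r6 : s.reg 6 = N

theorem SegRegs.congr (R : SegRegs q n p k N h g s) {s' : State}
    (hr : ∀ r < 15, s'.reg r = s.reg r) : SegRegs q n p k N h g s' :=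
  ⟨R.toCoreRegs.congr hr, by rw [hr 1 (by omega), R.r1], by rw [hr 5 (by omega), R.r5],
    by rw [hr 6 (by omega), R.r6]⟩

/-- Encode the segment with the index `r20`. -/
def encodeSegment : Program := seqs [.arith .mul 31 20 6, .arith .sub 37 1 31, .arith .sub 38 6 37,
  .arith .sub 30 6 38, .arith .add 21 30 9, .arith .add 27 10 14, .arith .add 28 31 14, copyDown,
  .arith .add 37 10 21, .arith .sub 37 37 9, .store 37 9, .arith .add 22 21 9, .arith .sub 22 22 4,
  coreLoop,
  .arith .add 28 10 14, .arith .mul 27 20 6, .arith .add 27 27 20, .arith .add 30 21 14, copyDown]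

theorem halts_encodeSegment (S : SegmentSizes q n ℓ p k N h) (C : CoreNums B q n p h N g)
    (R : SegRegs q n p k N h g s) (hx : x.length = n) {j : ℕ} (hj : j < k)
    (hst : Stands s.mem (j * N) (window x (j * N) N)) (h20 : s.reg 20 = j) :
    Halts B encodeSegment s fun t s' =>
      t ≤ ∑ τ ∈ Finset.range (coreSteps h p (window x (j * N) N) + 1),
        stateCost g h p (coreState h p (window x (j * N) N) τ) + 12 * N + 26 ∧
      (∀ r < 21, s'.reg r = s.reg r) ∧
      (∀ a < 4 * n, a < j * (N + 1) ∨ j * (N + 1) + (window x (j * N) N).length + 1 ≤ a →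
        s'.mem a = s.mem a) ∧
      Stands s'.mem (j * (N + 1)) (coreEncode h p (window x (j * N) N)) := by
  have c1 := C.N_le
  have c2 := C.n_pos
  have c3 := C.big
  have hjN := S.mul_lt hj
  have hkn := S.k_le
  have hl : (window x (j * N) N).length = min N (n - j * N) := by rw [segment_length, hx]
  have hmul : j * (N + 1) = j * N + j := by ring
  generalize window x (j * N) N = v at hst hl ⊢
  generalize hT : ∑ τ ∈ Finset.range (coreSteps h p v + 1), stateCost g h p (coreState h p v τ) = T
  generalize hL : v.length = L at hl ⊢
  rw [encodeSegment]
  simp [halts_seqs_cons, halts_arith, ArithOp.eval, R.r10, R.r1, R.r6, R.r9, R.r14, h20]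
  -- The minimum of `N` and `n - j * N`, obtained by truncated subtraction.
  rw [show N - (N - (n - j * N)) = L by omega]
  refine ⟨by omega, by omega, by omega, by omega, by omega, by omega, by omega,
    (halts_copyDown (dst := 4 * n) (src := j * N) (len := L) (by omega) (by omega)
      (by omega) (by omega) ?_ ?_ ?_ ?_).mono ?_⟩
  · simp [R.r9]
  · simp
  · simp
  · simp
  rintro t₁ s₁ ⟨ht₁, hr₁, hm₁⟩
  simp only [State.setReg_mem] at hm₁
  have f₁ : ∀ r < 21, s₁.reg r = s.reg r := fun r hr => by
    simp [hr₁ r (by omega), show r ≠ 30 by omega, show r ≠ 31 by omega, show r ≠ 27 by omega,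
      show r ≠ 28 by omega, show r ≠ 37 by omega, show r ≠ 38 by omega, show r ≠ 21 by omega]
  have g₁ : s₁.reg 21 = L + 1 := by simp [hr₁ 21]
  simp [halts_store, g₁, f₁ 10, f₁ 9, f₁ 4, R.r10, R.r9, R.r4]
  refine ⟨by omega, by omega, by omega, by omega,
    (halts_coreLoop (x := v) C (R.toCoreRegs.congr fun r hr => ?_) ?_ (by omega) ?_ ?_).mono ?_⟩
  · simp [show r ≠ 22 by omega, show r ≠ 37 by omega, f₁ r (by omega)]
  · rw [stands_append]
    refine ⟨hst.move fun t ht => ?_, stands_singleton ?_⟩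
    · simp only [State.setMem_mem, State.setReg_mem]
      rw [if_neg (by omega), hm₁, if_pos (by omega)]
      congr 1; omega
    · simp only [State.setMem_mem, State.setReg_mem]
      rw [if_pos (by omega), Fin.val_one', Nat.mod_eq_of_lt (by have := C.two_le; omega)]
  · simp [g₁, hL]
  · simp [hL]
  rintro t₂ s₂ ⟨ht₂, hr₂, hm₂, hst₂⟩
  rw [hT] at ht₂
  clear hT
  have f₂ : ∀ r < 21, s₂.reg r = s.reg r := fun r hr => by
    simp [hr₂ r (by omega), show r ≠ 22 by omega, show r ≠ 37 by omega, f₁ r hr]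
  have g₂ : s₂.reg 21 = L + 1 := by simp [hr₂ 21, g₁]
  simp [halts_seqs_singleton, g₂, f₂ 10, f₂ 14, f₂ 6, f₂ 20, R.r10, R.r14, R.r6, h20]
  refine ⟨by omega, by omega, by omega, by omega,
    (halts_copyDown (dst := j * N + j) (src := 4 * n) (len := L + 1) (by omega) (by omega)
      (by omega) (by omega) ?_ ?_ ?_ ?_).mono ?_⟩
  · simp [f₂ 9, R.r9]
  · simp
  · simp
  · simp
  rintro t₃ s₃ ⟨ht₃, hr₃, hm₃⟩
  simp only [State.setReg_mem] at hm₃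
  refine ⟨?_, fun r hr => ?_, fun a ha ha' => ?_, ?_⟩
  · have hLN : L ≤ N := by omega
    simp only [← Nat.add_assoc]
    omega
  · simp [hr₃ r (by omega), show r ≠ 30 by omega, show r ≠ 27 by omega, show r ≠ 28 by omega,
      f₂ r hr]
  · rw [hm₃, if_neg (by omega), hm₂ a (by omega)]
    simp only [State.setMem_mem, State.setReg_mem]
    rw [if_neg (by omega), hm₁, if_neg (by omega)]
  · refine hst₂.move fun t ht => ?_
    rw [coreEncode_length C.p_lt] at ht
    rw [hm₃, if_pos (by omega)]
    congr 1; omega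

/-- Encode all segments, from the last one to the first one. -/
def encodeSegments : Program := seqs [.arith .add 20 5 14, downLoop 20 encodeSegment,
  .arith .add 0 1 5]

/-- Codeword `j` starts at `j * (N + 1)`, at or behind the end `j * N` of the unread segments. Hence
working from the last segment to the first overwrites no input that is still needed. -/
theorem halts_encodeSegments (S : SegmentSizes q n ℓ p k N h) (C : CoreNums B q n p h N g)
    (R : SegRegs q n p k N h g s) (hx : x.length = n) (hst : Stands s.mem 0 x) :
    Halts B encodeSegments s fun t s' =>
      t ≤ ∑ j ∈ Finset.range k, (∑ τ ∈ Finset.range (coreSteps h p (window x (j * N) N) + 1),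
        stateCost g h p (coreState h p (window x (j * N) N) τ) + 12 * N + 28) + 3 ∧
      s'.Holds (encode ℓ p k x) := by
  have c1 := C.N_le
  have c2 := C.n_pos
  have c3 := C.big
  have hkn := S.k_le
  have hk2 := S.kN_le
  rw [encodeSegments]
  simp [halts_seqs_cons, halts_arith, ArithOp.eval, R.r5, R.r14]
  refine ⟨by omega, (halts_downLoop (len := k) (fun j s' => (∀ r < 20, s'.reg r = s.reg r) ∧
    (∀ a < j * N, a < n → s'.mem a = s.mem a) ∧
    Stands s'.mem (j * (N + 1)) (((segments k x).drop j).flatMap (coreEncode h p)))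
    (fun j => ∑ τ ∈ Finset.range (coreSteps h p (window x (j * N) N) + 1),
        stateCost g h p (coreState h p (window x (j * N) N) τ) + 12 * N + 26)
    (by omega) ?_ ?_ ?_ ?_).mono ?_⟩
  · rintro j s' ⟨hr, -⟩
    rw [hr 9 (by omega), R.r9]
  · rintro j hj s' h20 ⟨hr, hm, hs⟩
    have hjN := S.mul_lt hj
    have hjk : (j + 1) * N ≤ k * N := Nat.mul_le_mul_right N hj
    have e1 : (j + 1) * N = j * N + N := by ring
    have e2 : (j + 1) * (N + 1) = j * N + N + j + 1 := by ring
    have e3 : j * (N + 1) = j * N + j := by ring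
    have hl : (window x (j * N) N).length = min N (n - j * N) := by rw [segment_length, hx]
    refine (halts_encodeSegment S C (R.congr fun r hr' => ?_) hx hj ?_ ?_).mono ?_
    · simp [show r ≠ 20 by omega, hr r (by omega)]
    · have := stands_window hst (j * N) N
      rw [Nat.zero_add] at this
      exact this.congr fun a _ ha => hm a (by omega) (by omega)
    · simp
    rintro t s'' ⟨ht, hr'', hm'', hst''⟩
    refine ⟨ht, ?_, fun r hr' => ?_, fun a ha ha' => ?_, ?_⟩
    · rw [hr'' 20 (by omega)]; simp
    · simp [hr'' r (by omega), show r ≠ 20 by omega, hr r hr']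
    · rw [hm'' a (by omega) (by omega)]
      exact hm a (by omega) ha'
    · rw [S.segments_drop hx hj, List.flatMap_cons, stands_append]
      refine ⟨hst'', ?_⟩
      rw [coreEncode_length S.p_lt]
      -- A segment that is not the last is full, so its codeword ends where the next one starts;
      -- behind the last there is nothing.
      by_cases hlast : j + 1 < k
      · have hle := S.succ_mul_le hlast
        have hend : (j + 1) * (N + 1) +
            (((segments k x).drop (j + 1)).flatMap (coreEncode h p)).length = n + k := by
          have h1 := S.encode_length hx
          rw [S.encode_split hx hlast, ← List.flatMap_cons, ← S.segments_drop hx hlast,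
            List.length_append, S.encode_take hx hlast] at h1
          exact h1
        rw [show j * (N + 1) + ((window x (j * N) N).length + 1) = (j + 1) * (N + 1) by omega]
        exact hs.congr fun a ha ha' => hm'' a (by omega) (by omega)
      · rw [List.drop_of_length_le (by rw [segments_length]; omega)]
        exact stands_nil
  · simp
  · refine ⟨fun r hr => ?_, fun a _ _ => rfl, ?_⟩
    · simp [show r ≠ 20 by omega]
    · rw [List.drop_of_length_le (by rw [segments_length])]
      exact stands_nil
  · rintro t₁ s₁ ⟨ht₁, -, hr₁, -, hst₁⟩
    simp [halts_seqs_singleton, halts_arith, ArithOp.eval, hr₁ 1, hr₁ 5, R.r1, R.r5]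
    simp only [Nat.add_assoc, Nat.reduceAdd] at ht₁ ⊢
    refine ⟨by omega, by omega, ?_, fun i hi => ?_⟩
    · simp [S.encode_length hx]
    · rw [Nat.zero_mul, List.drop_zero, ← S.encode_eq] at hst₁
      have := hst₁ i hi
      rw [Nat.zero_add] at this
      simpa using this

end EncodeSegments

end PeriodAvoiding

namespace PeriodAvoiding

/-! ### The decoder -/

section Unrepair

variable {B q n p w N g : ℕ} [NeZero q] {s : State} {y : List (Fin q)}

theorem value_append_ge (l l' : List (Fin q)) : value l ≤ value (l ++ l') := by
  induction l' using List.reverseRecOn with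
  | nil => simp
  | append_singleton l' b ih =>
    rw [← List.append_assoc, value_append_singleton]
    have := Nat.le_mul_of_pos_right (value (l ++ l')) (Nat.pos_of_ne_zero (NeZero.ne q))
    omega

/-- The intermediate results of Horner's scheme are values of prefixes, so none of them overflows if
the final value fits into a word. -/
theorem value_take_le (l : List (Fin q)) (t : ℕ) : value (l.take t) ≤ value l := by
  conv_rhs => rw [← List.take_append_drop t l]
  exact value_append_ge _ _

/-- Compute the number that the `r30` symbols from the cell `r27` on represent in base `r0`. -/
def readDigits : Program := seqs [.const 23 0, downLoop 30 (seqs [.load 37 27,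
  .arith .mul 23 23 0, .arith .add 23 23 37, .arith .add 27 27 9])]

theorem halts_readDigits {l : List (Fin q)} {src : ℕ} (hl : Stands s.mem src l)
    (hv : value l < B) (hsrc : src + l.length < B) (h0 : s.reg 0 = q) (h9 : s.reg 9 = 1)
    (h27 : s.reg 27 = src) (h30 : s.reg 30 = l.length) :
    Halts B readDigits s fun t s' => t ≤ 6 * l.length + 2 ∧
      (∀ r < 27, r ≠ 23 → s'.reg r = s.reg r) ∧ s'.mem = s.mem ∧ s'.reg 23 = value l := by
  rw [readDigits]
  simp [halts_seqs_cons, halts_seqs_singleton, halts_const]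
  refine ⟨by omega, (halts_downLoop_const (len := l.length) (fun j s' =>
    (∀ r < 27, r ≠ 23 → s'.reg r = s.reg r) ∧ s'.mem = s.mem ∧
    s'.reg 27 = src + (l.length - j) ∧ s'.reg 23 = value (l.take (l.length - j)))
    4 (by omega) (fun j s' h => by rw [h.1 9 (by omega) (by omega), h9]) ?_ ?_ ?_).mono ?_⟩
  · rintro j hj s' h30' ⟨hr, hm, h27', h23⟩
    have hlt : l.length - (j + 1) < l.length := by omega
    have e1 : value (l.take (l.length - j)) =
        value (l.take (l.length - (j + 1))) * q + l[l.length - (j + 1)] := by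
      rw [← value_append_singleton, show l.length - j = l.length - (j + 1) + 1 by omega,
        List.take_add_one, List.getElem?_eq_getElem hlt, Option.toList_some]
    have e2 := value_take_le l (l.length - j)
    simp [halts_seqs_cons, halts_seqs_singleton, halts_arith, halts_load, ArithOp.eval, h27', h23,
      hm, hl _ hlt, hr, h9, h0]
    refine ⟨by omega, by omega, by omega, by omega, fun r hr' hr'' => ?_, by omega, e1.symm⟩
    simp [hr'', show r ≠ 27 by omega, show r ≠ 30 by omega, show r ≠ 37 by omega, hr r hr']
  · simp [h30]
  · refine ⟨fun r hr hr' => by simp [hr'], by simp, by simp [h27], by simp [value]⟩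
  · rintro t s' ⟨ht, -, hr, hm, -, h23⟩
    refine ⟨by omega, hr, hm, ?_⟩
    simpa using h23

/-- Starting at the symbol `r3 - 1` of the block at `r25`, look for the last symbol that is not
zero; `r24` becomes its index. -/
def lastNonzero : Program := seqs [.arith .sub 24 3 9, .arith .add 37 25 24, .load 37 37,
  .arith .sub 38 9 37,
  .loop 38 (seqs [.arith .sub 24 24 9, .arith .add 37 25 24, .load 37 37, .arith .sub 38 9 37])]

/-- The first `p` symbols of a block are the kernel, the marker and only zeros. So the first nonzero
symbol from the right is the marker, whatever the kernel contains. -/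
theorem halts_lastNonzero {E p' : ℕ} (hp : p' < p) (hE : E + p < B)
    (hone : s.mem (E + p') ≠ 0) (hzero : ∀ t, p' < t → t < p → s.mem (E + t) = 0)
    (h3 : s.reg 3 = p) (h9 : s.reg 9 = 1) (h25 : s.reg 25 = E) :
    Halts B lastNonzero s fun t s' => t ≤ 5 * p + 5 ∧
      (∀ r < 30, r ≠ 24 → s'.reg r = s.reg r) ∧ s'.mem = s.mem ∧ s'.reg 24 = p' := by
  rw [lastNonzero]
  simp [halts_seqs_cons, halts_arith, halts_load, ArithOp.eval, h3, h9, h25]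
  refine ⟨by omega, by omega, by omega, (halts_loop (fun b s' =>
    (∀ r < 30, r ≠ 24 → s'.reg r = s.reg r) ∧ s'.mem = s.mem ∧ p' ≤ s'.reg 24 ∧ s'.reg 24 < p ∧
      s'.reg 38 = 1 - s.mem (E + s'.reg 24) ∧ b = 5 * (s'.reg 24 - p') + 1)
    (fun s' => (∀ r < 30, r ≠ 24 → s'.reg r = s.reg r) ∧ s'.mem = s.mem ∧ s'.reg 24 = p')
    ?_ ?_ (b := 5 * (p - 1 - p') + 1) ?_).mono ?_⟩
  · rintro b s' ⟨hr, hm, hle, hlt, h38, hb⟩ h0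
    refine ⟨by omega, hr, hm, ?_⟩
    by_contra hne
    have := hzero (s'.reg 24) (by omega) hlt
    omega
  · rintro b s' ⟨hr, hm, hle, hlt, h38, hb⟩ h0
    have hne : s'.reg 24 ≠ p' := by
      intro e
      rw [e] at h38
      omega
    simp [halts_seqs_cons, halts_seqs_singleton, halts_arith, halts_load, ArithOp.eval, hr, hm, h9,
      h25]
    refine ⟨by omega, by omega, by omega, by omega, fun r hr' hr'' => ?_, by omega, by omega⟩
    simp [hr'', show r ≠ 37 by omega, show r ≠ 38 by omega, hr r hr' hr'']
  · refine ⟨fun r hr hr' => ?_, by simp, ?_, ?_, ?_, ?_⟩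
    · simp [hr', show r ≠ 37 by omega, show r ≠ 38 by omega]
    · simp; omega
    · simp; omega
    · simp
    · simp
  · rintro t s' ⟨ht, -, h⟩
    exact ⟨by omega, h⟩

/-- Store the word of length `r30` with period `r24` that continues the one at `r25` at `r27`. -/
def writePeriodic : Program := downLoop 30 (seqs [.arith .mod 37 30 24, .arith .add 37 25 37,
  .load 37 37, .arith .add 38 27 30, .store 38 37])

theorem halts_writePeriodic {src dst p' len : ℕ} (hp : 1 ≤ p') (hlen : len < B)
    (hdst : dst + len ≤ src) (hsrc : src + p' ≤ B) (h9 : s.reg 9 = 1) (h24 : s.reg 24 = p')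
    (h25 : s.reg 25 = src) (h27 : s.reg 27 = dst) (h30 : s.reg 30 = len) :
    Halts B writePeriodic s fun t s' => t ≤ 7 * len + 1 ∧ (∀ r < 30, s'.reg r = s.reg r) ∧
      ∀ a, s'.mem a = if dst ≤ a ∧ a < dst + len then s.mem (src + (a - dst) % p')
        else s.mem a := by
  refine (halts_downLoop_const (fun j s' => (∀ r < 30, s'.reg r = s.reg r) ∧
    ∀ a, s'.mem a = if dst + j ≤ a ∧ a < dst + len then s.mem (src + (a - dst) % p') else s.mem a)
    5 hlen (fun j s' h => by rw [h.1 9 (by omega), h9]) ?_ h30 ⟨fun _ _ => rfl, fun a => ?_⟩).mono ?_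
  · rintro j hj s' hj' ⟨hr, hm⟩
    have hmod := Nat.mod_lt j hp
    simp [halts_seqs_cons, halts_seqs_singleton, halts_arith, halts_load, halts_store,
      ArithOp.eval, hr, h27, h25, h24]
    refine ⟨by omega, by omega, by omega, fun r hr' => ?_, fun a => ?_⟩
    · simp [hr r hr', show r ≠ 30 by omega, show r ≠ 37 by omega, show r ≠ 38 by omega]
    · by_cases ha : a = dst + j
      · rw [if_pos ha, if_pos (by omega), hm, if_neg (by omega), ha, Nat.add_sub_cancel_left]
      · rw [if_neg ha, hm]
        split_ifs <;> first | rfl | (exfalso; omega)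
  · rw [if_neg (by omega)]
  · rintro t s' ⟨ht, -, hr, hm⟩
    exact ⟨ht, hr, hm⟩

/-- Read the period `r24` and the index `r23` from the end of the word of length `r21` in the
buffer. -/
def readBlock : Program := seqs [.arith .add 25 10 21, .arith .sub 25 25 4, lastNonzero,
  .arith .add 27 25 3, .arith .sub 30 4 3, .arith .sub 30 30 9, readDigits]

/-- Kernel, marker and padding always take `p` symbols together, so the index stands at a place that
does not depend on the unknown period. -/
theorem halts_readBlock (C : CoreNums B q n p w N g) (R : CoreRegs q n p w N g s) {i p' : ℕ}
    (hbad : IsFirstBad w p y i p') (hyN : y.length ≤ N + 1) (h21 : s.reg 21 = y.length)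
    (hz : Stands s.mem (4 * n) (repair w p y)) :
    Halts B readBlock s fun t s' => t ≤ 11 * w + 15 ∧
      (∀ r < 23, s'.reg r = s.reg r) ∧ s'.mem = s.mem ∧ s'.reg 23 = i ∧ s'.reg 24 = p' := by
  have c1 := C.N_le
  have c2 := C.n_pos
  have c3 := C.big
  have c5 := C.p_lt
  have c6 := C.w_le
  have c7 := C.two_le
  have b1 := hbad.le
  have b2 := hbad.lt
  have hkl := hbad.kernel_length
  rw [hbad.repair_eq', stands_append] at hz
  have hz1 := hz.2
  have hl : (y.take i ++ y.drop (i + w)).length = y.length - w := by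
    rw [List.length_append, List.length_take, List.length_drop]; omega
  rw [hl, repairBlock, stands_append, stands_append, stands_append, hkl, ← List.singleton_append,
    stands_append, List.length_append, hkl, List.length_append, List.length_singleton,
    List.length_replicate] at hz1
  obtain ⟨⟨⟨-, h1, h2⟩, h3⟩, -⟩ := hz1
  rw [show 4 * n + (y.length - w) = 4 * n + y.length - w by omega] at h1 h2 h3
  generalize hm : y.length = m at *
  have hone : s.mem (4 * n + m - w + p') = 1 := by
    have := h1 0 (by simp)
    rw [List.getElem_singleton, Fin.val_one', Nat.mod_eq_of_lt (by omega)] at this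
    exact this
  have hzero : ∀ t, p' < t → t < p → s.mem (4 * n + m - w + t) = 0 := by
    intro t ht ht'
    have := h2 (t - p' - 1) (by simp; omega)
    rw [List.getElem_replicate, Fin.val_zero,
      show 4 * n + m - w + p' + 1 + (t - p' - 1) = 4 * n + m - w + t by omega] at this
    exact this
  have hval : value (digits q (w - p - 1) i) = i :=
    value_digits _ _ (lt_of_lt_of_le (by omega) C.digits_le)
  rw [readBlock]
  simp [halts_seqs_cons, halts_arith, ArithOp.eval, R.r10, R.r4, h21]
  refine ⟨by omega, by omega, (halts_lastNonzero (E := 4 * n + m - w) hbad.lt (by omega) ?_ ?_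
    ?_ ?_ ?_).mono ?_⟩
  · simp [hone]
  · simpa using hzero
  · simp [R.r3]
  · simp [R.r9]
  · simp
  rintro t₁ s₁ ⟨ht₁, hr₁, hm₁, h24⟩
  simp only [State.setReg_mem] at hm₁
  have f₁ : ∀ r < 23, s₁.reg r = s.reg r := fun r hr => by
    simp [hr₁ r (by omega), show r ≠ 24 by omega, show r ≠ 25 by omega]
  have g₁ : s₁.reg 25 = 4 * n + m - w := by simp [hr₁ 25]
  simp [halts_seqs_singleton, f₁ 3, f₁ 4, f₁ 9, R.r3, R.r4, R.r9, g₁]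
  refine ⟨by omega, by omega, by omega, (halts_readDigits (q := q) (l := digits q (w - p - 1) i)
    (src := 4 * n + m - w + p) ?_ (by omega) (by rw [digits_length]; omega) ?_ ?_ ?_ ?_).mono ?_⟩
  · simp only [State.setReg_mem, hm₁]
    rw [show 4 * n + m - w + p = 4 * n + m - w + (p' + (1 + (p - p' - 1))) by omega]
    exact h3
  · simp [f₁ 0, R.r0]
  · simp [f₁ 9, R.r9]
  · simp
  · simp [digits_length]
  rintro t₂ s₂ ⟨ht₂, hr₂, hm₂, h23⟩
  rw [digits_length] at ht₂
  simp only [State.setReg_mem] at hm₂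
  simp only [← Nat.add_assoc]
  refine ⟨by omega, fun r hr => ?_, by rw [hm₂, hm₁], by rw [h23, hval], ?_⟩
  · simp [hr₂ r (by omega) (by omega), show r ≠ 30 by omega, show r ≠ 27 by omega, f₁ r hr]
  · simp [hr₂ 24, h24]

/-- Insert the window with the period `r24` at the index `r23` into the word of length `r21` in the
buffer. -/
def insertWindow : Program := seqs [.arith .add 28 10 23, .arith .add 27 28 4, .arith .sub 30 21 23,
  copyDown, .arith .add 25 10 21, .arith .add 27 10 23, .arith .add 30 4 14, writePeriodic]

/-- Shifting everything from index `i` on by `w` restores the tail and pushes the block right behind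
the word. Its kernel is then at `4 * n + m`, the source from which the window is filled
periodically. -/
theorem halts_insertWindow (C : CoreNums B q n p w N g) (R : CoreRegs q n p w N g s) {i p' : ℕ}
    (hbad : IsFirstBad w p y i p') (hyN : y.length ≤ N + 1) (h21 : s.reg 21 = y.length)
    (h23 : s.reg 23 = i) (h24 : s.reg 24 = p') (hz : Stands s.mem (4 * n) (repair w p y)) :
    Halts B insertWindow s fun t s' => t ≤ 13 * y.length + 8 ∧
      (∀ r < 23, s'.reg r = s.reg r) ∧ (∀ a < 4 * n, s'.mem a = s.mem a) ∧
      Stands s'.mem (4 * n) y := by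
  have c1 := C.N_le
  have c2 := C.n_pos
  have c3 := C.big
  have c5 := C.p_lt
  have c6 := C.w_le
  have b1 := hbad.le
  have b2 := hbad.lt
  have b3 := hbad.period.1
  have hkl := hbad.kernel_length
  rw [hbad.repair_eq', List.append_assoc, stands_append, stands_append] at hz
  obtain ⟨h1, h2, h3⟩ := hz
  rw [repairBlock, List.append_assoc, List.append_assoc, stands_append] at h3
  replace h3 := h3.1
  have hl1 : (y.take i).length = i := by rw [List.length_take]; omega
  have hl2 : (y.drop (i + w)).length = y.length - (i + w) := List.length_drop
  rw [hl1] at h2 h3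
  rw [hl2] at h3
  generalize hm : y.length = m at *
  rw [insertWindow]
  simp [halts_seqs_cons, halts_arith, ArithOp.eval, R.r10, R.r4, h21, h23]
  refine ⟨by omega, by omega, by omega, (halts_copyDown (dst := 4 * n + i + w) (src := 4 * n + i)
    (len := m - i) (by omega) (by omega) (by omega) (by omega) ?_ ?_ ?_ ?_).mono ?_⟩
  · simp [R.r9]
  · simp
  · simp
  · simp
  rintro t₁ s₁ ⟨ht₁, hr₁, hm₁⟩
  simp only [State.setReg_mem] at hm₁
  have f₁ : ∀ r < 25, s₁.reg r = s.reg r := fun r hr => by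
    simp [hr₁ r (by omega), show r ≠ 30 by omega, show r ≠ 27 by omega, show r ≠ 28 by omega]
  simp [halts_seqs_singleton, f₁ 10, f₁ 21, f₁ 23, f₁ 4, f₁ 14, R.r10, R.r4, R.r14, h21, h23]
  refine ⟨by omega, by omega, by omega, (halts_writePeriodic (dst := 4 * n + i) (src := 4 * n + m)
    (len := w) b3 (by omega) (by omega) (by omega) ?_ ?_ ?_ ?_ ?_).mono ?_⟩
  · simp [f₁ 9, R.r9]
  · simp [f₁ 24, h24]
  · simp
  · simp
  · simp
  rintro t₂ s₂ ⟨ht₂, hr₂, hm₂⟩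
  simp only [State.setReg_mem] at hm₂
  simp only [← Nat.add_assoc]
  refine ⟨by omega, fun r hr => ?_, fun a ha => ?_, fun t ht => ?_⟩
  · simp [hr₂ r (by omega), show r ≠ 25 by omega, show r ≠ 27 by omega, show r ≠ 30 by omega,
      f₁ r (by omega)]
  · rw [hm₂, if_neg (by omega), hm₁, if_neg (by omega)]
  · rw [hm] at ht
    by_cases hti : t < i
    · rw [hm₂, if_neg (by omega), hm₁, if_neg (by omega), h1 t (by omega), List.getElem_take]
    by_cases htw : t < i + w
    · have hlt : (t - i) % p' < p' := Nat.mod_lt _ b3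
      have hlt' : (4 * n + t - (4 * n + i)) % p' < p' := Nat.mod_lt _ b3
      rw [hm₂, if_pos (by omega), hm₁, if_pos (by omega),
        show 4 * n + i + (4 * n + m + (4 * n + t - (4 * n + i)) % p' - (4 * n + i + w)) =
          4 * n + i + (m - (i + w)) + (t - i) % p' by
          rw [show 4 * n + t - (4 * n + i) = t - i by omega]; omega,
        h3 _ (by omega)]
      have e := hbad.period.getElem?_mod (t - i) (by omega)
      rw [show i + (t - i) = t by omega, List.getElem?_eq_getElem (by omega),
        List.getElem?_eq_getElem (by omega), Option.some_inj] at e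
      rw [e]
      simp [window]
    · rw [hm₂, if_neg (by omega), hm₁, if_pos (by omega),
        show 4 * n + i + (4 * n + t - (4 * n + i + w)) = 4 * n + i + (t - (i + w)) by omega,
        h2 _ (by omega)]
      simp [show i + w + (t - (i + w)) = t by omega]

/-- Undo repair steps on the word of length `r21` in the buffer as long as it ends in zero. -/
def decodeLoop : Program := seqs [.arith .add 37 10 21, .arith .sub 37 37 9, .load 37 37,
  .arith .sub 26 9 37,
  .loop 26 (seqs [readBlock, insertWindow, .arith .add 37 10 21, .arith .sub 37 37 9, .load 37 37,
    .arith .sub 26 9 37])]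

theorem stands_getLast {mem : ℕ → ℕ} {b m : ℕ} {a : Fin q} (h : Stands mem b y)
    (hy : y.getLast? = some a) (hm : y.length = m) : mem (b + (m - 1)) = a := by
  rw [List.getLast?_eq_getElem?, hm] at hy
  obtain ⟨hlt, e⟩ := List.getElem?_eq_some_iff.1 hy
  rw [h _ hlt, e]

/-- The decoder walks through the states of the encoder backwards, so the number of rounds is
exactly `coreSteps`, and no search is needed. -/
theorem halts_decodeLoop (C : CoreNums B q n p w N g) (R : CoreRegs q n p w N g s)
    {x : List (Fin q)} (hx : Stands s.mem (4 * n) (coreEncode w p x)) (hxN : x.length ≤ N)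
    (h21 : s.reg 21 = x.length + 1) :
    Halts B decodeLoop s fun t s' =>
      t ≤ (24 * x.length + 60) * coreSteps w p x + 5 ∧
      (∀ r < 23, s'.reg r = s.reg r) ∧ (∀ a < 4 * n, s'.mem a = s.mem a) ∧
      Stands s'.mem (4 * n) (x ++ [1]) := by
  have c1 := C.N_le
  have c2 := C.n_pos
  have c3 := C.big
  have c7 := C.two_le
  have hlen : ∀ τ ≤ coreSteps w p x, (coreState w p x τ).length = x.length + 1 := fun τ hτ =>
    coreState_length C.p_lt fun σ hσ => not_isLPA_of_lt_coreSteps (by omega)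
  -- The start word ends in one and all later states end in zero, so one minus the last symbol is
  -- the loop flag.
  have hlast : ∀ τ ≤ coreSteps w p x, ∀ mem : ℕ → ℕ, Stands mem (4 * n) (coreState w p x τ) →
      (1 - mem (4 * n + x.length) = 0 ↔ τ = 0) := by
    intro τ hτ mem hst
    cases τ with
    | zero =>
      have := stands_getLast hst (a := 1) (by simp [coreState_zero]) (hlen 0 hτ)
      rw [Nat.add_sub_cancel, Fin.val_one', Nat.mod_eq_of_lt (by omega)] at this
      simp [this]
    | succ τ =>
      have := stands_getLast hst (by
        rw [coreState_succ, repair_getLast? (not_isLPA_of_lt_coreSteps (by omega))])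
        (hlen _ hτ)
      rw [Nat.add_sub_cancel, Fin.val_zero] at this
      simp [this]
  rw [decodeLoop]
  simp [halts_seqs_cons, halts_seqs_singleton, halts_arith, halts_load, ArithOp.eval, h21, R.r10,
    R.r9]
  refine ⟨by omega, by omega, by omega, (halts_loop (fun b s' =>
    (∀ r < 23, s'.reg r = s.reg r) ∧ (∀ a < 4 * n, s'.mem a = s.mem a) ∧
    ∃ τ ≤ coreSteps w p x, (s'.reg 26 = 0 ↔ τ = 0) ∧ Stands s'.mem (4 * n) (coreState w p x τ) ∧
      b = (24 * x.length + 60) * τ + 1)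
    (fun s' => (∀ r < 23, s'.reg r = s.reg r) ∧ (∀ a < 4 * n, s'.mem a = s.mem a) ∧
      Stands s'.mem (4 * n) (x ++ [1])) ?_ ?_ (b := (24 * x.length + 60) * coreSteps w p x + 1)
    ?_).mono ?_⟩
  · rintro b s' ⟨hr, hm, τ, hτ, h26, hst, hb⟩ h0
    obtain rfl := h26.1 h0
    exact ⟨by omega, hr, hm, hst⟩
  · rintro b s' ⟨hr, hm, τ, hτ, h26, hst, hb⟩ h0
    obtain ⟨τ, rfl⟩ := Nat.exists_eq_add_of_le' (Nat.pos_of_ne_zero fun h => h0 (h26.2 h))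
    have R' : CoreRegs q n p w N g s' := R.congr fun r hr' => hr r (by omega)
    obtain ⟨i, p', hbad⟩ := exists_isFirstBad
      (not_isLPA_of_lt_coreSteps (x := x) (w := w) (p := p) (s := τ) (by omega))
    have hl := hlen τ (by omega)
    have b1 := hbad.le
    rw [coreState_succ] at hst
    have h21' : s'.reg 21 = (coreState w p x τ).length := by rw [hr 21 (by omega), h21, hl]
    rw [halts_seqs_cons]
    refine (halts_readBlock C R' hbad (by omega) h21' hst).mono ?_
    rintro t₁ s₁ ⟨ht₁, hr₁, hm₁, h23, h24⟩
    rw [halts_seqs_cons]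
    refine (halts_insertWindow C (R'.congr fun r hr' => hr₁ r (by omega)) hbad (by omega)
      (by rw [hr₁ 21 (by omega), h21']) h23 h24 (by rwa [hm₁])).mono ?_
    rintro t₂ s₂ ⟨ht₂, hr₂, hm₂, hst₂⟩
    have f₂ : ∀ r < 23, s₂.reg r = s.reg r := fun r hr' => by
      rw [hr₂ r hr', hr₁ r hr', hr r hr']
    simp [halts_seqs_cons, halts_seqs_singleton, halts_arith, halts_load, ArithOp.eval, f₂ 21,
      f₂ 10, f₂ 9, h21, R.r10, R.r9]
    rw [hl] at ht₂ b1
    rw [hb, Nat.mul_succ]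
    simp only [← Nat.add_assoc]
    refine ⟨by omega, by omega, by omega, τ, ?_, fun r hr' => ?_, fun a ha => ?_,
      by omega, ?_, hst₂⟩
    · generalize (24 * x.length + 60) * τ = Z
      omega
    · simp [show r ≠ 26 by omega, show r ≠ 37 by omega, f₂ r hr']
    · rw [hm₂ a ha, hm₁, hm a ha]
    · exact hlast τ (by omega) _ hst₂
  · refine ⟨fun r hr => ?_, fun a _ => rfl, coreSteps w p x, le_rfl, ?_, hx, rfl⟩
    · simp [show r ≠ 26 by omega, show r ≠ 37 by omega]
    · simpa using hlast _ le_rfl _ hx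
  · rintro t s' ⟨ht, -, h⟩
    exact ⟨by omega, h⟩

end Unrepair

end PeriodAvoiding

namespace PeriodAvoiding

/-! ### Decoding the whole codeword -/

section DecodeSegments

variable {B q n ℓ p k N h g : ℕ} [NeZero q] {s : State} {x : List (Fin q)}

/-- Decode the segment with the index `r5 - r19 - 1`. -/
def decodeSegment : Program := seqs [.arith .sub 20 5 19, .arith .sub 20 20 9,
  .arith .mul 31 20 6, .arith .sub 37 1 31, .arith .sub 38 6 37,
  .arith .sub 30 6 38, .arith .add 21 30 9, .arith .add 27 10 14, .arith .add 28 31 20,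
  .arith .add 30 21 14, copyDown, decodeLoop,
  .arith .add 28 10 14, .arith .mul 27 20 6, .arith .sub 30 21 9, copyDown]

theorem halts_decodeSegment (S : SegmentSizes q n ℓ p k N h) (C : CoreNums B q n p h N g)
    (R : SegRegs q n p k N h g s) (hx : x.length = n) {j : ℕ} (hj : j < k)
    (hst : Stands s.mem (j * (N + 1)) (coreEncode h p (window x (j * N) N)))
    (h19 : s.reg 19 = k - 1 - j) :
    Halts B decodeSegment s fun t s' =>
      t ≤ (24 * N + 60) * coreSteps h p (window x (j * N) N) + 12 * N + 26 ∧
      (∀ r < 20, s'.reg r = s.reg r) ∧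
      (∀ a < 4 * n, a < j * N ∨ j * N + (window x (j * N) N).length ≤ a → s'.mem a = s.mem a) ∧
      Stands s'.mem (j * N) (window x (j * N) N) := by
  have c1 := C.N_le
  have c2 := C.n_pos
  have c3 := C.big
  have hjN := S.mul_lt hj
  have hkn := S.k_le
  have hl : (window x (j * N) N).length = min N (n - j * N) := by rw [segment_length, hx]
  have hmul : j * (N + 1) = j * N + j := by ring
  rw [hmul] at hst
  clear hmul
  generalize window x (j * N) N = v at hst hl ⊢
  generalize hL : v.length = L at hl ⊢
  rw [decodeSegment]
  have hj' : k - (k - 1 - j) - 1 = j := by omega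
  simp [halts_seqs_cons, halts_arith, ArithOp.eval, R.r10, R.r1, R.r5, R.r6, R.r9, R.r14, h19, hj']
  rw [show N - (N - (n - j * N)) = L by omega]
  refine ⟨by omega, by omega, by omega, by omega, by omega, by omega, by omega, by omega, by omega, by omega,
    (halts_copyDown (dst := 4 * n) (src := j * N + j) (len := L + 1) (by omega) (by omega)
      (by omega) (by omega) ?_ ?_ ?_ ?_).mono ?_⟩
  · simp [R.r9]
  · simp
  · simp
  · simp
  rintro t₁ s₁ ⟨ht₁, hr₁, hm₁⟩
  simp only [State.setReg_mem] at hm₁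
  have f₁ : ∀ r < 20, s₁.reg r = s.reg r := fun r hr => by
    simp [hr₁ r (by omega), show r ≠ 30 by omega, show r ≠ 31 by omega, show r ≠ 27 by omega,
      show r ≠ 28 by omega, show r ≠ 37 by omega, show r ≠ 38 by omega, show r ≠ 21 by omega,
      show r ≠ 20 by omega]
  have g₁ : s₁.reg 21 = L + 1 := by simp [hr₁ 21]
  have g₁' : s₁.reg 20 = j := by simp [hr₁ 20]
  have hst₁ : Stands s₁.mem (4 * n) (coreEncode h p v) := by
    refine hst.move fun t ht => ?_
    rw [coreEncode_length C.p_lt] at ht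
    rw [hm₁, if_pos (by omega)]
    congr 1; omega
  refine (halts_decodeLoop (x := v) C (R.toCoreRegs.congr fun r hr => f₁ r (by omega)) hst₁
    (by omega) (by rw [g₁, hL])).mono ?_
  rintro t₂ s₂ ⟨ht₂, hr₂, hm₂, hst₂⟩
  have f₂ : ∀ r < 20, s₂.reg r = s.reg r := fun r hr => by rw [hr₂ r (by omega), f₁ r hr]
  have g₂ : s₂.reg 21 = L + 1 := by rw [hr₂ 21 (by omega), g₁]
  have g₂' : s₂.reg 20 = j := by rw [hr₂ 20 (by omega), g₁']
  simp [halts_seqs_singleton, g₂, g₂', f₂ 10, f₂ 14, f₂ 6, f₂ 9, R.r10, R.r14, R.r6, R.r9]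
  refine ⟨by omega, by omega, by omega,
    (halts_copyDown (dst := j * N) (src := 4 * n) (len := L) (by omega) (by omega)
      (by omega) (by omega) ?_ ?_ ?_ ?_).mono ?_⟩
  · simp [f₂ 9, R.r9]
  · simp
  · simp
  · simp
  rintro t₃ s₃ ⟨ht₃, hr₃, hm₃⟩
  simp only [State.setReg_mem] at hm₃
  refine ⟨?_, fun r hr => ?_, fun a ha ha' => ?_, ?_⟩
  · have hLN : L ≤ N := by omega
    have hle : (24 * v.length + 60) * coreSteps h p v ≤ (24 * N + 60) * coreSteps h p v :=
      Nat.mul_le_mul_right _ (by omega)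
    have ht₂' := ht₂.trans (Nat.add_le_add_right hle 5)
    clear ht₂ hle
    generalize (24 * N + 60) * coreSteps h p v = Z at ht₂' ⊢
    simp only [← Nat.add_assoc]
    omega
  · simp [hr₃ r (by omega), show r ≠ 30 by omega, show r ≠ 27 by omega, show r ≠ 28 by omega,
      f₂ r hr]
  · rw [hm₃, if_neg (by omega), hm₂ a ha, hm₁, if_neg (by omega)]
  · refine (stands_append.1 hst₂).1.move fun t ht => ?_
    rw [hm₃, if_pos (by omega)]
    congr 1; omega

/-- Decode all segments, from the first one to the last one. -/
def decodeSegments : Program := seqs [.arith .add 19 5 14, downLoop 19 decodeSegment,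
  .arith .add 0 1 14]

/-- The order is opposite to that of the encoder: decoded segments are shorter than their codewords
and stay in front of the unread ones. -/
theorem halts_decodeSegments (S : SegmentSizes q n ℓ p k N h) (C : CoreNums B q n p h N g)
    (R : SegRegs q n p k N h g s) (hx : x.length = n) (hst : Stands s.mem 0 (encode ℓ p k x)) :
    Halts B decodeSegments s fun t s' =>
      t ≤ ∑ j ∈ Finset.range k,
        ((24 * N + 60) * coreSteps h p (window x (j * N) N) + 12 * N + 28) + 3 ∧
      s'.Holds x := by
  have c1 := C.N_le
  have c2 := C.n_pos
  have c3 := C.big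
  have hkn := S.k_le
  have hk2 := S.kN_le
  rw [decodeSegments]
  simp [halts_seqs_cons, halts_arith, ArithOp.eval, R.r5, R.r14]
  refine ⟨by omega, (halts_downLoop (len := k) (fun c s' => (∀ r < 19, s'.reg r = s.reg r) ∧
    (∀ a, (k - c) * (N + 1) ≤ a → a < 4 * n → s'.mem a = s.mem a) ∧
    Stands s'.mem 0 (x.take ((k - c) * N)))
    (fun c => (24 * N + 60) * coreSteps h p (window x ((k - 1 - c) * N) N) + 12 * N + 26)
    (by omega) ?_ ?_ ?_ ?_).mono ?_⟩
  · rintro j s' ⟨hr, -⟩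
    rw [hr 9 (by omega), R.r9]
  · rintro c hc s' h19 ⟨hr, hm, hs⟩
    obtain ⟨j, hjc⟩ : ∃ j, j = k - 1 - c := ⟨_, rfl⟩
    have hj : j < k := by omega
    rw [show k - (c + 1) = j by omega] at hm hs
    rw [show k - c = j + 1 by omega, ← hjc]
    have hjN := S.mul_lt hj
    have e1 : (j + 1) * N = j * N + N := by ring
    have e2 : (j + 1) * (N + 1) = j * N + N + j + 1 := by ring
    have e3 : j * (N + 1) = j * N + j := by ring
    have hl : (window x (j * N) N).length = min N (n - j * N) := by rw [segment_length, hx]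
    refine (halts_decodeSegment (j := j) S C (R.congr fun r hr' => ?_) hx hj ?_ ?_).mono ?_
    · simp [show r ≠ 19 by omega, hr r (by omega)]
    · rw [S.encode_split hx hj, stands_append, stands_append, S.encode_take hx hj] at hst
      have := hst.2.1
      rw [Nat.zero_add] at this
      refine this.congr fun a ha ha' => ?_
      rw [coreEncode_length C.p_lt] at ha'
      exact hm a (by omega) (by omega)
    · simp; omega
    rintro t s'' ⟨ht, hr'', hm'', hst''⟩
    refine ⟨ht, ?_, fun r hr' => ?_, fun a ha ha' => ?_, ?_⟩
    · rw [hr'' 19 (by omega)]; simp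
    · simp [hr'' r (by omega), show r ≠ 19 by omega, hr r hr']
    · rw [hm'' a (by omega) (by omega)]
      exact hm a (by omega) ha'
    · rw [e1, List.take_add, stands_append]
      have htl : (x.take (j * N)).length = j * N := by rw [List.length_take]; omega
      refine ⟨hs.congr fun a _ ha => ?_, ?_⟩
      · rw [htl] at ha
        exact hm'' a (by omega) (by omega)
      · rw [htl, Nat.zero_add]
        exact hst''
  · simp
  · refine ⟨fun r hr => ?_, fun a _ _ => rfl, ?_⟩
    · simp [show r ≠ 19 by omega]
    · rw [Nat.sub_self, Nat.zero_mul, List.take_zero]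
      exact stands_nil
  · rintro t₁ s₁ ⟨ht₁, -, hr₁, -, hst₁⟩
    simp [halts_seqs_singleton, halts_arith, ArithOp.eval, hr₁ 1, hr₁ 14, R.r1, R.r14]
    -- The counter `c` of the loop belongs to the segment `k - 1 - c`.
    rw [Finset.sum_range_reflect (fun j => (24 * N + 60) * coreSteps h p (window x (j * N) N) +
      12 * N + 26 + 2)] at ht₁
    simp only [Nat.add_assoc, Nat.reduceAdd] at ht₁ ⊢
    refine ⟨by omega, by omega, ?_, fun i hi => ?_⟩
    · simp [hx]
    · rw [Nat.sub_zero, List.take_of_length_le (by rw [hx]; exact S.n_le)] at hst₁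
      have := hst₁ i hi
      rw [Nat.zero_add] at this
      simpa using this

end DecodeSegments

end PeriodAvoiding

namespace PeriodAvoiding

/-! ### The computation of the parameters -/

section Setup

variable {B q n ℓ p k N h g : ℕ} [NeZero q] {s : State}

/-- Compute `h` and a number that can replace `q ^ (ℓ / 2 - p - 1)`. -/
def setupPower : Program := seqs [.const 9 1, .const 14 0, .const 38 2, .arith .add 4 2 9,
  .arith .div 4 4 38, .arith .div 30 2 38, .arith .sub 30 30 3, .arith .sub 30 30 9, .const 31 1,
  downLoop 30 (seqs [.arith .sub 37 1 31, .ite 37 (.arith .mul 31 31 0) .skip])]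

/-- The true power may exceed a word, so multiplication stops as soon as the product reaches `n`;
the result stays at most `q * n`. There are at most `n` rounds because `h ≤ n + 1`. -/
theorem halts_setupPower (hq : 2 ≤ q) (hn : 1 ≤ n) (hh : half ℓ = h) (hhn : h ≤ n + 1)
    (hB : 20 * n + q + 20 ≤ B) (hB' : q * n < B) (h0 : s.reg 0 = q) (h1 : s.reg 1 = n)
    (h2 : s.reg 2 = ℓ) (h3 : s.reg 3 = p) :
    Halts B setupPower s fun t s' => t ≤ 5 * n + 15 ∧ s'.mem = s.mem ∧ (∀ r < 4, s'.reg r = s.reg r) ∧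
      s'.reg 4 = h ∧ s'.reg 9 = 1 ∧ s'.reg 14 = 0 ∧ s'.reg 38 = 2 ∧
      (s'.reg 31 = q ^ (ℓ / 2 - p - 1) ∨ n ≤ s'.reg 31 ∧ s'.reg 31 ≤ q ^ (ℓ / 2 - p - 1)) ∧
      s'.reg 31 ≤ q * n := by
  have hh' : (ℓ + 1) / 2 = h := hh
  have hqn : q ≤ q * n := Nat.le_mul_of_pos_right q hn
  rw [setupPower]
  simp [halts_seqs_cons, halts_seqs_singleton, halts_const, halts_arith, ArithOp.eval, h2, h3, hh']
  refine ⟨by omega, by omega, by omega, by omega, by omega, by omega, by omega, by omega, by omega,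
    (halts_downLoop_const (len := ℓ / 2 - p - 1) (fun j s' =>
      s'.mem = s.mem ∧ (∀ r < 4, s'.reg r = s.reg r) ∧
      s'.reg 4 = h ∧ s'.reg 9 = 1 ∧ s'.reg 14 = 0 ∧ s'.reg 38 = 2 ∧
      (s'.reg 31 = q ^ (ℓ / 2 - p - 1 - j) ∨
        n ≤ s'.reg 31 ∧ s'.reg 31 ≤ q ^ (ℓ / 2 - p - 1 - j)) ∧ s'.reg 31 ≤ q * n)
    3 (by omega) (fun j s' h => h.2.2.2.1) ?_ ?_ ?_).mono ?_⟩
  · rintro j hj s' h30 ⟨hm, hr, h4, h9, h14, h38, h31, hle⟩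
    have e : q ^ (ℓ / 2 - p - 1 - j) = q ^ (ℓ / 2 - p - 1 - (j + 1)) * q := by
      rw [← pow_succ]; congr 1; omega
    simp [halts_seqs_cons, halts_seqs_singleton, halts_arith, halts_ite, halts_skip, ArithOp.eval,
      hr, h0, h1, hm, h4, h9, h14, h38]
    refine ⟨by omega, fun hne => ?_, fun hge => ?_⟩
    · have h31' : s'.reg 31 = q ^ (ℓ / 2 - p - 1 - (j + 1)) := by omega
      have hmul : s'.reg 31 * q ≤ q * n := by
        rw [mul_comm q n]
        exact Nat.mul_le_mul_right q (by omega)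
      refine ⟨by omega, fun r hr' => ?_, ?_, hmul⟩
      · simp [show r ≠ 31 by omega, show r ≠ 37 by omega, show r ≠ 30 by omega, hr r hr']
      · left
        rw [e, h31']
    · have hle' : q ^ (ℓ / 2 - p - 1 - (j + 1)) ≤ q ^ (ℓ / 2 - p - 1 - j) := by
        rw [e]; exact Nat.le_mul_of_pos_right _ (by omega)
      refine ⟨fun r hr' => ?_, by omega, hle⟩
      simp [show r ≠ 37 by omega, show r ≠ 30 by omega, hr r hr']
  · simp
  · simp
    refine ⟨fun r hr => ?_, by omega⟩
    simp [show r ≠ 30 by omega, show r ≠ 31 by omega, show r ≠ 4 by omega, show r ≠ 38 by omega,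
      show r ≠ 14 by omega, show r ≠ 9 by omega]
  · rintro t s' ⟨ht, -, hrest⟩
    simp only [← Nat.add_assoc]
    refine ⟨by omega, hrest⟩

/-- Compute `k` and `N`. -/
def setupSegments : Program := seqs [.arith .add 31 31 4, .arith .sub 31 31 38,
  .arith .add 32 1 31, .arith .sub 32 32 9, .arith .div 5 32 31,
  .arith .add 32 1 5, .arith .sub 32 32 9, .arith .div 6 32 5]

/-- By `k_lt` and `le_k`, the number `k` is the quotient of `n` by `q ^ (ℓ / 2 - p - 1) + h - 2`,
rounded up. A capped power `P ≥ n` gives the right answer too, as then both values are one. -/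
theorem SegmentSizes.k_eq (S : SegmentSizes q n ℓ p k N h) (hp : 1 ≤ p) {P : ℕ} (hP1 : 1 ≤ P)
    (hP : P = q ^ (ℓ / 2 - p - 1) ∨ n ≤ P ∧ P ≤ q ^ (ℓ / 2 - p - 1)) :
    (n + (P + h - 2) - 1) / (P + h - 2) = k := by
  have h1 := S.k_lt
  have h2 := S.le_k
  have h3 := S.p_lt
  have h4 := S.n_pos
  have h5 := S.k_pos
  obtain ⟨k, rfl⟩ := Nat.exists_eq_add_of_le' h5
  rw [Nat.add_sub_cancel] at h1
  rw [Nat.succ_mul] at h2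
  rcases hP with rfl | ⟨hnP, hPq⟩
  · apply Nat.div_eq_of_lt_le
    · rw [Nat.succ_mul]; omega
    · rw [Nat.succ_mul, Nat.succ_mul]; omega
  -- Here `k` is the number of segments minus one; a further segment would contradict `n ≤ P`.
  · have hk : k = 0 := by
      by_contra hne
      have := Nat.le_mul_of_pos_left (q ^ (ℓ / 2 - p - 1) + h - 2) (Nat.pos_of_ne_zero hne)
      omega
    subst hk
    apply Nat.div_eq_of_lt_le <;> omega

theorem halts_setupSegments (S : SegmentSizes q n ℓ p k N h) (hp : 1 ≤ p) (hq : 2 ≤ q)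
    (hhn : h ≤ n + 1)
    (hB : q * n + 20 * n + q + 20 ≤ B) (h1 : s.reg 1 = n) (h4 : s.reg 4 = h) (h9 : s.reg 9 = 1)
    (h38 : s.reg 38 = 2)
    (h31 : s.reg 31 = q ^ (ℓ / 2 - p - 1) ∨ n ≤ s.reg 31 ∧ s.reg 31 ≤ q ^ (ℓ / 2 - p - 1))
    (hle : s.reg 31 ≤ q * n) :
    Halts B setupSegments s fun t s' => t = 8 ∧ s'.mem = s.mem ∧
      (∀ r < 20, r ≠ 5 → r ≠ 6 → s'.reg r = s.reg r) ∧ s'.reg 38 = 2 ∧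
      s'.reg 5 = k ∧ s'.reg 6 = N := by
  have hn := S.n_pos
  have hP1 : 1 ≤ s.reg 31 := by
    have := Nat.one_le_pow (ℓ / 2 - p - 1) q (by omega)
    omega
  have hk := S.k_eq hp hP1 h31
  have hN := S.seg_eq
  have hkn := S.k_le
  have hNk : N ≤ n + k - 1 := by rw [← hN]; exact Nat.div_le_self _ _
  rw [setupSegments]
  simp [halts_seqs_cons, halts_seqs_singleton, halts_arith, ArithOp.eval, h1, h4, h9, h38, hk, hN]
  refine ⟨by omega, by omega, by omega, by omega, by omega, by omega, by omega, by omega,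
    fun r hr hr' hr'' => ?_⟩
  simp [hr', hr'', show r ≠ 31 by omega, show r ≠ 32 by omega]

/-- Compute the size of the table and the layout of the memory. -/
def setupTable : Program := seqs [.arith .add 10 1 1, .arith .add 10 10 10, .arith .add 11 10 10,
  .arith .add 12 11 10, .arith .add 13 6 9, .arith .add 13 13 3, .const 7 1, .const 8 0,
  .arith .add 33 6 38, .arith .sub 33 33 4, .arith .sub 34 33 7,
  .loop 34 (seqs [.arith .mul 7 7 0, .arith .add 8 8 9, .arith .sub 34 33 7])]

theorem SegmentSizes.N_le (S : SegmentSizes q n ℓ p k N h) : N ≤ n := by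
  rw [← S.seg_eq]
  have := S.k_pos
  have := S.n_pos
  rw [Nat.div_le_iff_le_mul_add_pred (by omega)]
  have := Nat.le_mul_of_pos_left n (show 0 < k by omega)
  omega

/-- The loop stops at the first power of `q` that is at least the number of windows, which is
`Nat.clog`. Its exponent is at most `h - p - 1`, so the loop is short and `g` symbols fit into any
comparison. -/
theorem halts_setupTable (S : SegmentSizes q n ℓ p k N h) (hg : Nat.clog q (N + 2 - h) = g) (hp : 1 ≤ p) (hq : 2 ≤ q)
    (hB : q * n + 20 * n + q + 20 ≤ B) (hB' : q * (q * n) ≤ B) (h0 : s.reg 0 = q)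
    (h1 : s.reg 1 = n) (h3 : s.reg 3 = p) (h4 : s.reg 4 = h) (h5 : s.reg 5 = k) (h6 : s.reg 6 = N)
    (h9 : s.reg 9 = 1) (h14 : s.reg 14 = 0) (h38 : s.reg 38 = 2) :
    Halts B setupTable s fun t s' => t ≤ 4 * n + 12 ∧ s'.mem = s.mem ∧
      CoreNums B q n p h N g ∧ SegRegs q n p k N h g s' := by
  have hn := S.n_pos
  have hNn := S.N_le
  have hhN := S.h_le
  have hph := S.p_lt
  have hwin := S.windows_le
  have hgh : g ≤ h - p - 1 := by
    rw [← hg]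
    exact Nat.clog_le_of_le_pow hwin
  rw [setupTable]
  simp [halts_seqs_cons, halts_seqs_singleton, halts_arith, halts_const, ArithOp.eval, h1, h3, h4,
    h6, h9, h38]
  refine ⟨by omega, by omega, by omega, by omega, by omega, by omega, by omega, by omega, by omega, by omega, by omega,
    (halts_loop (fun b s' => s'.mem = s.mem ∧ ∃ t, t ≤ g ∧ s'.reg 7 = q ^ t ∧
      s'.reg 8 = t ∧ q ^ t ≤ q * N ∧ s'.reg 33 = N + 2 - h ∧ s'.reg 34 = N + 2 - h - q ^ t ∧
      s'.reg 10 = 4 * n ∧ s'.reg 11 = 8 * n ∧ s'.reg 12 = 12 * n ∧ s'.reg 13 = N + 1 + p ∧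
      (∀ r < 7, s'.reg r = s.reg r) ∧ s'.reg 9 = 1 ∧ s'.reg 14 = 0 ∧ b = 4 * (g - t) + 1)
    (fun s' => s'.mem = s.mem ∧ CoreNums B q n p h N g ∧ SegRegs q n p k N h g s')
    ?_ ?_ (b := 4 * g + 1) ?_).mono ?_⟩
  · rintro b s' ⟨hm, t, ht, h7, h8, htN, h33, h34, h10, h11, h12, h13, hr, h9', h14', hb⟩ hz
    have hqN : q * N ≤ q * n := Nat.mul_le_mul_left q hNn
    have hqq : q * q ^ t ≤ q * (q * n) := Nat.mul_le_mul_left q (htN.trans hqN)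
    have htg : t = g := by
      refine le_antisymm ht ?_
      rw [← hg]
      exact Nat.clog_le_of_le_pow (by omega)
    subst htg
    refine ⟨by omega, hm, ⟨hq, hp, hph, hhN, hNn, hn, by omega, by omega, hwin, by omega,
      by omega, by omega⟩, ⟨⟨?_, ?_, ?_, h7, h8, h9', h10, h11, h12, h13, h14'⟩, ?_, ?_, ?_⟩⟩
    · rw [hr 0 (by omega), h0]
    · rw [hr 3 (by omega), h3]
    · rw [hr 4 (by omega), h4]
    · rw [hr 1 (by omega), h1]
    · rw [hr 5 (by omega), h5]
    · rw [hr 6 (by omega), h6]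
  · rintro b s' ⟨hm, t, ht, h7, h8, htN, h33, h34, h10, h11, h12, h13, hr, h9', h14', hb⟩ hz
    have hlt : q ^ t < N + 2 - h := by omega
    have htlt : t < g := by
      rw [← hg]
      exact (Nat.lt_clog_iff_pow_lt hq).2 hlt
    have hmul : q ^ t * q ≤ q * N := by
      rw [mul_comm]
      exact Nat.mul_le_mul_left q (by omega)
    have hqN : q * N ≤ q * n := Nat.mul_le_mul_left q hNn
    simp [halts_seqs_cons, halts_seqs_singleton, halts_arith, ArithOp.eval, hr, h0, h7, h8, h9', hm,
      h33, h10, h11, h12, h13, h14']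
    refine ⟨by omega, by omega, by omega, by omega, by omega, (pow_succ ..).symm, by rwa [pow_succ], by rw [pow_succ],
      fun r hr' => ?_⟩
    simp [show r ≠ 34 by omega, show r ≠ 7 by omega, show r ≠ 8 by omega, hr r hr']
  · refine ⟨by simp, 0, by omega, by simp, by simp, ?_, by simp, by simp, ?_, ?_, ?_, by simp,
      fun r hr => ?_, by simp [h9], by simp [h14], by simp⟩
    · have := Nat.le_mul_of_pos_right q S.N_pos
      simp
      omega
    · simp; omega
    · simp; omega
    · simp; omega
    · simp [show r ≠ 34 by omega, show r ≠ 33 by omega, show r ≠ 8 by omega, show r ≠ 7 by omega,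
        show r ≠ 13 by omega, show r ≠ 12 by omega, show r ≠ 11 by omega, show r ≠ 10 by omega]
  · rintro t s' ⟨ht, -, hrest⟩
    simp only [← Nat.add_assoc]
    exact ⟨by omega, hrest⟩

/-- Compute all parameters. -/
def setup : Program := seqs [setupPower, setupSegments, setupTable]

theorem halts_setup (S : SegmentSizes q n ℓ p k N h) (hg : Nat.clog q (N + 2 - h) = g)
    (hp : 1 ≤ p) (hq : 2 ≤ q)
    (hB : q * n + 20 * n + q + 20 ≤ B) (hB' : q * (q * n) ≤ B) (h0 : s.reg 0 = q)
    (h1 : s.reg 1 = n) (h2 : s.reg 2 = ℓ) (h3 : s.reg 3 = p) :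
    Halts B setup s fun t s' => t ≤ 9 * n + 35 ∧ s'.mem = s.mem ∧
      CoreNums B q n p h N g ∧ SegRegs q n p k N h g s' := by
  have hhn : h ≤ n + 1 := by have := S.h_le; have := S.N_le; omega
  rw [setup, halts_seqs_cons]
  refine (halts_setupPower (p := p) hq S.n_pos S.half_eq hhn (by omega) (by omega) h0 h1 h2 h3).mono ?_
  rintro t₁ s₁ ⟨ht₁, hm₁, hr₁, h4, h9, h14, h38, h31, hle⟩
  rw [halts_seqs_cons]
  refine (halts_setupSegments S hp hq hhn hB (by rw [hr₁ 1 (by omega), h1]) h4 h9 h38 h31 hle).mono ?_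
  rintro t₂ s₂ ⟨ht₂, hm₂, hr₂, h38', h5, h6⟩
  have f₂ : ∀ r < 4, s₂.reg r = s.reg r := fun r hr => by
    rw [hr₂ r (by omega) (by omega) (by omega), hr₁ r hr]
  rw [halts_seqs_singleton]
  refine (halts_setupTable S hg hp hq hB hB' (by rw [f₂ 0 (by omega), h0])
    (by rw [f₂ 1 (by omega), h1]) (by rw [f₂ 3 (by omega), h3])
    (by rw [hr₂ 4 (by omega) (by omega) (by omega), h4]) h5 h6
    (by rw [hr₂ 9 (by omega) (by omega) (by omega), h9])
    (by rw [hr₂ 14 (by omega) (by omega) (by omega), h14]) h38').mono ?_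
  rintro t₃ s₃ ⟨ht₃, hm₃, hrest⟩
  exact ⟨by omega, by rw [hm₃, hm₂, hm₁], hrest⟩

end Setup

end PeriodAvoiding

namespace PeriodAvoiding

/-! ### The programs and their average running time -/

section Average

variable {B q n ℓ p k N h g : ℕ} [NeZero q] {s : State} {x : List (Fin q)}

/-- The program of the encoder. -/
def encoder : Program := seqs [setup, encodeSegments]

/-- The program of the decoder. -/
def decoder : Program := seqs [setup, decodeSegments]

theorem stands_start (params : List ℕ) (x : List (Fin q)) :
    Stands (State.start params x).mem 0 x := by
  intro i hi
  simp [State.start, hi]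

/-- The words have to hold the addresses up to `12 * n + q ^ g` and the product `q * q ^ g` of the
rolling code, where `q ^ g ≤ q * n`. Since `n + q ≥ 3`, spare factors of `n + q` absorb the
constants. -/
theorem word_size_bounds (hn : 1 ≤ n) (hq : 2 ≤ q) :
    q * n + 20 * n + q + 20 ≤ (n + q) ^ 6 ∧ q * (q * n) ≤ (n + q) ^ 6 := by
  have h3 : 3 ≤ n + q := by omega
  have h1 : q * n ≤ (n + q) ^ 2 := by nlinarith
  have h2 : q * (q * n) ≤ (n + q) ^ 3 := by
    calc q * (q * n) ≤ (n + q) * (n + q) ^ 2 := Nat.mul_le_mul (by omega) h1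
      _ = (n + q) ^ 3 := by ring
  have h4 : (n + q) ^ 3 * 27 ≤ (n + q) ^ 6 := by
    calc (n + q) ^ 3 * 27 ≤ (n + q) ^ 3 * (n + q) ^ 3 :=
          Nat.mul_le_mul_left _ (by simpa using Nat.pow_le_pow_left h3 3)
      _ = (n + q) ^ 6 := by ring
  have h5 : (n + q) ^ 2 * 3 ≤ (n + q) ^ 3 := by
    rw [pow_succ (n + q) 2]
    exact Nat.mul_le_mul_left _ h3
  have h6 : (n + q) * 3 ≤ (n + q) ^ 2 := by
    rw [sq]
    exact Nat.mul_le_mul_left _ h3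
  constructor <;> omega

theorem halts_encoder (S : SegmentSizes q n ℓ p k N h) (hg : Nat.clog q (N + 2 - h) = g)
    (hp : 1 ≤ p) (hq : 2 ≤ q) (hx : x.length = n) :
    Halts ((n + q) ^ 6) encoder (State.start [q, n, ℓ, p] x) fun t s' =>
      t ≤ 9 * n + 38 + ∑ j ∈ Finset.range k,
        (∑ τ ∈ Finset.range (coreSteps h p (window x (j * N) N) + 1),
          stateCost g h p (coreState h p (window x (j * N) N) τ) + 12 * N + 28) ∧
      s'.Holds (encode ℓ p k x) := by
  have hB := word_size_bounds S.n_pos hq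
  rw [encoder, halts_seqs_cons]
  refine (halts_setup S hg hp hq hB.1 hB.2 rfl rfl rfl rfl).mono ?_
  rintro t₁ s₁ ⟨ht₁, hm₁, C, R⟩
  rw [halts_seqs_singleton]
  refine (halts_encodeSegments S C R hx (by rw [hm₁]; exact stands_start _ x)).mono ?_
  rintro t₂ s₂ ⟨ht₂, hs₂⟩
  exact ⟨by omega, hs₂⟩

theorem halts_decoder (S : SegmentSizes q n ℓ p k N h) (hp : 1 ≤ p) (hq : 2 ≤ q)
    (hx : x.length = n) :
    Halts ((n + q) ^ 6) decoder (State.start [q, n, ℓ, p] (encode ℓ p k x)) fun t s' =>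
      t ≤ 9 * n + 38 + ∑ j ∈ Finset.range k,
        ((24 * N + 60) * coreSteps h p (window x (j * N) N) + 12 * N + 28) ∧
      s'.Holds x := by
  have hB := word_size_bounds S.n_pos hq
  rw [decoder, halts_seqs_cons]
  refine (halts_setup S rfl hp hq hB.1 hB.2 rfl rfl rfl rfl).mono ?_
  rintro t₁ s₁ ⟨ht₁, hm₁, C, R⟩
  rw [halts_seqs_singleton]
  refine (halts_decodeSegments S C R hx (by rw [hm₁]; exact stands_start _ _)).mono ?_
  rintro t₂ s₂ ⟨ht₂, hs₂⟩
  exact ⟨by omega, hs₂⟩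

/-- The previous power of `q` is below the number of windows, which is at most `N` because `h ≥ 2`.
So clearing the table is linear in `N` for fixed `q`. -/
theorem pow_clog_le (hq : 2 ≤ q) (S : SegmentSizes q n ℓ p k N h) (hp : 1 ≤ p) :
    q ^ Nat.clog q (N + 2 - h) ≤ q * N := by
  have h1 := S.p_lt
  have h2 := S.h_le
  rcases Nat.eq_zero_or_pos (Nat.clog q (N + 2 - h)) with h0 | h0
  · rw [h0, pow_zero]
    have := Nat.le_mul_of_pos_left N (show 0 < q by omega)
    omega
  · have h3 : q ^ (Nat.clog q (N + 2 - h) - 1) < N + 2 - h :=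
      (Nat.lt_clog_iff_pow_lt hq).1 (by omega)
    obtain ⟨c, hc⟩ := Nat.exists_eq_add_of_le' h0
    rw [hc, pow_succ, mul_comm]
    rw [hc] at h3
    exact Nat.mul_le_mul_left q (by simp at h3; omega)

/-- Only the comparisons depend on the word; `sum_matchCost_le` turns `26` times their number into
the term `52 * p`. -/
theorem sum_stateCost_le (hq : 2 ≤ q) {m : ℕ} (hA : m + 1 - h ≤ q ^ g) (hg : g ≤ h) (hp : p ≤ h) :
    ∑ y : Fin m → Fin q, stateCost g h p (List.ofFn y) ≤
      (52 * p + 41 * m + 4 * q ^ g + 37) * q ^ m := by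
  have h1 := sum_matchCost_le hq le_rfl hA hg hp
  have h2 : ∑ y : Fin m → Fin q, stateCost g h p (List.ofFn y) =
      26 * ∑ y : Fin m → Fin q, matchCost g h p (m + 1 - h) (List.ofFn y) +
        (41 * m + 4 * q ^ g + 37) * q ^ m := by
    simp only [stateCost, List.length_ofFn, add_assoc, Finset.sum_add_distrib, ← Finset.mul_sum]
    simp
    ring
  rw [h2]
  calc _ ≤ 26 * (2 * p * q ^ m) + (41 * m + 4 * q ^ g + 37) * q ^ m := by gcongr
    _ = _ := by ring

theorem pow_mul_pow_segment {j : ℕ} (a : ℕ) :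
    q ^ (n - min N (n - j * N)) * (a * q ^ (min N (n - j * N) + 1)) = a * (q * q ^ n) := by
  have : n = (n - min N (n - j * N)) + min N (n - j * N) := by omega
  conv_rhs => rw [this]
  rw [pow_add, pow_succ]
  ring

/-- With `p ≤ N`, words of length at most `N + 1` and `N ≥ 1`, the constant is `171 = 52 + 2 * 41 +
37`; the table gives `4 * q`, and the last factor `q` is the average number of states. -/
theorem sum_encode_segment_le (hq : 2 ≤ q) (hp : 1 ≤ p) (S : SegmentSizes q n ℓ p k N h)
    (hg : Nat.clog q (N + 2 - h) = g) {j : ℕ} (hj : j < k) :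
    ∑ x : Fin n → Fin q,
      ∑ τ ∈ Finset.range (coreSteps h p (window (List.ofFn x) (j * N) N) + 1),
        stateCost g h p (coreState h p (window (List.ofFn x) (j * N) N) τ) ≤
      (171 + 4 * q) * N * (q * q ^ n) := by
  have h1 := S.p_lt
  have h2 := S.h_le
  have h3 := S.windows_le
  have hN := S.N_pos
  have hgN : q ^ g ≤ q * N := hg ▸ pow_clog_le hq S hp
  have hgh : g ≤ h - p - 1 := by
    rw [← hg]
    exact Nat.clog_le_of_le_pow h3
  have hwg : N + 2 - h ≤ q ^ g := by
    rw [← hg]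
    exact Nat.le_pow_clog hq _
  refine (sum_segment_states_le hq S hj _).trans ?_
  refine (Nat.mul_le_mul_left _ (sum_stateCost_le (g := g) hq (le_trans (by omega) hwg)
    (by omega) (by omega))).trans ?_
  rw [pow_mul_pow_segment]
  refine Nat.mul_le_mul_right _ ?_
  have : (171 + 4 * q) * N = 171 * N + 4 * (q * N) := by ring
  rw [this]
  omega

/-- The bound on all states with the constant cost one. -/
theorem sum_coreSteps_le (hq : 2 ≤ q) (S : SegmentSizes q n ℓ p k N h) {j : ℕ} (hj : j < k) :
    ∑ x : Fin n → Fin q, coreSteps h p (window (List.ofFn x) (j * N) N) ≤ q * q ^ n := by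
  have := sum_segment_states_le hq S hj fun _ => 1
  simp only [Finset.sum_const, Finset.card_range, Finset.card_univ, Fintype.card_pi,
    Fintype.card_fin, Finset.prod_const, smul_eq_mul, mul_one] at this
  have e := pow_mul_pow_segment (q := q) (n := n) (N := N) (j := j) 1
  rw [one_mul, one_mul] at e
  rw [e] at this
  exact le_trans (Finset.sum_le_sum fun x _ => Nat.le_succ _) this

/-- If the average cost of each segment is at most `a * N`, then the average total cost is linear. -/
theorem sum_segments_le (S : SegmentSizes q n ℓ p k N h) (a : ℕ)
    (F : ℕ → (Fin n → Fin q) → ℕ) (hF : ∀ j < k, ∑ x, F j x ≤ a * N * (q * q ^ n)) :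
    ∑ x, (9 * n + 38 + ∑ j ∈ Finset.range k, (F j x + 12 * N + 28)) ≤
      (2 * a * q + 99) * n * q ^ n := by
  have hk := S.k_le
  have hkN := S.kN_le
  have hn := S.n_pos
  have h1 : ∑ x, ∑ j ∈ Finset.range k, F j x ≤ k * (a * N * (q * q ^ n)) := by
    rw [Finset.sum_comm]
    simpa using Finset.sum_le_card_nsmul _ _ _ fun j hj => hF j (Finset.mem_range.1 hj)
  have h2 : ∑ x, (9 * n + 38 + ∑ j ∈ Finset.range k, (F j x + 12 * N + 28)) =
      (9 * n + 38 + 12 * (k * N) + 28 * k) * q ^ n + ∑ x, ∑ j ∈ Finset.range k, F j x := by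
    simp only [Finset.sum_add_distrib]
    simp
    ring
  rw [h2]
  calc _ ≤ (99 * n) * q ^ n + a * (2 * n) * (q * q ^ n) := by
        -- The constant is `99 = 9 + 38 + 2 * 12 + 28`, by `1 ≤ n`, `k * N < 2 * n` and `k ≤ n`.
        refine add_le_add (Nat.mul_le_mul_right _ (by omega)) (h1.trans ?_)
        calc _ = a * (k * N) * (q * q ^ n) := by ring
          _ ≤ _ := by gcongr
    _ = _ := by ring

end Average

end PeriodAvoiding

/-! ### Assembly of the theorem -/

theorem mainTheorem7 :
    ∃ (encoder decoder : PeriodAvoiding.Program) (c : ℕ),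
      ∀ (q : ℕ) [NeZero q], 2 ≤ q → ∃ C : ℕ,
        ∀ (n ℓ p k : ℕ), 1 ≤ p → 2 * (p + 1) ≤ ℓ → PeriodAvoiding.IsSegmentCount q n ℓ p k →
          -- the loop of the core encoder ends on every segment of every message
          (∀ x : Fin n → Fin q, ∀ s ∈ PeriodAvoiding.segments k (List.ofFn x),
            PeriodAvoiding.CoreTerminates (PeriodAvoiding.half ℓ) p s) ∧
          -- the code is an LPA code of length `n + k`
          (∀ x : Fin n → Fin q,
            PeriodAvoiding.encode ℓ p k (List.ofFn x) ∈ PeriodAvoiding.lpaWords q (n + k) ℓ p) ∧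
          -- distinct messages have distinct codewords
          (Function.Injective fun x : Fin n → Fin q =>
            PeriodAvoiding.encode ℓ p k (List.ofFn x)) ∧
          -- encoding in linear average time
          (∃ T : (Fin n → Fin q) → ℕ,
            (∀ x, encoder.Computes ((n + q) ^ c) [q, n, ℓ, p] (List.ofFn x) (T x)
              (PeriodAvoiding.encode ℓ p k (List.ofFn x))) ∧
            ∑ x, T x ≤ C * n * q ^ n) ∧
          -- decoding in linear average time
          (∃ T : (Fin n → Fin q) → ℕ,
            (∀ x, decoder.Computes ((n + q) ^ c) [q, n, ℓ, p]
              (PeriodAvoiding.encode ℓ p k (List.ofFn x)) (T x) (List.ofFn x)) ∧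
            ∑ x, T x ≤ C * n * q ^ n) := by
  refine ⟨PeriodAvoiding.encoder, PeriodAvoiding.decoder, 6, fun q _ hq =>
    ⟨2 * (171 + 4 * q) * q + 99, fun n ℓ p k hp hl hk => ?_⟩⟩
  have S := hk.sizes hq hp hl
  have hlen (x : Fin n → Fin q) : (List.ofFn x).length = n := List.length_ofFn
  choose T sE hTE hT using fun x : Fin n → Fin q =>
    PeriodAvoiding.halts_encoder S rfl hp hq (hlen x)
  choose T' sD hTD hT' using fun x : Fin n → Fin q =>
    PeriodAvoiding.halts_decoder S hp hq (hlen x)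
  refine ⟨fun x s hs => S.coreTerminates hq (S.mem_segments_length (hlen x) hs),
    fun x => S.encode_mem hq (hlen x), fun x x' hxx => ?_,
    ⟨T, fun x => ⟨sE x, hTE x, (hT x).2⟩, ?_⟩, ⟨T', fun x => ⟨sD x, hTD x, (hT' x).2⟩, ?_⟩⟩
  -- Injectivity comes from the decoder: equal codewords give equal final states by determinism, and
  -- the state holds the message.
  · have h1 := hTD x
    have h2 := hTD x'
    simp only at hxx
    rw [hxx] at h1
    have hs : sD x = sD x' := h1.deterministic h2
    have hx := (hT' x).2
    rw [hs] at hx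
    refine List.ofFn_injective (List.ext_getElem (by simp) fun i hi hi' => Fin.ext ?_)
    rw [← hx.2 i hi, ← (hT' x').2.2 i hi']
  · refine (Finset.sum_le_sum fun x _ => (hT x).1).trans ?_
    exact PeriodAvoiding.sum_segments_le S _ _ fun j hj =>
      PeriodAvoiding.sum_encode_segment_le hq hp S rfl hj
  · refine (Finset.sum_le_sum fun x _ => (hT' x).1).trans ?_
    -- Undoing one repair costs at most `24 * N + 60 ≤ 84 * N`, as `N ≥ 1`; the resulting constant
    -- is below the one for the encoder.
    refine (PeriodAvoiding.sum_segments_le S 84 _ fun j hj => ?_).trans ?_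
    · rw [← Finset.mul_sum]
      have hN := S.N_pos
      exact Nat.mul_le_mul (by omega) (PeriodAvoiding.sum_coreSteps_le hq S hj)
    · gcongr
      omega
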